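/- Let $p\neq l$ be primes, let $K$ be a finite extension of $\mathbb{Q}_p$ with residue field of $q$ elements, let $G_K=\mathrm{Gal}(\bar K/K)$, and let $P\subset I\subset G_K$ be the wild inertia and inertia subgroups. Let $L$ be a finite extension of $\mathbb{Q}_l$ with ring of integers $\mathcal{O}$ and residue field $\mathbb{F}$. For an integer $i$ write $(i)$ for the twist by the $i$-th power of the unramified character sending (arithmetic) Frobenius to $q$, i.e. of the $l$-adic cyclotomic character. Fix a lift $\mathrm{Frob}\in G_K$ of arithmetic Frobenius and a topological generator $s$ of $I/P$ (lifted to $I$), let $W^0\subset G_K$ be the subgroup generated by $\mathrm{Frob}$, $s$ and $P$, and put $I^0=I\cap W^0$. Let $n\ge 1$ and $d\mid n$, put $m=n/d$, and assume that $l$ is greater than the Coxeter number of $\mathrm{GL}_n$, that is, $l>n$. Let $\tilde r:G_K\to \mathrm{GL}_d(\mathcal{O})$ be a continuous representation such that 1. $\tilde r\otimes\mathbb{F}$ is absolutely irreducible; 2. every irreducible subquotient of $(\tilde r\otimes\mathbb{F})|_I$ is absolutely irreducible; 3. $\tilde r\otimes\mathbb{F}\not\cong(\tilde r\otimes\mathbb{F})(i)$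 for $i=1,\dots,m$. For an $\mathcal{O}$-algebra $R$, call a homomorphism $\rho:W^0\to\mathrm{GL}_n(R)$ $\tilde r$-discrete series if there is a decreasing filtration $R^n=\mathrm{Fil}^0\supseteq\mathrm{Fil}^1\supseteq\dots\supseteq\mathrm{Fil}^m=0$ by $W^0$-stable $R$-direct summands with $\mathrm{gr}^i\cong\mathrm{gr}^0(i)$ for $0\le i\le m-1$ and $\mathrm{gr}^0|_{I^0}\cong\tilde r|_{I^0}\otimes_{\mathcal{O}}R$. Let $X_{\tilde r,n}$ be the moduli space over $\mathcal{O}$ of framed $\tilde r$-discrete series representations of rank $n$: its $R$-points, for an $\mathcal{O}$-algebra $R$, are the homomorphisms $\rho:W^0\to\mathrm{GL}_n(R)$ whose restriction to $P$ has open kernel and which are $\tilde r$-discrete series Zariski-locally on $\mathrm{Spec}\,R$. Then the generic fibre $(X_{\tilde r,n})_L$ is smooth over $L$. Precisely: the restriction of the functor $X_{\tilde r,n}$ to $L$-algebras is represented by a smooth $L$-algebra; and for every $\mathcal{O}$-scheme $X$ representing the functor $X_{\tilde r,n}$ on $\mathcal{O}$-algebras, the base change $X\times_{\mathcal{O}}L$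 is smooth over $L$. -/

import Mathlib

open CategoryTheory AlgebraicGeometry CategoryTheory.Limits

universe u v w

noncomputable section

namespace DiscreteSeries

/-! ### Representations -/

section Representations

variable {k G V : Type*} [Monoid G]

/-- The representation on column vectors attached to a homomorphism into `GL_n`. -/
def toRep [CommRing k] {n : ℕ} (ρ : G →* GL (Fin n) k) : Representation k G (Fin n → k) :=
  ((Units.coeHom _).comp Matrix.GeneralLinearGroup.toLin.toMonoidHom).comp ρ

/-- The subquotient `A / B` of a representation, for subrepresentations `B ≤ A`. -/
def subquotient [CommRing k] [AddCommGroup V] [Module k V] {ρ : Representation k G V}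
    (A B : Subrepresentation ρ) :
    Representation k G (A.toSubmodule ⧸ B.toSubmodule.submoduleOf A.toSubmodule) :=
  A.toRepresentation.quotient _ fun g x hx => B.apply_mem_toSubmodule g (v := (x : V)) hx

/-- The twist `ρ ⊗ χ` of a representation by a character. -/
def twist [CommRing k] [AddCommGroup V] [Module k V] (ρ : Representation k G V) (χ : G →* kˣ) :
    Representation k G V where
  toFun g := (χ g : k) • ρ g
  map_one' := by simp
  map_mul' g h := by
    ext x
    simp [mul_smul, smul_comm (χ h : k) (χ g : k)]

/-- Absolute irreducibility: the base change to an algebraic closure is irreducible. -/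
def IsAbsolutelyIrreducible [Field k] [AddCommGroup V] [Module k V]
    (ρ : Representation k G V) : Prop :=
  Representation.IsIrreducible (k := AlgebraicClosure k)
    ((Module.End.baseChangeHom k (AlgebraicClosure k) V).toMonoidHom.comp ρ)

end Representations

/-! ### The Galois group of a local field

Here `OK` is the ring of integers of the local field `K`. -/

section Galois

variable (OK : Type*) [CommRing OK] (K : Type*) [Field K] [Algebra OK K]

/-- The ring of integers of the algebraic closure of `K`. -/
abbrev intBar : Type _ := integralClosure OK (AlgebraicClosure K)

/-- The maximal ideal of the (local) ring of integers of the algebraic closure of `K`. -/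
def maxBar : Ideal (intBar OK K) := Ideal.jacobson ⊥

/-- The inertia subgroup: the automorphisms acting trivially on the residue field of the
algebraic closure. -/
def inertiaGroup : Subgroup Gal(AlgebraicClosure K/K) :=
  (maxBar OK K).toAddSubgroup.inertia Gal(AlgebraicClosure K/K)

theorem smul_mem_maxBar (σ : Gal(AlgebraicClosure K/K)) {y : intBar OK K}
    (hy : y ∈ maxBar OK K) : σ • y ∈ maxBar OK K := by
  rw [maxBar, Ideal.mem_jacobson_bot] at hy ⊢
  intro z
  have h := (hy (σ⁻¹ • z)).map (MulSemiringAction.toRingHom Gal(AlgebraicClosure K/K)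
    (intBar OK K) σ)
  simpa using h

/-- The wild inertia subgroup: the automorphisms `σ` with `σ x / x ≡ 1` modulo the maximal ideal,
for every nonzero `x` in the algebraic closure. -/
def wildInertia : Subgroup Gal(AlgebraicClosure K/K) where
  carrier := {σ | ∀ x : AlgebraicClosure K, ∃ y ∈ maxBar OK K, σ x = x * (1 + (y : intBar OK K))}
  one_mem' x := ⟨0, zero_mem _, by simp⟩
  mul_mem' {σ τ} hσ hτ x := by
    obtain ⟨y, hy, hxy⟩ := hτ x
    obtain ⟨z, hz, hxz⟩ := hσ x
    refine ⟨z + σ • y + z * σ • y, add_mem (add_mem hz (smul_mem_maxBar OK K σ hy))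
      (Ideal.mul_mem_right _ _ hz), ?_⟩
    have h1 : ((σ • y : intBar OK K) : AlgebraicClosure K) = σ (y : AlgebraicClosure K) := rfl
    simp only [AlgEquiv.mul_apply, hxy, map_mul, map_add, map_one, hxz]
    push_cast
    rw [h1]
    ring
  inv_mem' {σ} hσ x := by
    obtain ⟨y, hy, hxy⟩ := hσ x
    have hy' := smul_mem_maxBar OK K σ⁻¹ hy
    obtain ⟨u, hu⟩ := (Ideal.mem_jacobson_bot.mp hy') 1
    have hu' : (1 + ((σ⁻¹ • y : intBar OK K) : AlgebraicClosure K)) *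
        ((u⁻¹ : (intBar OK K)ˣ) : intBar OK K) = 1 := by
      have h := congrArg (fun t : intBar OK K => (t : AlgebraicClosure K)) u.mul_inv
      rw [hu] at h
      push_cast at h
      linear_combination h
    refine ⟨-(σ⁻¹ • y) * ((u⁻¹ : (intBar OK K)ˣ) : intBar OK K),
      Ideal.mul_mem_right _ _ (neg_mem hy'), ?_⟩
    have h1 : ((σ⁻¹ • y : intBar OK K) : AlgebraicClosure K) = σ⁻¹ (y : AlgebraicClosure K) := rfl
    have h2 : x = σ⁻¹ x * (1 + ((σ⁻¹ • y : intBar OK K) : AlgebraicClosure K)) := by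
      have h := congrArg (fun t => σ⁻¹ t) hxy
      simp only [map_mul, map_add, map_one] at h
      rw [h1, ← h]
      exact (σ.symm_apply_apply x).symm
    push_cast
    linear_combination (-1) * ((u⁻¹ : (intBar OK K)ˣ) : intBar OK K) * h2
      - (σ⁻¹ x - x) * hu'

/-- `σ` is a topological generator of the tame inertia group `I / P`. -/
def IsTameGenerator (σ : Gal(AlgebraicClosure K/K)) : Prop :=
  (Subgroup.closure {σ} ⊔ wildInertia OK K).topologicalClosure = inertiaGroup OK K

/-- `σ` is a lift of the arithmetic Frobenius `x ↦ x ^ q`. -/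
def IsFrobeniusLift (σ : Gal(AlgebraicClosure K/K)) : Prop :=
  IsArithFrobAt OK σ (maxBar OK K)

/-- The discretized Weil group `W⁰`: the preimage in the Weil group of the subgroup of `W / P`
generated by a Frobenius lift `φ` and a topological generator `s` of tame inertia. -/
def weilGroup (φ s : Gal(AlgebraicClosure K/K)) : Subgroup Gal(AlgebraicClosure K/K) :=
  Subgroup.closure {φ, s} ⊔ wildInertia OK K

/-- The inertia subgroup of `W⁰`. -/
def weilInertia (φ s : Gal(AlgebraicClosure K/K)) : Subgroup (weilGroup OK K φ s) :=
  (inertiaGroup OK K).subgroupOf (weilGroup OK K φ s)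

/-- The `l`-adic cyclotomic character with values in a `ℤ_l`-algebra. When `l` is not the residue
characteristic of `K`, this is the unramified character with arithmetic Frobenius `↦ q`; the twist
`(i)` is the twist by its `i`-th power. -/
def cycChar (l : ℕ) [Fact l.Prime] (O : Type*) [CommRing O] [Algebra ℤ_[l] O] :
    Gal(AlgebraicClosure K/K) →* Oˣ :=
  (Units.map (algebraMap ℤ_[l] O : ℤ_[l] →* O)).comp
    ((cyclotomicCharacter (AlgebraicClosure K) l).comp
      (MulSemiringAction.toRingAut Gal(AlgebraicClosure K/K) (AlgebraicClosure K)))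

end Galois

/-! ### The type `r` and `r`-discrete series -/

section Types

variable (OK : Type*) [CommRing OK] (K : Type*) [Field K] [Algebra OK K]
  (l : ℕ) [Fact l.Prime] {O : Type*} [CommRing O] [Algebra ℤ_[l] O] {d : ℕ}

/-- Base change of a homomorphism into `GL_n` along a ring homomorphism. -/
def mapGL {G R R' : Type*} [Monoid G] [CommRing R] [CommRing R'] {n : ℕ} (f : R →+* R')
    (ρ : G →* GL (Fin n) R) : G →* GL (Fin n) R' :=
  (Matrix.GeneralLinearGroup.map f).comp ρ

/-- Continuity of `r : Gal → GL_d(O)` for the topology of `O` defined by its maximal ideal. -/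
def IsAdicContinuous [IsLocalRing O] (r : Gal(AlgebraicClosure K/K) →* GL (Fin d) O) : Prop :=
  ∀ N : ℕ, ∃ U : Subgroup Gal(AlgebraicClosure K/K), IsOpen (U : Set Gal(AlgebraicClosure K/K)) ∧
    ∀ g ∈ U, ∀ i j, (r g : Matrix (Fin d) (Fin d) O) i j - (1 : Matrix (Fin d) (Fin d) O) i j ∈
      IsLocalRing.maximalIdeal O ^ N

/-- The reduction of `r` modulo the maximal ideal. -/
def reduction [IsLocalRing O] (r : Gal(AlgebraicClosure K/K) →* GL (Fin d) O) :
    Representation (IsLocalRing.ResidueField O) Gal(AlgebraicClosure K/K)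
      (Fin d → IsLocalRing.ResidueField O) :=
  toRep (mapGL (IsLocalRing.residue O) r)

/-- The conditions on `r` under which `r`-discrete series of rank `m * d` are considered. -/
structure IsDiscreteSeriesType [IsLocalRing O] (m : ℕ)
    (r : Gal(AlgebraicClosure K/K) →* GL (Fin d) O) : Prop where
  continuous : IsAdicContinuous K r
  absolutelyIrreducible : IsAbsolutelyIrreducible (reduction K r)
  inertia_subquotients : ∀ A B : Subrepresentation
      ((reduction K r).comp (inertiaGroup OK K).subtype), B ≤ A →
    (subquotient A B).IsIrreducible → IsAbsolutelyIrreducible (subquotient A B)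
  not_equiv_twist : ∀ i : ℕ, 1 ≤ i → i ≤ m → IsEmpty ((reduction K r).Equiv
    (twist (reduction K r)
      (((Units.map (IsLocalRing.residue O : O →* _)).comp (cycChar K l O)) ^ i)))

variable {K} (φ s : Gal(AlgebraicClosure K/K)) {n : ℕ}

/-- `ρ` is `r`-discrete series: there is a decreasing filtration
`R^n = Fil⁰ ⊇ Fil¹ ⊇ ... ⊇ Fil^m = 0` by subrepresentations that are direct summands, with
`gr^i ≅ gr⁰(i)` for `i < m` and `gr⁰ ≅ r ⊗ R` on inertia. -/
def IsDiscreteSeries (m : ℕ) (r : Gal(AlgebraicClosure K/K) →* GL (Fin d) O)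
    (R : Type*) [CommRing R] [Algebra O R] (ρ : weilGroup OK K φ s →* GL (Fin n) R) : Prop :=
  ∃ Fil : ℕ → Subrepresentation (toRep ρ),
    Antitone Fil ∧ (Fil 0).toSubmodule = ⊤ ∧ (Fil m).toSubmodule = ⊥ ∧
    (∀ i, ∃ C : Submodule R (Fin n → R), IsCompl (Fil i).toSubmodule C) ∧
    (∀ i < m, Nonempty ((subquotient (Fil i) (Fil (i + 1))).Equiv
      (twist (subquotient (Fil 0) (Fil 1))
        (((Units.map (algebraMap O R : O →* R)).comp
          ((cycChar K l O).comp (weilGroup OK K φ s).subtype)) ^ i)))) ∧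
    Nonempty (Representation.Equiv
      ((subquotient (Fil 0) (Fil 1)).comp (weilInertia OK K φ s).subtype)
      (((toRep (mapGL (algebraMap O R) r)).comp (weilGroup OK K φ s).subtype).comp
        (weilInertia OK K φ s).subtype))

/-- `ρ` is `r`-discrete series Zariski-locally on `Spec R`. -/
def IsLocallyDiscreteSeries (m : ℕ) (r : Gal(AlgebraicClosure K/K) →* GL (Fin d) O)
    (R : Type*) [CommRing R] [Algebra O R] (ρ : weilGroup OK K φ s →* GL (Fin n) R) : Prop :=
  ∃ S : Set R, Ideal.span S = ⊤ ∧ ∀ f ∈ S,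
    IsDiscreteSeries OK l φ s m r (Localization.Away f)
      (mapGL (algebraMap R (Localization.Away f)) ρ)

/-- The restriction of `ρ` to wild inertia has open kernel. -/
def HasOpenWildKernel {R : Type*} [CommRing R] (ρ : weilGroup OK K φ s →* GL (Fin n) R) : Prop :=
  ∃ U : Subgroup Gal(AlgebraicClosure K/K), IsOpen (U : Set Gal(AlgebraicClosure K/K)) ∧
    ∀ g : weilGroup OK K φ s, (g : Gal(AlgebraicClosure K/K)) ∈ wildInertia OK K →
      (g : Gal(AlgebraicClosure K/K)) ∈ U → ρ g = 1

/-- The `R`-points of the moduli problem of framed `r`-discrete series of rank `n`. -/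
def moduliPoints (m n : ℕ) (r : Gal(AlgebraicClosure K/K) →* GL (Fin d) O)
    (R : Type*) [CommRing R] [Algebra O R] : Set (weilGroup OK K φ s →* GL (Fin n) R) :=
  {ρ | HasOpenWildKernel OK φ s ρ ∧ IsLocallyDiscreteSeries OK l φ s m r R ρ}

end Types

/-! ### Moduli spaces -/

section Moduli

variable (OK : Type v) [CommRing OK] {K : Type w} [Field K] [Algebra OK K]
  (l : ℕ) [Fact l.Prime] {O : Type u} [CommRing O] [Algebra ℤ_[l] O] {d : ℕ}
  (φ s : Gal(AlgebraicClosure K/K))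

/-- The `R`-points over `O` of an `O`-scheme `f : X ⟶ Spec O`. -/
abbrev PointsOver {X : Scheme.{u}} (f : X ⟶ Spec (CommRingCat.of O))
    (R : Type u) [CommRing R] [Algebra O R] : Type u :=
  {x : Spec (CommRingCat.of R) ⟶ X //
    x ≫ f = Spec.map (CommRingCat.ofHom (algebraMap O R))}

/-- The `O`-scheme `f : X ⟶ Spec O` is a moduli space of framed `r`-discrete series of rank `n`:
it represents the functor `R ↦ moduliPoints R` on `O`-algebras. -/
def IsModuliSpace (m n : ℕ) (r : Gal(AlgebraicClosure K/K) →* GL (Fin d) O)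
    {X : Scheme.{u}} (f : X ⟶ Spec (CommRingCat.of O)) : Prop :=
  ∃ e : ∀ (R : Type u) [CommRing R] [Algebra O R],
      PointsOver f R ≃ moduliPoints OK l φ s m n r R,
    ∀ (R R' : Type u) [CommRing R] [Algebra O R] [CommRing R'] [Algebra O R']
      (g : R →ₐ[O] R') (x : PointsOver f R) (x' : PointsOver f R'),
      x'.1 = Spec.map (CommRingCat.ofHom g.toRingHom) ≫ x.1 →
      (e R' x').1 = mapGL g.toRingHom (e R x).1

/-- The `L`-algebra `A` represents the generic fibre of the moduli problem, that is, its
restriction to `L`-algebras. -/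
def RepresentsGenericFibre (m n : ℕ) (r : Gal(AlgebraicClosure K/K) →* GL (Fin d) O)
    (L : Type u) [Field L] [Algebra O L] (A : Type u) [CommRing A] [Algebra L A] [Algebra O A] :
    Prop :=
  ∃ ρ ∈ moduliPoints OK l φ s m n r A,
    ∀ (R : Type u) [CommRing R] [Algebra O R] [Algebra L R] [IsScalarTower O L R],
      Set.BijOn (fun g : A →ₐ[L] R => mapGL g.toRingHom ρ) Set.univ
        (moduliPoints OK l φ s m n r R)

end Moduli

end DiscreteSeries

end

set_option linter.unusedSectionVars false

noncomputable section

namespace DiscreteSeries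

/-! ### Exponentials and logarithms of nilpotent elements -/

section Nilpotent

/-! Only algebras over the characteristic zero field `L` matter, and there a discrete series has a
normal form. Let `ρ₀` be an extension of `r|I` to the discretized Weil group `W`, let `N` have
scalar blocks `x j` just below the diagonal and zeros elsewhere, and let `t` be the tame cocycle.
The normal form sends `w` to the block diagonal sum of the twists `ρ₀(i)` at `w`, multiplied by `exp
(t w • N)`; this is `exists_conj_std`. To reach it, choose a basis adapted to the filtration, so
that the representation becomes block triangular. The logarithm of the image of a power of `s` gives
the monodromy operator, and twisting it away leaves a representation trivial on the inertial kernel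
of `r`. A power `φ ^ h` then acts on the diagonal blocks by scalars `q ^ (h * i) * α` whose
differences are units, so it can be diagonalised, and averaging over a finite coset space splits the
whole filtration. In the new coordinates the relation between `N` and Frobenius leaves only the
blocks just below the diagonal, which are scalar by Schur's lemma. The `x j` are arbitrary, so
degenerate monodromy creates no singularity.

The extensions `ρ₀` are given by `φ ↦ r φ * e`, with `e` a unit in the commutant of `r|I`. This
commutant is commutative (`commutant_commute`) because inertia is normal with quotient generated by
Frobenius, and commutativity yields Schur's lemma for every `ρ₀` over every base. Hence standard
families with a chosen basis are parametrized by an open subset of an affine space, the spectrum of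
`StdRing`: its coordinates are a change of basis, a matrix whose projection is `e`, and the `x j`.

The moduli ring is the subring `univRing` of `StdRing` generated by the matrix entries of the
universal standard family. The essential point is that this family is locally standard already over
the subring (`isLocStd_of_injective`). If a family over a subring becomes standard over the bigger
ring, then traces and averages show that the block idempotents and suitable multiples of the block
matrix units are conjugate to matrices over the subring. Near a maximal ideal, the character theory
of the finite image of inertia provides a basis of one block, and a conjugating matrix over the
subring is assembled from it. Therefore, locally on `univRing`, the universal family is classified
by a map out of `StdRing`; so `univRing` is locally a retract of a localization of `StdRing` and is
smooth (`smooth_univRing`). Any locally standard family satisfies the relations among the universal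
entries, so it comes from a unique map out of `univRing`.

Arithmetic enters through `exists_tameDatum`. Wild inertia is pro-`p` and `p ≠ l`, so its image is
finite; Frobenius acts on tame inertia by `q`-th powers; the cyclotomic character supplies the
valuation; density of `W` and Burnside's theorem make the image of `r` span the matrix algebra.
Finally `smooth_genericFibre` identifies the generic fibre of any moduli scheme with the affine
solution by comparing functors of points. -/

/-- Descent on the nilpotency exponent. It is used with identities in `X` that become linear after
multiplication by a power of `X` annihilating all higher terms. -/
theorem eq_zero_of_forall_pow_succ {A : Type*} [Ring A] {X : A} (hX : IsNilpotent X)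
    (h : ∀ k : ℕ, X ^ (k + 2) = 0 → X ^ (k + 1) = 0) : X = 0 := by
  obtain ⟨n, hn⟩ := hX
  induction n with
  | zero =>
    have : (1 : A) = 0 := by simpa using hn
    rw [← mul_one X, this, mul_zero]
  | succ n ih =>
    cases n with
    | zero => simpa using hn
    | succ n => exact ih (h n hn)

variable {A : Type*} [Ring A] [Algebra ℚ A]

/-- A unipotent element of finite order in a `ℚ`-algebra is trivial. -/
theorem eq_zero_of_one_add_pow_eq_one {X : A} (hX : IsNilpotent X) {M : ℕ} (hM : 0 < M)
    (h : (1 + X) ^ M = 1) : X = 0 := by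
  refine eq_zero_of_forall_pow_succ hX fun k hk => ?_
  -- As `X ^ (k + 2) = 0`, multiplying by `X ^ k` keeps only the linear part of the binomial
  -- expansion; the exponent `M` is then invertible.
  have key : ∀ j : ℕ, (1 + X) ^ j * X ^ k = X ^ k + j • X ^ (k + 1) := by
    intro j
    induction j with
    | zero => simp
    | succ j ih =>
      rw [pow_succ', mul_assoc, ih, mul_add, add_mul, add_mul, one_mul, one_mul, mul_smul_comm,
        ← pow_succ', ← pow_succ', hk, smul_zero, add_zero, succ_nsmul]
      abel
  have h1 := key M
  rw [h, one_mul, left_eq_add] at h1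
  have h2 : ((M : ℚ)) • X ^ (k + 1) = 0 := by rw [Nat.cast_smul_eq_nsmul, h1]
  have h3 := congrArg (fun y => ((M : ℚ)⁻¹) • y) h2
  simpa [smul_smul, inv_mul_cancel₀ (show (M : ℚ) ≠ 0 by positivity)] using h3

/-- When `X ^ (k + 2) = 0`, multiplying the exponential series by `X ^ k` leaves `X ^ k + X ^ (k +
1)`, so the exponent of nilpotency can be lowered. -/
theorem eq_zero_of_exp_eq_one {X : A} (hX : IsNilpotent X) (h : IsNilpotent.exp X = 1) :
    X = 0 := by
  refine eq_zero_of_forall_pow_succ hX fun k hk => ?_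
  obtain ⟨n, hn⟩ := hX
  have h0 : X ^ (n + 2) = 0 := pow_eq_zero_of_le (by omega) hn
  have h1 := IsNilpotent.exp_eq_sum h0
  rw [h, Finset.sum_range_succ', Finset.sum_range_succ'] at h1
  have h2 := congrArg (fun y => y * X ^ k) h1
  simp only [add_mul, Finset.sum_mul, smul_mul_assoc, ← pow_add, one_mul] at h2
  rw [Finset.sum_eq_zero] at h2
  · simpa [add_comm] using h2
  · intro i _
    rw [pow_eq_zero_of_le (show k + 2 ≤ i + 1 + 1 + k by omega) hk, smul_zero]

theorem exp_injective_of_commute {X Y : A} (hX : IsNilpotent X) (hY : IsNilpotent Y)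
    (hc : Commute X Y) (h : IsNilpotent.exp X = IsNilpotent.exp Y) : X = Y := by
  rw [← sub_eq_zero]
  refine eq_zero_of_exp_eq_one (hc.isNilpotent_sub hX hY) ?_
  rw [sub_eq_add_neg, IsNilpotent.exp_add_of_commute hc.neg_right hX hY.neg, h,
    IsNilpotent.exp_mul_exp_neg_self hY]

theorem exp_nsmul {X : A} (hX : IsNilpotent X) (j : ℕ) :
    IsNilpotent.exp (j • X) = IsNilpotent.exp X ^ j := by
  induction j with
  | zero => simp
  | succ j ih =>
    rw [succ_nsmul, IsNilpotent.exp_add_of_commute ((Commute.refl X).smul_left j) (hX.smul j) hX,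
      ih, pow_succ]

theorem exp_conj {X U V : A} (hX : IsNilpotent X) (h : V * U = 1) (h' : U * V = 1) :
    IsNilpotent.exp (U * X * V) = U * IsNilpotent.exp X * V := by
  have hp : ∀ i : ℕ, (U * X * V) ^ i = U * X ^ i * V := by
    intro i
    induction i with
    | zero => simp [h']
    | succ i ih =>
      rw [pow_succ, ih, pow_succ]
      calc U * X ^ i * V * (U * X * V) = U * X ^ i * (V * U) * X * V := by noncomm_ring
        _ = _ := by rw [h]; noncomm_ring
  obtain ⟨n, hn⟩ := hX
  rw [IsNilpotent.exp_eq_sum hn, IsNilpotent.exp_eq_sum (k := n) (by rw [hp, hn]; simp),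
    Finset.mul_sum, Finset.sum_mul]
  simp [hp]

theorem commute_exp {X Y : A} (hX : IsNilpotent X) (h : Commute Y X) :
    Commute Y (IsNilpotent.exp X) := by
  obtain ⟨n, hn⟩ := hX
  rw [IsNilpotent.exp_eq_sum hn]
  exact Commute.sum_right _ _ _ fun i _ => (h.pow_right i).smul_right _

end Nilpotent

/-- Newton iteration. If `exp N` agrees with `U` modulo a power of `U - 1`, correct `N` by `D = (U -
exp N) * exp (-N)`; the new error is divisible by `D ^ 2`. The divisibility of `N` by `U - 1` is
recorded because it later shows that logarithms of unitriangular matrices are strictly triangular.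
-/
theorem exists_exp_eq_of_comm {A : Type*} [CommRing A] [Algebra ℚ A] {U : A}
    (hU : IsNilpotent (U - 1)) : ∃ N : A, U - 1 ∣ N ∧ IsNilpotent N ∧
      IsNilpotent.exp N = U := by
  have key : ∀ k : ℕ, ∃ N : A, U - 1 ∣ N ∧ IsNilpotent N ∧
      (U - 1) ^ (k + 1) ∣ U - IsNilpotent.exp N := by
    intro k
    induction k with
    | zero => exact ⟨0, dvd_zero _, IsNilpotent.zero, by simp⟩
    | succ k ih =>
      obtain ⟨N, hdvd, hN, c, hc⟩ := ih
      set D := (U - 1) ^ (k + 1) * c * IsNilpotent.exp (-N) with hD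
      have hDn : IsNilpotent D := by
        rw [hD, mul_assoc]
        exact (Commute.all _ _).isNilpotent_mul_right (hU.pow_of_pos (Nat.succ_ne_zero k))
      have hE : IsNilpotent.exp N * D = U - IsNilpotent.exp N := by
        rw [hD, hc]
        linear_combination ((U - 1) ^ (k + 1) * c) * IsNilpotent.exp_mul_exp_neg_self hN
      refine ⟨N + D, dvd_add hdvd ?_, (Commute.all _ _).isNilpotent_add hN hDn, ?_⟩
      · rw [hD, pow_succ', mul_assoc, mul_assoc]
        exact dvd_mul_right _ _
      rw [IsNilpotent.exp_add_of_commute (Commute.all _ _) hN hDn]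
      have h2 : D ^ 2 ∣ IsNilpotent.exp D - 1 - D := by
        obtain ⟨n, hn⟩ := hDn
        rw [IsNilpotent.exp_eq_sum (pow_eq_zero_of_le (show n ≤ n + 2 by omega) hn),
          Finset.sum_range_succ', Finset.sum_range_succ']
        simp only [zero_add, Nat.factorial_one, Nat.cast_one, inv_one, pow_one, one_smul,
          Nat.factorial_zero, pow_zero, add_sub_cancel_right]
        refine Finset.dvd_sum fun i _ => ?_
        rw [Algebra.smul_def]
        exact Dvd.dvd.mul_left (pow_dvd_pow D (by omega)) _
      have h3 : U - IsNilpotent.exp N * IsNilpotent.exp D =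
          -(IsNilpotent.exp N * (IsNilpotent.exp D - 1 - D)) := by
        linear_combination -hE
      rw [h3, dvd_neg]
      refine Dvd.dvd.mul_left (dvd_trans ?_ h2) _
      rw [hD, mul_assoc, mul_pow, ← pow_mul]
      exact Dvd.dvd.mul_right (pow_dvd_pow _ (by omega)) _
  obtain ⟨n, hn⟩ := hU
  obtain ⟨N, hdvd, hN, h⟩ := key n
  refine ⟨N, hdvd, hN, ?_⟩
  rw [pow_eq_zero_of_le (Nat.le_succ n) hn, zero_dvd_iff] at h
  exact (sub_eq_zero.mp h).symm

/-- Unipotent elements of a `ℚ`-algebra have logarithms. -/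
theorem exists_exp_eq {A : Type*} [Ring A] [Algebra ℚ A] {U : A} (hU : IsNilpotent (U - 1)) :
    ∃ Y ∈ Algebra.adjoin ℚ {U}, IsNilpotent ((U - 1) * Y) ∧ IsNilpotent.exp ((U - 1) * Y) = U := by
  have : IsMulCommutative (Algebra.adjoin ℚ {U}) := Algebra.isMulCommutative_adjoin ℚ (by simp)
  let _ : CommRing (Algebra.adjoin ℚ {U}) := { mul_comm := fun a b => mul_comm' a b }
  let U' : Algebra.adjoin ℚ {U} := ⟨U, Algebra.self_mem_adjoin_singleton ℚ U⟩
  have hU' : IsNilpotent (U' - 1) := by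
    obtain ⟨n, hn⟩ := hU
    exact ⟨n, Subtype.ext (by simpa [U'] using hn)⟩
  obtain ⟨_, ⟨Y, rfl⟩, hN, h⟩ := exists_exp_eq_of_comm hU'
  refine ⟨Y, Y.2, ?_, ?_⟩
  · obtain ⟨n, hn⟩ := hN
    exact ⟨n, congrArg Subtype.val hn⟩
  · have h2 := IsNilpotent.map_exp hN (Algebra.adjoin ℚ {U}).val
    rw [h] at h2
    exact h2.symm

theorem commute_of_mem_adjoin {k A : Type*} [CommRing k] [Ring A] [Algebra k A] {U N Y : A}
    (hN : N ∈ Algebra.adjoin k {U}) (h : Commute Y U) : Commute Y N := by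
  have h1 : N ∈ Subalgebra.centralizer k {Y} :=
    (Algebra.adjoin_le (S := Subalgebra.centralizer k {Y}) (by
      rintro _ rfl
      rw [SetLike.mem_coe, Subalgebra.mem_centralizer_iff]
      rintro _ rfl
      exact h)) hN
  exact (Subalgebra.mem_centralizer_iff k).mp h1 Y rfl

/-! ### Averaging -/

/-- Averages over the cosets of a subgroup of finite index are invariant. -/
theorem map_sum_quotient_out {G M : Type*} [Group G] [AddCommMonoid M] {K : Subgroup G}
    [Fintype (G ⧸ K)] (f : G → M) (hf : ∀ g, ∀ k ∈ K, f (g * k) = f g) (g : G) (τ : M →+ M)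
    (hτ : ∀ g', τ (f g') = f (g * g')) :
    τ (∑ c : G ⧸ K, f c.out) = ∑ c : G ⧸ K, f c.out := by
  let F : G ⧸ K → M := Quotient.lift f (by
    intro a b hab
    have h := QuotientGroup.leftRel_apply.mp hab
    have := hf a _ h
    rw [mul_inv_cancel_left] at this
    exact this.symm)
  have hF : ∀ c : G ⧸ K, f c.out = F c := fun c => by
    conv_rhs => rw [← Quotient.out_eq c]
    rfl
  simp_rw [hF]
  rw [map_sum]
  refine Fintype.sum_equiv (MulAction.toPerm g) _ _ fun c => ?_
  induction c using QuotientGroup.induction_on with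
  | H a => exact hτ a

/-! ### Representations with equal characters -/

section Characters

open Representation

/-- The inner product of characters computes the dimension of the space of intertwining maps. Equal
characters give `Hom(V, W)` the dimension of `End(V)`, which is positive because it contains the
identity. -/
theorem finrank_intertwiningMap_pos {k G V W : Type*} [Field k] [CharZero k] [Group G] [Finite G]
    [AddCommGroup V] [Module k V] [FiniteDimensional k V] [AddCommGroup W] [Module k W]
    [FiniteDimensional k W] (ρ : Representation k G V) (σ : Representation k G W)
    (h : ρ.character = σ.character) [Nontrivial V] :
    ∃ f : IntertwiningMap ρ σ, f ≠ 0 := by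
  have := Fintype.ofFinite G
  have : Invertible (Nat.card G : k) := invertibleOfNonzero (by
    have := Nat.card_pos (α := G)
    exact_mod_cast this.ne')
  by_contra! hc
  have h1 := card_inv_mul_sum_char_mul_char_eq_finrank ρ σ
  rw [← h, card_inv_mul_sum_char_mul_char_eq_finrank ρ ρ] at h1
  have h2 : Module.finrank k (IntertwiningMap ρ σ) = 0 := by
    have : Subsingleton (IntertwiningMap ρ σ) := ⟨fun a b => by rw [hc a, hc b]⟩
    exact Module.finrank_zero_of_subsingleton
  rw [h2] at h1
  have h3 : Module.finrank k (IntertwiningMap ρ ρ) = 0 := by exact_mod_cast h1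
  have h4 : Module.Finite k (IntertwiningMap ρ ρ) :=
    Module.Finite.equiv (invariantsEquivIntertwiningMap ρ ρ)
  have h5 := Module.finrank_zero_iff.mp h3
  obtain ⟨v, hv⟩ := exists_ne (0 : V)
  have h6 := congrArg (fun f : IntertwiningMap ρ ρ => f v)
    (Subsingleton.elim (IntertwiningMap.id ρ) 0)
  exact hv h6

theorem exists_subrepresentation_isCompl {k G V : Type*} [Field k] [CharZero k] [Group G] [Finite G]
    [AddCommGroup V] [Module k V] {ρ : Representation k G V} (A : Subrepresentation ρ) :
    ∃ C : Subrepresentation ρ, IsCompl A.toSubmodule C.toSubmodule := by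
  have : NeZero (Nat.card G : k) := ⟨by
    have := Nat.card_pos (α := G)
    exact_mod_cast this.ne'⟩
  obtain ⟨C, hC⟩ := exists_isCompl A
  refine ⟨C, ?_, ?_⟩
  · rw [disjoint_iff]
    exact congrArg Subrepresentation.toSubmodule hC.inf_eq_bot
  · rw [codisjoint_iff]
    exact congrArg Subrepresentation.toSubmodule hC.sup_eq_top

/-- The decomposition of a representation as a sum of complementary subrepresentations. -/
def prodEquivOfIsCompl {k G V : Type*} [Field k] [Monoid G] [AddCommGroup V] [Module k V]
    {ρ : Representation k G V} (A C : Subrepresentation ρ)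
    (h : IsCompl A.toSubmodule C.toSubmodule) :
    (A.toRepresentation.prod C.toRepresentation).Equiv ρ :=
  Representation.Equiv.mk (Submodule.prodEquivOfIsCompl _ _ h) fun g => by
    ext x <;> simp [Representation.prod, Subrepresentation.toRepresentation]

theorem character_prod {k G V W : Type*} [Field k] [Monoid G] [AddCommGroup V] [Module k V]
    [AddCommGroup W] [Module k W] [FiniteDimensional k V] [FiniteDimensional k W]
    (ρ : Representation k G V) (σ : Representation k G W) :
    (ρ.prod σ).character = ρ.character + σ.character := by
  ext g
  exact LinearMap.trace_prodMap' _ _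

/-- Representations of a finite group with equal characters in characteristic zero are
equivalent. -/
theorem nonempty_equiv_of_character_eq {k G : Type*} [Field k] [CharZero k] [Group G] [Finite G]
    (n : ℕ) : ∀ {V W : Type*} [AddCommGroup V] [Module k V] [FiniteDimensional k V]
    [AddCommGroup W] [Module k W] [FiniteDimensional k W] (ρ : Representation k G V)
    (σ : Representation k G W) (_ : ρ.character = σ.character) (_ : Module.finrank k V = n),
    Nonempty (ρ.Equiv σ) := by
  induction n using Nat.strong_induction_on with
  | _ n ih =>
  intro V W _ _ _ _ _ _ ρ σ h hn
  have hVW : Module.finrank k V = Module.finrank k W := by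
    have h1 := congrFun h 1
    rw [char_one, char_one] at h1
    exact_mod_cast h1
  rcases subsingleton_or_nontrivial V with hV | hV
  · have h0 : Module.finrank k V = 0 := Module.finrank_zero_of_subsingleton
    have hW : Subsingleton W := Module.finrank_zero_iff.mp (hVW ▸ h0)
    exact ⟨Representation.Equiv.mk 0 fun g => Subsingleton.elim _ _⟩
  -- The image of a nonzero map is a common direct summand. Removing it from both sides leaves the
  -- kernel of `f` and a complement of its image, with equal characters and smaller dimension.
  obtain ⟨f, hf⟩ := finrank_intertwiningMap_pos ρ σ h
  let A : Subrepresentation ρ := ⟨LinearMap.ker f.toLinearMap, fun g v hv => by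
    have h1 := LinearMap.congr_fun (f.isIntertwining' g) v
    simp only [LinearMap.comp_apply] at h1
    rw [LinearMap.mem_ker] at hv ⊢
    rw [h1, hv, map_zero]⟩
  let B : Subrepresentation σ := ⟨LinearMap.range f.toLinearMap, by
    rintro g _ ⟨v, rfl⟩
    exact ⟨ρ g v, LinearMap.congr_fun (f.isIntertwining' g) v⟩⟩
  obtain ⟨A', hA⟩ := exists_subrepresentation_isCompl A
  obtain ⟨B', hB⟩ := exists_subrepresentation_isCompl B
  let e : A'.toRepresentation.Equiv B.toRepresentation :=
    Representation.Equiv.mk ((Submodule.quotientEquivOfIsCompl _ _ hA).symm.trans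
      f.toLinearMap.quotKerEquivRange) fun g => by
      ext x
      have h1 : ∀ y : A'.toSubmodule, (Submodule.quotientEquivOfIsCompl _ _ hA).symm y =
        Submodule.Quotient.mk (y : V) := fun y => rfl
      have h2 := LinearMap.congr_fun (f.isIntertwining' g) x
      simp only [LinearMap.comp_apply, LinearEquiv.coe_coe, LinearEquiv.trans_apply, h1]
      exact h2
  have hc : A.toRepresentation.character = B'.toRepresentation.character := by
    have h1 := char_iso (prodEquivOfIsCompl A A' hA)
    have h2 := char_iso (prodEquivOfIsCompl B B' hB)
    rw [character_prod] at h1 h2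
    rw [← h1, ← h2, char_iso e, add_comm] at h
    exact add_left_cancel h
  have hlt : Module.finrank k A.toSubmodule < n := by
    rw [← hn]
    refine Submodule.finrank_lt fun ht => hf ?_
    ext x
    have : x ∈ A.toSubmodule := ht ▸ Submodule.mem_top
    exact this
  obtain ⟨e'⟩ := ih _ hlt A.toRepresentation B'.toRepresentation hc rfl
  refine ⟨(prodEquivOfIsCompl A A' hA).symm.trans
    (Representation.Equiv.trans (Representation.Equiv.mk
      ((LinearEquiv.prodComm k _ _).trans (e.toLinearEquiv.prodCongr e'.toLinearEquiv)) ?_)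
      (prodEquivOfIsCompl B B' hB))⟩
  intro g
  have h1 := e.isIntertwining' g
  have h2 := e'.isIntertwining' g
  refine LinearMap.ext fun x => Prod.ext ?_ ?_
  · exact LinearMap.congr_fun h1 x.2
  · exact LinearMap.congr_fun h2 x.1

/-- A matrix form of `nonempty_equiv_of_character_eq`: the second representation is realised on
the image of an idempotent. -/
theorem exists_matrix_intertwiner {k G ι κ : Type*} [Field k] [CharZero k] [Group G] [Finite G]
    [Fintype ι] [DecidableEq ι] [Fintype κ] [DecidableEq κ] (σ : G →* Matrix κ κ k)
    (τ : G → Matrix ι ι k) (hτ : ∀ g h, τ (g * h) = τ g * τ h)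
    (htr : ∀ g, (τ g).trace = (σ g).trace) :
    ∃ (X : Matrix ι κ k) (Y : Matrix κ ι k), Y * X = 1 ∧ X * Y = τ 1 ∧
      ∀ g, τ g * X = X * σ g := by
  -- The map `τ` is multiplicative but need not be unital, so `τ 1` is only an idempotent. A genuine
  -- representation lives on its range, with the same traces.
  let e := Matrix.toLin' (τ 1)
  have he : ∀ g x, e (Matrix.toLin' (τ g) x) = Matrix.toLin' (τ g) x := fun g x => by
    have := hτ 1 g
    rw [one_mul] at this
    simp only [e, ← Matrix.toLin'_mul_apply, ← this]
  have he' : ∀ g x, Matrix.toLin' (τ g) (e x) = Matrix.toLin' (τ g) x := fun g x => by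
    have := hτ g 1
    rw [mul_one] at this
    simp only [e, ← Matrix.toLin'_mul_apply, ← this]
  let V := LinearMap.range e
  let p : (ι → k) →ₗ[k] V := e.rangeRestrict
  have hp : ∀ x : V, p x = x := by
    rintro ⟨_, y, rfl⟩
    exact Subtype.ext (he 1 y)
  let τ' : Representation k G V :=
    { toFun := fun g => p ∘ₗ Matrix.toLin' (τ g) ∘ₗ V.subtype
      map_one' := by
        refine LinearMap.ext fun x => Subtype.ext ?_
        obtain ⟨_, y, rfl⟩ := x
        exact (he _ _).trans (he 1 y)
      map_mul' := fun g h => by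
        refine LinearMap.ext fun x => Subtype.ext ?_
        change e (Matrix.toLin' (τ (g * h)) x) = e (Matrix.toLin' (τ g) (e (Matrix.toLin' (τ h) x)))
        rw [he, he, he, hτ, Matrix.toLin'_mul_apply] }
  let σ' : Representation k G (κ → k) :=
    ((Matrix.toLinAlgEquiv' : Matrix κ κ k ≃ₐ[k] _) : Matrix κ κ k →* _).comp σ
  have hch : σ'.character = τ'.character := by
    ext g
    have h1 : σ'.character g = (σ g).trace := by
      change LinearMap.trace k _ (Matrix.toLin' (σ g)) = _
      simp
    have h2 : τ'.character g = (τ g).trace := by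
      change LinearMap.trace k _ (p ∘ₗ (Matrix.toLin' (τ g) ∘ₗ V.subtype)) = _
      rw [LinearMap.trace_comp_comm']
      have : (Matrix.toLin' (τ g) ∘ₗ V.subtype) ∘ₗ p = Matrix.toLin' (τ g) :=
        LinearMap.ext fun x => he' g x
      rw [this]
      simp
    rw [h1, h2, htr]
  obtain ⟨E⟩ := nonempty_equiv_of_character_eq _ σ' τ' hch rfl
  refine ⟨LinearMap.toMatrix' (V.subtype ∘ₗ E.toLinearEquiv.toLinearMap),
    LinearMap.toMatrix' (E.toLinearEquiv.symm.toLinearMap ∘ₗ p), ?_, ?_, ?_⟩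
  · rw [← LinearMap.toMatrix'_comp, ← LinearMap.toMatrix'_id]
    congr 1
    refine LinearMap.ext fun x => ?_
    change E.toLinearEquiv.symm (p (E.toLinearEquiv x)) = x
    rw [hp, LinearEquiv.symm_apply_apply]
  · rw [← LinearMap.toMatrix'_comp]
    conv_rhs => rw [← LinearMap.toMatrix'_toLin' (τ 1)]
    congr 1
    refine LinearMap.ext fun x => ?_
    change ((E.toLinearEquiv (E.toLinearEquiv.symm (p x)) : V) : ι → k) = e x
    rw [LinearEquiv.apply_symm_apply]
    rfl
  · intro g
    rw [← Matrix.toLin'.injective.eq_iff, Matrix.toLin'_mul, Matrix.toLin'_mul,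
      Matrix.toLin'_toMatrix']
    refine LinearMap.ext fun x => ?_
    have h1 := congrArg Subtype.val (LinearMap.congr_fun (E.isIntertwining' g) x)
    change ((E.toLinearEquiv (Matrix.toLin' (σ g) x) : V) : ι → k) =
      e (Matrix.toLin' (τ g) (E.toLinearEquiv x)) at h1
    rw [he] at h1
    exact h1.symm

end Characters

/-! ### Burnside's theorem -/

/-- Burnside: the image of an irreducible representation over an algebraically closed field spans
the endomorphism algebra. -/
theorem span_range_eq_top_of_isIrreducible {k G V : Type*} [Field k] [IsAlgClosed k] [Monoid G]
    [AddCommGroup V] [Module k V] [FiniteDimensional k V] (ρ : Representation k G V)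
    (h : ρ.IsIrreducible) : Submodule.span k (Set.range ρ) = ⊤ := by
  have hS : IsSimpleModule (MonoidAlgebra k G) ρ.asModule :=
    (Representation.irreducible_iff_isSimpleModule_asModule ρ).mp h
  rw [eq_top_iff]
  intro f _
  -- Over an algebraically closed field the endomorphisms of a simple module are scalars, so every
  -- `k`-linear map commutes with them. Density then provides an element of the group algebra
  -- agreeing with it on a spanning set.
  have hb : Function.Bijective
      (algebraMap k (Module.End (MonoidAlgebra k G) ρ.asModule)) :=
    IsSimpleModule.algebraMap_end_bijective_of_isAlgClosed k
  let f' : Module.End (Module.End (MonoidAlgebra k G) ρ.asModule) ρ.asModule :=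
    { toFun := f
      map_add' := f.map_add
      map_smul' := fun c x => by
        obtain ⟨a, rfl⟩ := hb.2 c
        exact f.map_smul a x }
  obtain ⟨s, hs⟩ := Module.Finite.fg_top (R := k) (M := V)
  obtain ⟨a, ha⟩ := jacobson_density f' s
  have : f = ρ.asAlgebraHom a := by
    refine LinearMap.ext_on (s := (s : Set V)) hs fun x hx => ?_
    exact ha x hx
  rw [this]
  clear this ha
  induction a using MonoidAlgebra.induction_linear with
  | zero => simp
  | add x y hx hy =>
    rw [map_add]
    exact add_mem hx hy
  | single g c =>
    rw [Representation.asAlgebraHom_single]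
    exact Submodule.smul_mem _ _ (Submodule.subset_span ⟨g, rfl⟩)


/-! ### Tame data -/

/-- The group theory of the discretized Weil group `W` with wild inertia `P`, Frobenius `φ`, tame
generator `s`, valuation `v` and tame cocycle `t`, together with a representation `r` over a
field whose image spans the matrix algebra. -/
structure TameDatum (L W : Type*) [Field L] [Group W] (d : ℕ) where
  φ : W
  s : W
  P : Subgroup W
  v : W →* Multiplicative ℤ
  q : ℕ
  t : W → L
  r : W →* GL (Fin d) L
  normal : P.Normal
  two_le : 2 ≤ q
  v_φ : v φ = Multiplicative.ofAdd 1
  v_s : v s = 1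
  v_P : ∀ p ∈ P, v p = 1
  tame : (s ^ q)⁻¹ * (φ * s * φ⁻¹) ∈ P
  form : ∀ w, ∃ (a : ℕ) (b : ℤ) (c : ℕ), ∃ p ∈ P, w = (φ ^ a)⁻¹ * s ^ b * φ ^ c * p
  -- This twisted additivity is what makes `w ↦ T w * exp (t w • N)` multiplicative when moving `N`
  -- past `T w` multiplies it by the inverse of the unramified character.
  t_mul : ∀ w w', t (w * w') = (q : L) ^ (-(v w').toAdd) * t w + t w'
  t_φ : t φ = 0
  t_P : ∀ p ∈ P, t p = 0
  -- Either the cocycle is normalised at `s`, or a power of `s` is wild and the cocycle vanishes.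
  -- Allowing both cases makes it unnecessary to know the order of `s` modulo `P`.
  t_s : t s = 1 ∨ (∀ w, t w = 0) ∧ ∃ j > 0, s ^ j ∈ P
  finite_P : (r '' P).Finite
  span : Submodule.span L (Set.range fun w => (r w : Matrix (Fin d) (Fin d) L)) = ⊤
  pos : 0 < d

/-- Conjugation by `g` permutes the finite set `S`, and raising a permutation to the order of the
symmetric group makes it trivial. -/
theorem exists_pow_commute {G : Type*} [Group G] {S : Set G} (hS : S.Finite) (g : G)
    (h : ∀ x ∈ S, g * x * g⁻¹ ∈ S) : ∃ k > 0, ∀ x ∈ S, g ^ k * x = x * g ^ k := by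
  have := hS.to_subtype
  let f : S → S := fun x => ⟨g * x * g⁻¹, h x x.2⟩
  have hf : Function.Injective f := fun x y hxy => Subtype.ext (by simpa [f] using hxy)
  let σ : Equiv.Perm S := Equiv.ofBijective f (Finite.injective_iff_bijective.mp hf)
  have hσ : ∀ (k : ℕ) (x : S), (((σ ^ k) x : S) : G) = g ^ k * x * (g ^ k)⁻¹ := by
    intro k
    induction k with
    | zero => simp
    | succ k ih =>
      intro x
      rw [pow_succ', Equiv.Perm.mul_apply]
      change g * (((σ ^ k) x : S) : G) * g⁻¹ = _
      rw [ih, pow_succ']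
      group
  refine ⟨Nat.card (Equiv.Perm S), Nat.card_pos, fun x hx => ?_⟩
  have h1 := hσ (Nat.card (Equiv.Perm S)) ⟨x, hx⟩
  rw [pow_card_eq_one'] at h1
  have h2 : x = g ^ Nat.card (Equiv.Perm S) * x * (g ^ Nat.card (Equiv.Perm S))⁻¹ := h1
  nth_rw 2 [h2]
  group

theorem conj_inv_mem {G : Type*} [Group G] {S : Set G} (hS : S.Finite) (g : G)
    (h : ∀ x ∈ S, g * x * g⁻¹ ∈ S) : ∀ x ∈ S, g⁻¹ * x * g ∈ S := by
  have := hS.to_subtype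
  let f : S → S := fun x => ⟨g * x * g⁻¹, h x x.2⟩
  have hf : Function.Injective f := fun x y hxy => Subtype.ext (by simpa [f] using hxy)
  intro x hx
  obtain ⟨y, hy⟩ := (Finite.injective_iff_surjective.mp hf) ⟨x, hx⟩
  have hy' : g * y * g⁻¹ = x := congrArg Subtype.val hy
  have : g⁻¹ * x * g = y := by rw [← hy']; group
  rw [this]
  exact y.2

namespace TameDatum

variable {L W : Type*} [Field L] [Group W] {d : ℕ} (D : TameDatum L W d)

instance : D.P.Normal := D.normal

/-- The inertia subgroup. -/
def I : Subgroup W := D.v.ker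

theorem mem_I {w : W} : w ∈ D.I ↔ D.v w = 1 := Iff.rfl

instance : D.I.Normal := by unfold I; infer_instance

theorem s_mem_I : D.s ∈ D.I := D.v_s

theorem P_le_I : D.P ≤ D.I := D.v_P

theorem closure_eq_top (K : Subgroup W) (hφ : D.φ ∈ K) (hs : D.s ∈ K) (hP : D.P ≤ K) : K = ⊤ := by
  rw [eq_top_iff]
  intro w _
  obtain ⟨a, b, c, p, hp, rfl⟩ := D.form w
  exact mul_mem (mul_mem (mul_mem (inv_mem (pow_mem hφ a)) (zpow_mem hs b)) (pow_mem hφ c)) (hP hp)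

/-- The valuation forces the two Frobenius exponents to agree. The conjugation cannot be dropped:
modulo `P`, conjugating `s` by the inverse of Frobenius yields a `q`-th root of `s`. -/
theorem form_I {w : W} (hw : w ∈ D.I) : ∃ (a : ℕ) (b : ℤ), ∃ p ∈ D.P,
    w = (D.φ ^ a)⁻¹ * (D.s ^ b * p) * D.φ ^ a := by
  obtain ⟨a, b, c, p, hp, rfl⟩ := D.form w
  have h := congrArg Multiplicative.toAdd (D.mem_I.mp hw)
  simp only [map_mul, map_inv, map_pow, map_zpow, D.v_φ, D.v_s, D.v_P p hp, one_zpow, mul_one,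
    toAdd_mul, toAdd_inv, toAdd_pow, toAdd_ofAdd, toAdd_one] at h
  have hac : a = c := by
    simp only [nsmul_eq_mul, mul_one] at h
    omega
  subst hac
  refine ⟨a, b, D.φ ^ a * p * (D.φ ^ a)⁻¹, D.normal.conj_mem p hp _, by group⟩

theorem tame_zpow (b : ℤ) : (D.s ^ (D.q * b))⁻¹ * (D.φ * D.s ^ b * D.φ⁻¹) ∈ D.P := by
  have h1 := D.tame
  rw [← QuotientGroup.eq] at h1 ⊢
  have h2 : D.φ * D.s ^ b * D.φ⁻¹ = (D.φ * D.s * D.φ⁻¹) ^ b := conj_zpow.symm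
  rw [h2, zpow_mul, zpow_natCast, QuotientGroup.mk_zpow, QuotientGroup.mk_zpow, h1]

theorem conj_s_zpow (b : ℤ) : ∃ p ∈ D.P, D.φ * D.s ^ b * D.φ⁻¹ = D.s ^ (D.q * b) * p :=
  ⟨_, D.tame_zpow b, by group⟩

/-! ### Finiteness of the image of inertia -/

theorem mulVec_mem_of_stable {K : Type*} [Field K] [Algebra L K] (V : Submodule K (Fin d → K))
    (hV : ∀ w, ∀ x ∈ V, ((D.r w : Matrix (Fin d) (Fin d) L).map (algebraMap L K)).mulVec x ∈ V)
    (M : Matrix (Fin d) (Fin d) L) : ∀ x ∈ V, (M.map (algebraMap L K)).mulVec x ∈ V := by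
  have hM : M ∈ Submodule.span L (Set.range fun w => (D.r w : Matrix (Fin d) (Fin d) L)) := by
    rw [D.span]
    trivial
  induction hM using Submodule.span_induction with
  | mem x hx =>
    obtain ⟨w, rfl⟩ := hx
    exact hV w
  | zero => intro x _; simp [Matrix.map_zero]
  | add A B _ _ hA hB =>
    intro x hx
    rw [Matrix.map_add _ (map_add _), Matrix.add_mulVec]
    exact add_mem (hA x hx) (hB x hx)
  | smul c A _ hA =>
    intro x hx
    have : (c • A).map (algebraMap L K) = algebraMap L K c • A.map (algebraMap L K) := by
      ext; simp
    rw [this, Matrix.smul_mulVec]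
    exact V.smul_mem _ (hA x hx)

/-- Irreducibility over every extension field: since the image of `r` spans the matrix algebra, a
stable subspace is stable under the matrix units, which move a nonzero coordinate to any position.
-/
theorem eq_top_of_stable {K : Type*} [Field K] [Algebra L K] (V : Submodule K (Fin d → K))
    (hV : ∀ w, ∀ x ∈ V, ((D.r w : Matrix (Fin d) (Fin d) L).map (algebraMap L K)).mulVec x ∈ V)
    (h0 : V ≠ ⊥) : V = ⊤ := by
  obtain ⟨x, hx, hx0⟩ := Submodule.exists_mem_ne_zero_of_ne_bot h0
  obtain ⟨i, hi⟩ := Function.ne_iff.mp hx0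
  have key : ∀ j, Pi.single j (1 : K) ∈ V := by
    intro j
    have h1 := D.mulVec_mem_of_stable V hV (Matrix.single j i 1) x hx
    rw [Matrix.map_single, map_one, Matrix.single_mulVec] at h1
    have h2 := V.smul_mem (x i)⁻¹ h1
    convert h2 using 1
    ext k
    by_cases hk : k = j
    · subst hk
      simp [inv_mul_cancel₀ (show x i ≠ 0 from hi)]
    · simp [hk]
  rw [eq_top_iff]
  intro y _
  rw [pi_eq_sum_univ' y]
  refine sum_mem fun j _ => V.smul_mem _ ?_
  convert key j using 1

theorem image_P_eq : D.r '' D.P = (D.P.map D.r : Subgroup _) := by simp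

/-- A first power of `s` centralises the finite group `r(P)`. Raising it further to the order of
that group kills the wild error term in the tame relation. -/
theorem exists_s_pow_commute : ∃ k > 0, (∀ p ∈ D.P, D.r D.s ^ k * D.r p = D.r p * D.r D.s ^ k) ∧
    D.r D.φ * D.r D.s ^ k * (D.r D.φ)⁻¹ = (D.r D.s ^ k) ^ D.q := by
  obtain ⟨k, hk, h⟩ := exists_pow_commute D.finite_P (D.r D.s) (by
    rintro _ ⟨p, hp, rfl⟩
    exact ⟨D.s * p * D.s⁻¹, D.normal.conj_mem p hp _, by simp⟩)
  have hfin : Finite (D.P.map D.r : Subgroup _) := by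
    have := D.finite_P.to_subtype
    rw [D.image_P_eq] at this
    exact this
  set M := Nat.card (D.P.map D.r : Subgroup _)
  refine ⟨k * M, Nat.mul_pos hk Nat.card_pos, fun p hp => ?_, ?_⟩
  · rw [pow_mul]
    exact Commute.pow_left (h _ ⟨p, hp, rfl⟩) M
  · obtain ⟨p, hp, h1⟩ := D.conj_s_zpow k
    have h2 := congrArg D.r h1
    simp only [map_mul, map_inv, map_zpow, zpow_natCast, map_pow] at h2
    rw [pow_mul, ← conj_pow, h2, mul_comm (D.q : ℤ), zpow_mul, zpow_natCast, zpow_natCast]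
    have hc : Commute ((D.r D.s ^ k) ^ D.q) (D.r p) := Commute.pow_left (h _ ⟨p, hp, rfl⟩) _
    have h3 : D.r p ^ M = 1 := by
      have := pow_card_eq_one' (x := (⟨D.r p, ⟨p, hp, rfl⟩⟩ : (D.P.map D.r : Subgroup _)))
      exact congrArg Subtype.val this
    rw [hc.mul_pow, h3, mul_one, ← pow_mul, ← pow_mul, ← pow_mul, ← pow_mul]
    congr 1
    ring

/-- Let `U` be the power of `r s` just found. As `U` is conjugate to `U ^ q` by Frobenius, its
finite set of eigenvalues is stable under `q`-th powers, so some eigenvalue is a root of unity. The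
fixed space of a suitable power of `U` is then nonzero and stable under `W`, hence everything by
irreducibility. -/
theorem exists_s_pow_eq_one : ∃ k > 0, D.r D.s ^ k = 1 := by
  obtain ⟨k, hk, hP, hφ⟩ := D.exists_s_pow_commute
  set U : GL (Fin d) L := D.r D.s ^ k with hU
  let K := AlgebraicClosure L
  let E : Matrix (Fin d) (Fin d) L →+* Module.End K (Fin d → K) :=
    (Matrix.toLinAlgEquiv' : Matrix (Fin d) (Fin d) K ≃ₐ[K] _).toRingEquiv.toRingHom.comp
      (algebraMap L K).mapMatrix
  have hEinj : Function.Injective E := by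
    refine (Matrix.toLinAlgEquiv' : Matrix (Fin d) (Fin d) K ≃ₐ[K] _).injective.comp ?_
    exact Matrix.map_injective (algebraMap L K).injective
  have : NeZero d := ⟨D.pos.ne'⟩
  have hEu : ∀ g : GL (Fin d) L, E (g⁻¹ : GL (Fin d) L).1 * E g.1 = 1 := fun g => by
    rw [← map_mul, Units.inv_mul, map_one]
  have hpow : ∀ i : ℕ, ∀ c : K, (E U.1).HasEigenvalue c → (E U.1).HasEigenvalue (c ^ D.q ^ i) := by
    intro i
    induction i with
    | zero => simp
    | succ i ih =>
      intro c hc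
      obtain ⟨x, hx⟩ := (ih c hc).exists_hasEigenvector
      rw [pow_succ, pow_mul]
      refine Module.End.hasEigenvalue_of_hasEigenvector
        (x := E ((D.r D.φ)⁻¹ : GL (Fin d) L).1 x) ⟨?_, ?_⟩
      · rw [Module.End.mem_eigenspace_iff]
        have h1 : U * (D.r D.φ)⁻¹ = (D.r D.φ)⁻¹ * U ^ D.q := by rw [← hφ]; group
        have h2 := congrArg (fun g : GL (Fin d) L => E g.1 x) h1
        simp only [Units.val_mul, map_mul, Units.val_pow_eq_pow_val, map_pow,
          Module.End.mul_apply] at h2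
        rw [h2, hx.pow_apply, map_smul]
      · intro h0
        apply hx.2
        have h1 := hEu (D.r D.φ)⁻¹
        have h2 := LinearMap.congr_fun h1 x
        rw [Module.End.mul_apply, h0, map_zero] at h2
        exact h2.symm
  obtain ⟨c, hc⟩ := Module.End.exists_eigenvalue (E U.1)
  have hc0 : c ≠ 0 := by
    rintro rfl
    obtain ⟨x, hx⟩ := hc.exists_hasEigenvector
    have h1 := hx.apply_eq_smul
    rw [zero_smul] at h1
    have h2 := LinearMap.congr_fun (hEu U) x
    rw [Module.End.mul_apply, h1, map_zero] at h2
    exact hx.2 h2.symm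
  obtain ⟨i, j, hij, hcij⟩ : ∃ i j : ℕ, i < j ∧ c ^ D.q ^ i = c ^ D.q ^ j := by
    have hfin : Finite {c : K // (E U.1).HasEigenvalue c} :=
      (Module.End.finite_hasEigenvalue (E U.1)).to_subtype
    obtain ⟨i, j, hij, h⟩ := Finite.exists_ne_map_eq_of_infinite
      (fun i : ℕ => (⟨c ^ D.q ^ i, hpow i c hc⟩ : {c : K // (E U.1).HasEigenvalue c}))
    have h' := congrArg Subtype.val h
    rcases lt_or_gt_of_ne hij with hlt | hlt
    · exact ⟨i, j, hlt, h'⟩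
    · exact ⟨j, i, hlt, h'.symm⟩
  have hlt : D.q ^ i < D.q ^ j := Nat.pow_lt_pow_right D.two_le hij
  set M := D.q ^ j - D.q ^ i with hM
  have hcM : c ^ M = 1 := by
    have h1 : D.q ^ j = D.q ^ i + M := by omega
    rw [h1, pow_add] at hcij
    exact (mul_right_eq_self₀.mp hcij.symm).resolve_right (pow_ne_zero _ hc0)
  let V : Submodule K (Fin d → K) := LinearMap.eqLocus (E (U ^ M).1) LinearMap.id
  have hmemV : ∀ x, x ∈ V ↔ E (U ^ M).1 x = x := fun x => Iff.rfl
  have hV0 : V ≠ ⊥ := by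
    obtain ⟨x, hx⟩ := hc.exists_hasEigenvector
    refine (Submodule.ne_bot_iff _).mpr ⟨x, ?_, hx.2⟩
    rw [hmemV, Units.val_pow_eq_pow_val, map_pow, hx.pow_apply, hcM, one_smul]
  have hcomm : ∀ g : GL (Fin d) L, Commute U g → ∀ x ∈ V, E g.1 x ∈ V := by
    intro g hg x hx
    rw [hmemV] at hx ⊢
    have h1 := congrArg (fun g : GL (Fin d) L => E g.1 x) (hg.pow_left M).eq
    simp only [Units.val_mul, map_mul, Module.End.mul_apply] at h1
    rw [h1, hx]
  have hφV : ∀ x ∈ V, E ((D.r D.φ)⁻¹ : GL (Fin d) L).1 x ∈ V := by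
    intro x hx
    rw [hmemV] at hx ⊢
    have h1 : U ^ M * (D.r D.φ)⁻¹ = (D.r D.φ)⁻¹ * (U ^ M) ^ D.q := by
      have : (U ^ M) ^ D.q = D.r D.φ * U ^ M * (D.r D.φ)⁻¹ := by
        rw [← conj_pow, hφ]
        exact pow_right_comm _ _ _
      rw [this, mul_assoc (D.r D.φ), inv_mul_cancel_left]
    have h2 := congrArg (fun g : GL (Fin d) L => E g.1 x) h1
    simp only [Units.val_mul, map_mul, Module.End.mul_apply] at h2
    rw [h2, Units.val_pow_eq_pow_val, map_pow]
    congr 1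
    clear h1 h2
    generalize D.q = n
    induction n with
    | zero => simp
    | succ n ih => rw [pow_succ, Module.End.mul_apply, hx, ih]
  -- The inverse of Frobenius is injective on the finite-dimensional space `V`, hence bijective on
  -- it, so Frobenius preserves `V` too.
  have hφV' : ∀ x ∈ V, E (D.r D.φ).1 x ∈ V := by
    let f : V →ₗ[K] V := (E ((D.r D.φ)⁻¹ : GL (Fin d) L).1).restrict hφV
    have hf : Function.Injective f := by
      intro x y hxy
      have h1 := congrArg Subtype.val hxy
      have h2 := congrArg (E (D.r D.φ).1) h1
      have h3 : ∀ z, E (D.r D.φ).1 (E ((D.r D.φ)⁻¹ : GL (Fin d) L).1 z) = z := fun z => by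
        have := LinearMap.congr_fun (hEu (D.r D.φ)⁻¹) z
        rwa [inv_inv] at this
      have h4 : E (D.r D.φ).1 (E ((D.r D.φ)⁻¹ : GL (Fin d) L).1 x) =
        E (D.r D.φ).1 (E ((D.r D.φ)⁻¹ : GL (Fin d) L).1 y) := h2
      rw [h3, h3] at h4
      exact Subtype.ext h4
    intro x hx
    obtain ⟨y, hy⟩ := (LinearMap.injective_iff_surjective.mp hf) ⟨x, hx⟩
    have h1 : E ((D.r D.φ)⁻¹ : GL (Fin d) L).1 y = x := congrArg Subtype.val hy
    have h2 := LinearMap.congr_fun (hEu (D.r D.φ)⁻¹) y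
    rw [inv_inv, Module.End.mul_apply, h1] at h2
    rw [h2]
    exact y.2
  have hstab : ∀ w, ∀ x ∈ V, E (D.r w).1 x ∈ V := by
    intro w
    obtain ⟨a, b, e, p, hp, rfl⟩ := D.form w
    intro x hx
    simp only [map_mul, map_inv, map_pow, map_zpow, Units.val_mul, Module.End.mul_apply]
    have hpowV : ∀ (g : GL (Fin d) L) (_ : ∀ x ∈ V, E g.1 x ∈ V) (n : ℕ), ∀ x ∈ V,
        E (g ^ n).1 x ∈ V := by
      intro g hg n
      induction n with
      | zero => simp
      | succ n ih =>
        intro x hx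
        rw [pow_succ, Units.val_mul, map_mul]
        exact ih _ (hg x hx)
    have h1 := hcomm _ (hP p hp) x hx
    have h2 := hpowV _ hφV' e _ h1
    have h3 := hcomm (D.r D.s ^ b) (by
      rw [hU]
      exact (((Commute.refl (D.r D.s)).pow_left k).zpow_right b)) _ h2
    rw [← inv_pow]
    exact hpowV _ hφV a _ h3
  have htop := D.eq_top_of_stable V hstab hV0
  refine ⟨k * M, Nat.mul_pos hk (by omega), ?_⟩
  rw [pow_mul, ← hU]
  apply Units.ext
  apply hEinj
  refine LinearMap.ext fun x => ?_
  have hx : x ∈ V := htop ▸ Submodule.mem_top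
  rw [hmemV] at hx
  rw [hx]
  simp

open scoped Pointwise in
-- The images of the elements `s ^ b * p` form a finite set stable under conjugation by Frobenius,
-- hence also by its inverse; by `form_I` this set contains the whole image of inertia.
theorem finite_image_I : (D.r '' D.I).Finite := by
  obtain ⟨k, hk, h1⟩ := D.exists_s_pow_eq_one
  have hfin : (((Subgroup.zpowers (D.r D.s) : Subgroup _) : Set (GL (Fin d) L)) *
      (D.r '' D.P)).Finite := by
    refine Set.Finite.mul ?_ D.finite_P
    have := (isOfFinOrder_iff_pow_eq_one.mpr ⟨k, hk, h1⟩)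
    exact this.finite_zpowers
  refine hfin.subset ?_
  have hst : ∀ x ∈ ((Subgroup.zpowers (D.r D.s) : Subgroup _) : Set (GL (Fin d) L)) *
      (D.r '' D.P), D.r D.φ * x * (D.r D.φ)⁻¹ ∈
      ((Subgroup.zpowers (D.r D.s) : Subgroup _) : Set (GL (Fin d) L)) * (D.r '' D.P) := by
    rintro _ ⟨_, ⟨b, rfl⟩, _, ⟨p, hp, rfl⟩, rfl⟩
    obtain ⟨p', hp', h2⟩ := D.conj_s_zpow b
    refine ⟨D.r D.s ^ (D.q * b : ℤ), ⟨_, rfl⟩, D.r (p' * (D.φ * p * D.φ⁻¹)),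
      ⟨_, mul_mem hp' (D.normal.conj_mem p hp _), rfl⟩, ?_⟩
    dsimp only
    rw [← map_zpow, ← map_zpow, ← map_mul, ← map_mul, ← map_mul, ← map_inv, ← map_mul,
      ← mul_assoc, ← h2]
    congr 1
    group
  have hst' := conj_inv_mem hfin (D.r D.φ) hst
  rintro _ ⟨w, hw, rfl⟩
  obtain ⟨a, b, p, hp, rfl⟩ := D.form_I hw
  have h0 : D.r (D.s ^ b * p) ∈ ((Subgroup.zpowers (D.r D.s) : Subgroup _) : Set (GL (Fin d) L)) *
      (D.r '' D.P) := ⟨_, ⟨b, rfl⟩, _, ⟨p, hp, rfl⟩, by simp⟩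
  clear hst hw
  induction a with
  | zero => simpa using h0
  | succ a ih =>
    have := hst' _ ih
    rw [← map_inv, ← map_mul, ← map_mul] at this
    convert this using 2
    rw [pow_succ]
    group

/-- The image of inertia, as a finite group. -/
abbrev Γ : Subgroup (GL (Fin d) L) := D.I.map D.r

instance : Finite D.Γ := by
  have := D.finite_image_I.to_subtype
  rwa [show D.r '' D.I = (D.Γ : Set (GL (Fin d) L)) by simp] at this

theorem r_mem_Γ {w : W} (hw : w ∈ D.I) : D.r w ∈ D.Γ := ⟨w, hw, rfl⟩

/-! ### Base change of the representation and its commutants -/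

/-- The base change of `r` to an algebra over the ground field. -/
def rB (R : Type*) [CommRing R] [Algebra L R] : W →* GL (Fin d) R := mapGL (algebraMap L R) D.r

section BaseChange

variable (R : Type*) [CommRing R] [Algebra L R]

theorem coe_rB (w : W) : (D.rB R w : Matrix (Fin d) (Fin d) R) =
    (D.r w : Matrix (Fin d) (Fin d) L).map (algebraMap L R) := rfl

variable {R}

theorem commute_map {X : Matrix (Fin d) (Fin d) R} (hX : ∀ w, Commute X (D.rB R w).1)
    (M : Matrix (Fin d) (Fin d) L) : Commute X (M.map (algebraMap L R)) := by
  have hM : M ∈ Submodule.span L (Set.range fun w => (D.r w : Matrix (Fin d) (Fin d) L)) := by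
    rw [D.span]
    trivial
  induction hM using Submodule.span_induction with
  | mem x hx =>
    obtain ⟨w, rfl⟩ := hx
    exact hX w
  | zero => simp [Matrix.map_zero]
  | add A B _ _ hA hB =>
    rw [Matrix.map_add _ (map_add _)]
    exact hA.add_right hB
  | smul c A _ hA =>
    have : (c • A).map (algebraMap L R) = c • A.map (algebraMap L R) := by
      ext i j
      rw [Matrix.map_apply, Matrix.smul_apply, Matrix.smul_apply, smul_eq_mul, map_mul,
        Algebra.smul_def]
      rfl
    rw [this]
    exact hA.smul_right c

/-- Schur's lemma for `r` over an arbitrary base. -/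
theorem exists_scalar {X : Matrix (Fin d) (Fin d) R} (hX : ∀ w, Commute X (D.rB R w).1) :
    ∃ c : R, X = Matrix.scalar (Fin d) c := by
  have : X ∈ Set.range (Matrix.scalar (Fin d)) := by
    rw [Matrix.mem_range_scalar_iff_commute_single]
    intro i j _
    have := D.commute_map hX (Matrix.single i j 1)
    rw [Matrix.map_single, map_one] at this
    exact this.symm
  obtain ⟨c, hc⟩ := this
  exact ⟨c, hc.symm⟩

/-- It suffices to check commutation on inertia and Frobenius. -/
theorem exists_scalar_of_commute {X : Matrix (Fin d) (Fin d) R}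
    (hI : ∀ w ∈ D.I, Commute X (D.rB R w).1) (hφ : Commute X (D.rB R D.φ).1) :
    ∃ c : R, X = Matrix.scalar (Fin d) c := by
  refine D.exists_scalar fun w => ?_
  let K : Subgroup W := (Subgroup.comap (D.rB R)
    { carrier := {g : GL (Fin d) R | Commute X g.1}
      one_mem' := Commute.one_right X
      mul_mem' := fun ha hb => Commute.mul_right ha hb
      inv_mem' := fun {g} hg => Commute.units_inv_right (u := g) hg })
  have hK : K = ⊤ := D.closure_eq_top K hφ (hI _ D.s_mem_I) fun p hp => hI _ (D.P_le_I hp)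
  have : w ∈ K := hK ▸ Subgroup.mem_top w
  exact this

end BaseChange

/-- A power of Frobenius which acts as a scalar. -/
theorem exists_φ_pow_scalar : ∃ h > 0, ∃ c : L, (D.r (D.φ ^ h)).1 = Matrix.scalar (Fin d) c := by
  obtain ⟨h, h0, hc⟩ := exists_pow_commute D.finite_image_I (D.r D.φ) (by
    rintro _ ⟨w, hw, rfl⟩
    exact ⟨D.φ * w * D.φ⁻¹, (inferInstance : D.I.Normal).conj_mem w hw _, by simp⟩)
  have hmap : ∀ w, (D.rB L w).1 = (D.r w).1 := fun w => by
    rw [coe_rB]; ext; simp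
  refine ⟨h, h0, D.exists_scalar_of_commute (R := L) ?_ ?_⟩
  · intro w hw
    rw [hmap, map_pow]
    exact congrArg Units.val (hc _ ⟨w, hw, rfl⟩)
  · rw [hmap, map_pow]
    exact congrArg Units.val ((Commute.refl (D.r D.φ)).pow_left h).eq

/-- The exponent of a power of Frobenius which acts as a scalar. -/
def h : ℕ := D.exists_φ_pow_scalar.choose

theorem h_pos : 0 < D.h := D.exists_φ_pow_scalar.choose_spec.1

theorem exists_r_φ_pow_h : ∃ c : L, (D.r (D.φ ^ D.h)).1 = Matrix.scalar (Fin d) c :=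
  D.exists_φ_pow_scalar.choose_spec.2

theorem r_φ_pow_h_mul (w : W) : D.r (D.φ ^ D.h) * D.r w = D.r w * D.r (D.φ ^ D.h) := by
  obtain ⟨c, hc⟩ := D.exists_r_φ_pow_h
  apply Units.ext
  rw [Units.val_mul, Units.val_mul, hc]
  exact (Matrix.scalar_commute c (fun _ => Commute.all _ _) _).eq

/-! ### The commutant of inertia is commutative -/

/-- Matrices commuting with the image of inertia. -/
def commutant (R : Type*) [CommRing R] [Algebra L R] : Subalgebra R (Matrix (Fin d) (Fin d) R) :=
  Subalgebra.centralizer R ((fun w => (D.rB R w).1) '' D.I)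

theorem mem_commutant {R : Type*} [CommRing R] [Algebra L R] {X : Matrix (Fin d) (Fin d) R} :
    X ∈ D.commutant R ↔ ∀ w ∈ D.I, Commute X (D.rB R w).1 := by
  simp only [commutant, Subalgebra.mem_centralizer_iff, Set.forall_mem_image]
  exact forall₂_congr fun w _ => eq_comm

theorem conj_mem_commutant {R : Type*} [CommRing R] [Algebra L R] {X : Matrix (Fin d) (Fin d) R}
    (hX : X ∈ D.commutant R) (w : W) :
    (D.rB R w).1 * X * (D.rB R w⁻¹).1 ∈ D.commutant R := by
  rw [mem_commutant] at hX ⊢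
  intro w' hw'
  have h1 := hX (w⁻¹ * w' * w) (by
    simpa using (inferInstance : D.I.Normal).conj_mem w' hw' w⁻¹)
  have hab : (D.rB R w).1 * (D.rB R w⁻¹).1 = 1 := by
    rw [← Units.val_mul, ← map_mul, mul_inv_cancel, map_one, Units.val_one]
  have hab' : ∀ Z, (D.rB R w).1 * ((D.rB R w⁻¹).1 * Z) = Z := fun Z => by
    rw [← mul_assoc, hab, one_mul]
  rw [map_mul, map_mul, Units.val_mul, Units.val_mul] at h1
  change _ * _ = _ * _
  calc (D.rB R w).1 * X * (D.rB R w⁻¹).1 * (D.rB R w').1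
      = (D.rB R w).1 * (X * ((D.rB R w⁻¹).1 * (D.rB R w').1 * (D.rB R w).1)) *
        (D.rB R w⁻¹).1 := by simp only [mul_assoc, hab, mul_one]
    _ = _ := by
      rw [h1.eq]
      simp only [mul_assoc, hab']

end TameDatum
namespace TameDatum

variable {L W : Type*} [Field L] [Group W] {d : ℕ} (D : TameDatum L W d)

section

variable {R R' : Type*} [CommRing R] [Algebra L R] [CommRing R'] [Algebra L R']

theorem map_rB (f : R →ₐ[L] R') (w : W) :
    (D.rB R w).1.map f = (D.rB R' w).1 := by
  rw [coe_rB, coe_rB, Matrix.map_map]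
  congr 1
  ext x
  exact f.commutes x

theorem map_mem_commutant (f : R →ₐ[L] R') {X : Matrix (Fin d) (Fin d) R}
    (hX : X ∈ D.commutant R) : X.map f ∈ D.commutant R' := by
  rw [mem_commutant] at hX ⊢
  intro w hw
  have := congrArg (fun Y => Y.map f) (hX w hw).eq
  simp only [Matrix.map_mul, map_rB] at this
  exact this

end

/-! ### Frobenius acting on the commutant of inertia over an algebraically closed field -/

section AlgClosed

variable {K : Type*} [Field K] [IsAlgClosed K] [Algebra L K]

/-- Conjugation by Frobenius on the commutant of inertia. -/
def frobConj (K : Type*) [Field K] [Algebra L K] : Module.End K (D.commutant K) where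
  toFun X := ⟨(D.rB K D.φ).1 * X * (D.rB K D.φ⁻¹).1, D.conj_mem_commutant X.2 _⟩
  map_add' X Y := Subtype.ext (by simp [mul_add, add_mul])
  map_smul' c X := Subtype.ext (by simp)

theorem frobConj_mul (X Y : D.commutant K) :
    D.frobConj K (X * Y) = D.frobConj K X * D.frobConj K Y := by
  refine Subtype.ext ?_
  have hab : (D.rB K D.φ⁻¹).1 * (D.rB K D.φ).1 = 1 := by
    rw [← Units.val_mul, ← map_mul, inv_mul_cancel, map_one, Units.val_one]
  have hab' : ∀ Z, (D.rB K D.φ⁻¹).1 * ((D.rB K D.φ).1 * Z) = Z := fun Z => by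
    rw [← mul_assoc, hab, one_mul]
  simp only [frobConj, LinearMap.coe_mk, AddHom.coe_mk, Subalgebra.coe_mul]
  simp only [mul_assoc, hab']

theorem frobConj_pow (n : ℕ) (X : D.commutant K) :
    ((D.frobConj K ^ n) X : Matrix (Fin d) (Fin d) K) =
      (D.rB K (D.φ ^ n)).1 * X * (D.rB K (D.φ ^ n)⁻¹).1 := by
  induction n with
  | zero => simp
  | succ n ih =>
    rw [pow_succ', Module.End.mul_apply]
    simp only [frobConj, LinearMap.coe_mk, AddHom.coe_mk] at ih ⊢
    rw [ih, pow_succ', mul_inv_rev, map_mul, map_mul, Units.val_mul, Units.val_mul]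
    simp only [mul_assoc]

theorem frobConj_pow_h : D.frobConj K ^ D.h = 1 := by
  refine LinearMap.ext fun X => Subtype.ext ?_
  rw [frobConj_pow]
  obtain ⟨c, hc⟩ := D.exists_r_φ_pow_h
  have h1 : (D.rB K (D.φ ^ D.h)).1 = Matrix.scalar (Fin d) (algebraMap L K c) := by
    rw [coe_rB, hc]
    ext i j
    by_cases hij : i = j
    · subst hij; simp
    · simp [hij]
  have h2 : Commute (D.rB K (D.φ ^ D.h)).1 (X : Matrix (Fin d) (Fin d) K) := by
    rw [h1]
    exact Matrix.scalar_commute _ (fun _ => Commute.all _ _) _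
  rw [h2.eq, mul_assoc, ← Units.val_mul, ← map_mul, mul_inv_cancel]
  simp

theorem isScalar_of_frobConj_eq {X : D.commutant K} (hX : D.frobConj K X = X) :
    ∃ c : K, X = algebraMap K _ c := by
  have h1 : (D.rB K D.φ).1 * X.1 * (D.rB K D.φ⁻¹).1 = X.1 := congrArg Subtype.val hX
  have h2 : Commute X.1 (D.rB K D.φ).1 := by
    change _ * _ = _ * _
    conv_lhs => rw [← h1]
    rw [mul_assoc, ← Units.val_mul, ← map_mul, inv_mul_cancel, map_one, Units.val_one, mul_one]
  obtain ⟨c, hc⟩ := D.exists_scalar_of_commute (D.mem_commutant.mp X.2) h2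
  exact ⟨c, Subtype.ext hc⟩

/-- The nonzero eigenvectors of Frobenius in the commutant are invertible. -/
theorem exists_inverse_of_eigenvector {X : D.commutant K} {c : K} (hc : c ≠ 0)
    (hX : D.frobConj K X = c • X) (h0 : X ≠ 0) : ∃ Y : D.commutant K, Y * X = 1 ∧ X * Y = 1 ∧
      D.frobConj K Y = c⁻¹ • Y := by
  have hXφ : (D.rB K D.φ).1 * X.1 = c • X.1 * (D.rB K D.φ).1 := by
    have h1 : (D.rB K D.φ).1 * X.1 * (D.rB K D.φ⁻¹).1 = c • X.1 := congrArg Subtype.val hX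
    rw [← h1, mul_assoc _ _ (D.rB K D.φ).1, ← Units.val_mul, ← map_mul, inv_mul_cancel, map_one,
      Units.val_one, mul_one]
  -- An eigenvector commutes with each `r w` up to a nonzero scalar, since it does so on inertia and
  -- on Frobenius. Its kernel is therefore stable under `W`, and irreducibility makes it zero.
  have hsemi : ∀ w, ∃ a : K, a ≠ 0 ∧ X.1 * (D.rB K w).1 = a • ((D.rB K w).1 * X.1) := by
    intro w
    let S : Subgroup W :=
      { carrier := {w | ∃ a : K, a ≠ 0 ∧ X.1 * (D.rB K w).1 = a • ((D.rB K w).1 * X.1)}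
        one_mem' := ⟨1, one_ne_zero, by simp⟩
        mul_mem' := by
          rintro x y ⟨a, ha, hx⟩ ⟨b, hb, hy⟩
          refine ⟨a * b, mul_ne_zero ha hb, ?_⟩
          rw [map_mul, Units.val_mul, ← mul_assoc, hx, smul_mul_assoc, mul_assoc, hy,
            mul_smul_comm, smul_smul, mul_assoc]
        inv_mem' := by
          rintro x ⟨a, ha, hx⟩
          refine ⟨a⁻¹, inv_ne_zero ha, ?_⟩
          have e1 : (D.rB K x).1 * (D.rB K x⁻¹).1 = 1 := by
            rw [← Units.val_mul, ← map_mul, mul_inv_cancel, map_one, Units.val_one]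
          have e2 : (D.rB K x⁻¹).1 * (D.rB K x).1 = 1 := by
            rw [← Units.val_mul, ← map_mul, inv_mul_cancel, map_one, Units.val_one]
          have h1 := congrArg (fun Y => (D.rB K x⁻¹).1 * Y * (D.rB K x⁻¹).1) hx
          simp only [mul_smul_comm, smul_mul_assoc] at h1
          rw [← mul_assoc (D.rB K x⁻¹).1 (D.rB K x).1, e2, one_mul, mul_assoc, mul_assoc X.1, e1,
            mul_one] at h1
          rw [h1, smul_smul, inv_mul_cancel₀ ha, one_smul] }
    have hS : S = ⊤ := by
      have hI : ∀ w ∈ D.I, w ∈ S := fun w hw =>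
        ⟨1, one_ne_zero, by rw [one_smul]; exact (D.mem_commutant.mp X.2 w hw).eq⟩
      refine D.closure_eq_top S ⟨c⁻¹, inv_ne_zero hc, ?_⟩ (hI _ D.s_mem_I)
        fun p hp => hI _ (D.P_le_I hp)
      rw [hXφ, smul_mul_assoc, smul_smul, inv_mul_cancel₀ hc, one_smul]
    have : w ∈ S := hS ▸ Subgroup.mem_top w
    exact this
  let V : Submodule K (Fin d → K) := LinearMap.ker (Matrix.toLin' X.1)
  have hV : V = ⊥ := by
    by_contra hne
    have htop := D.eq_top_of_stable V (by
      intro w x hx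
      obtain ⟨a, -, ha⟩ := hsemi w
      simp only [V, LinearMap.mem_ker, Matrix.toLin'_apply] at hx ⊢
      change X.1.mulVec ((D.rB K w).1.mulVec x) = 0
      rw [Matrix.mulVec_mulVec, ha, Matrix.smul_mulVec, ← Matrix.mulVec_mulVec, hx,
        Matrix.mulVec_zero, smul_zero]) hne
    apply h0
    refine Subtype.ext (Matrix.toLin'.injective ?_)
    rw [LinearMap.ker_eq_top.mp htop]
    simp
  have hinj : Function.Injective X.1.mulVec := by
    have := LinearMap.ker_eq_bot.mp hV
    exact this
  obtain ⟨u, hu⟩ := Matrix.mulVec_injective_iff_isUnit.mp hinj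
  have hu1 : u⁻¹.1 * X.1 = 1 := by rw [← hu]; simp
  have hu2 : X.1 * u⁻¹.1 = 1 := by rw [← hu]; simp
  let Y : D.commutant K := ⟨u⁻¹.1, by
    rw [mem_commutant]
    intro w hw
    have := D.mem_commutant.mp X.2 w hw
    rw [← hu] at this
    exact this.units_inv_left⟩
  have hYX : Y * X = 1 := Subtype.ext hu1
  have hXY : X * Y = 1 := Subtype.ext hu2
  refine ⟨Y, hYX, hXY, ?_⟩
  have h1 : D.frobConj K X * D.frobConj K Y = 1 := by
    rw [← frobConj_mul, hXY]
    refine Subtype.ext ?_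
    simp [frobConj]
  rw [hX, smul_mul_assoc] at h1
  have h2 := congrArg (fun Z => c⁻¹ • (Y * Z)) h1
  simp only [mul_smul_comm, smul_smul, inv_mul_cancel₀ hc, one_smul, mul_one] at h2
  rw [← mul_assoc, hYX, one_mul] at h2
  exact h2

/-- The quotient of two eigenvectors with the same eigenvalue commutes with inertia and with
Frobenius, so it is a scalar by Schur's lemma. -/
theorem eigenvector_unique {X Y : D.commutant K} {c : K} (hc : c ≠ 0)
    (hX : D.frobConj K X = c • X) (hY : D.frobConj K Y = c • Y) (h0 : X ≠ 0) :
    ∃ a : K, Y = a • X := by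
  obtain ⟨Z, hZX, -, hZ⟩ := D.exists_inverse_of_eigenvector hc hX h0
  obtain ⟨a, ha⟩ := D.isScalar_of_frobConj_eq (X := Y * Z) (by
    rw [frobConj_mul, hY, hZ, smul_mul_smul_comm, mul_inv_cancel₀ hc, one_smul])
  refine ⟨a, ?_⟩
  have := congrArg (fun T => T * X) ha
  simp only [mul_assoc, hZX, mul_one] at this
  rw [this, Algebra.smul_def]

theorem eigenvalue_pow_h {X : D.commutant K} {c : K} (hX : D.frobConj K X = c • X) (h0 : X ≠ 0) :
    c ^ D.h = 1 := by
  have h1 : ∀ n, (D.frobConj K ^ n) X = c ^ n • X := by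
    intro n
    induction n with
    | zero => simp
    | succ n ih => rw [pow_succ', Module.End.mul_apply, ih, map_smul, hX, smul_smul, pow_succ]
  have h2 := h1 D.h
  rw [frobConj_pow_h, Module.End.one_apply] at h2
  by_contra h
  apply h0
  have h3 : (c ^ D.h - 1) • X = 0 := by rw [sub_smul, ← h2, one_smul, sub_self]
  exact (smul_eq_zero.mp h3).resolve_left (sub_ne_zero.mpr h)

/-- The eigenvalues of Frobenius on the commutant form a subgroup of the `h`-th roots of unity,
hence a cyclic group. Eigenspaces being lines, every eigenvector is a multiple of a power of an
eigenvector `Z` for a generator, and powers of `Z` commute. -/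
theorem commute_of_eigenvectors {X Y : D.commutant K} {a b : K}
    (hX : D.frobConj K X = a • X) (hY : D.frobConj K Y = b • Y) : Commute X Y := by
  by_cases hX0 : X = 0
  · rw [hX0]; exact Commute.zero_left _
  by_cases hY0 : Y = 0
  · rw [hY0]; exact Commute.zero_right _
  have hone : D.frobConj K 1 = 1 := Subtype.ext (by simp [frobConj])
  have hh := D.h_pos.ne'
  have hnt : Nontrivial (D.commutant K) := ⟨⟨X, 0, hX0⟩⟩
  let S : Subgroup Kˣ :=
    { carrier := {c | ∃ Z : D.commutant K, Z ≠ 0 ∧ D.frobConj K Z = (c : K) • Z}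
      one_mem' := ⟨1, one_ne_zero, by simp [hone]⟩
      mul_mem' := by
        rintro c e ⟨Z, hZ0, hZ⟩ ⟨T, hT0, hT⟩
        refine ⟨Z * T, fun h0 => hT0 ?_, ?_⟩
        · obtain ⟨Z', hZ', -, -⟩ := D.exists_inverse_of_eigenvector c.ne_zero hZ hZ0
          rw [← one_mul T, ← hZ', mul_assoc, h0, mul_zero]
        · rw [frobConj_mul, hZ, hT, smul_mul_smul_comm, Units.val_mul]
      inv_mem' := by
        rintro c ⟨Z, hZ0, hZ⟩
        obtain ⟨Z', hZ', -, h1⟩ := D.exists_inverse_of_eigenvector c.ne_zero hZ hZ0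
        refine ⟨Z', fun h0 => ?_, by simpa using h1⟩
        rw [h0, zero_mul] at hZ'
        exact zero_ne_one hZ' }
  have hSfin : Finite S := by
    have : NeZero D.h := ⟨hh⟩
    have hle : S ≤ rootsOfUnity D.h K := by
      rintro c ⟨Z, hZ0, hZ⟩
      rw [mem_rootsOfUnity']
      exact D.eigenvalue_pow_h hZ hZ0
    exact Finite.of_injective _ (Subgroup.inclusion_injective hle)
  obtain ⟨⟨ζ, Z, hZ0, hZ⟩, hgen⟩ := IsCyclic.exists_generator (α := S)
  have hpow : ∀ n : ℕ, D.frobConj K (Z ^ n) = (ζ : K) ^ n • Z ^ n := by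
    intro n
    induction n with
    | zero => simp [hone]
    | succ n ih => rw [pow_succ, frobConj_mul, ih, hZ, smul_mul_smul_comm, pow_succ]
  have hpow0 : ∀ n : ℕ, Z ^ n ≠ 0 := by
    obtain ⟨Z', hZ', -, -⟩ := D.exists_inverse_of_eigenvector ζ.ne_zero hZ hZ0
    intro n h0
    induction n with
    | zero =>
      rw [pow_zero] at h0
      exact one_ne_zero h0
    | succ n ih =>
      rw [pow_succ'] at h0
      exact ih (by rw [← one_mul (Z ^ n), ← hZ', mul_assoc, h0, mul_zero])
  have key : ∀ (T : D.commutant K) (e : K), T ≠ 0 → D.frobConj K T = e • T →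
      ∃ (n : ℕ) (x : K), T = x • Z ^ n := by
    intro T e hT0 hT
    have he : e ≠ 0 := fun h0 => by
      have := D.eigenvalue_pow_h hT hT0
      rw [h0, zero_pow hh] at this
      exact zero_ne_one this
    have hmem := hgen ⟨Units.mk0 e he, T, hT0, hT⟩
    rw [← mem_powers_iff_mem_zpowers] at hmem
    obtain ⟨n, hn⟩ := hmem
    have hn' : (ζ : K) ^ n = e := by
      have := congrArg (fun t : S => ((t : Kˣ) : K)) hn
      simpa using this
    obtain ⟨x, hx⟩ := D.eigenvector_unique (pow_ne_zero n ζ.ne_zero) (hpow n) (hn' ▸ hT) (hpow0 n)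
    exact ⟨n, x, hx⟩
  obtain ⟨n, x, rfl⟩ := key X a hX0 hX
  obtain ⟨n', y, rfl⟩ := key Y b hY0 hY
  exact (((Commute.refl Z).pow_pow n n').smul_left x).smul_right y

/-- Conjugation by Frobenius has finite order, so in characteristic zero it is diagonalisable and
its eigenvectors span the commutant. -/
theorem commutant_commute_of_isAlgClosed [CharZero K] (X Y : D.commutant K) : Commute X Y := by
  have hss : (D.frobConj K).IsSemisimple := by
    refine Module.End.isSemisimple_of_squarefree_aeval_eq_zero
      (p := (Polynomial.X ^ D.h - 1 : Polynomial K)) ?_ ?_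
    · have : NeZero (D.h : K) := ⟨by exact_mod_cast D.h_pos.ne'⟩
      exact (Polynomial.separable_X_pow_sub_C (1 : K) this.out one_ne_zero).squarefree
    · simp [frobConj_pow_h]
  have htop : ⨆ c, Module.End.eigenspace (D.frobConj K) c = ⊤ := by
    rw [← Module.End.iSup_maxGenEigenspace_eq_top (D.frobConj K)]
    congr 1
    ext1 c
    exact (hss.isFinitelySemisimple.maxGenEigenspace_eq_eigenspace c).symm
  have hX : X ∈ ⨆ c, Module.End.eigenspace (D.frobConj K) c := htop ▸ Submodule.mem_top
  have hY : Y ∈ ⨆ c, Module.End.eigenspace (D.frobConj K) c := htop ▸ Submodule.mem_top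
  induction hX using Submodule.iSup_induction' with
  | zero => exact Commute.zero_left _
  | add _ _ _ _ h1 h2 => exact h1.add_left h2
  | mem c X hX =>
    induction hY using Submodule.iSup_induction' with
    | zero => exact Commute.zero_right _
    | add _ _ _ _ h1 h2 => exact h1.add_right h2
    | mem c' Y hY =>
      exact D.commute_of_eigenvectors (Module.End.mem_eigenspace_iff.mp hX)
        (Module.End.mem_eigenspace_iff.mp hY)

end AlgClosed

/-! ### The projection onto the commutant -/

variable [CharZero L]

instance : Fintype D.Γ := Fintype.ofFinite _

section Projection

variable (R : Type*) [CommRing R] [Algebra L R]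

/-- The averaging projection onto the commutant of inertia. -/
def proj (X : Matrix (Fin d) (Fin d) R) : Matrix (Fin d) (Fin d) R :=
  (Fintype.card D.Γ : L)⁻¹ • ∑ γ : D.Γ,
    (mapGL (algebraMap L R) D.Γ.subtype γ).1 * X * (mapGL (algebraMap L R) D.Γ.subtype γ⁻¹).1

variable {R}

theorem card_Γ_ne_zero : (Fintype.card D.Γ : L) ≠ 0 := by
  have : 0 < Fintype.card D.Γ := Fintype.card_pos
  exact_mod_cast this.ne'

theorem proj_mem (X : Matrix (Fin d) (Fin d) R) : D.proj R X ∈ D.commutant R := by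
  rw [mem_commutant]
  intro w hw
  refine Commute.smul_left ?_ _
  set g := mapGL (algebraMap L R) D.Γ.subtype with hg
  have h1 : (D.rB R w) = g ⟨D.r w, D.r_mem_Γ hw⟩ := rfl
  set γ : D.Γ := ⟨D.r w, D.r_mem_Γ hw⟩
  rw [h1]
  change _ * _ = _ * _
  rw [Finset.sum_mul, Finset.mul_sum]
  refine Fintype.sum_equiv (Equiv.mulLeft γ⁻¹) _ _ fun δ => ?_
  simp only [Equiv.coe_mulLeft, mul_inv_rev, inv_inv, map_mul, Units.val_mul, mul_assoc]
  have e : (g γ).1 * (g γ⁻¹).1 = 1 := by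
    rw [← Units.val_mul, ← map_mul, mul_inv_cancel, map_one, Units.val_one]
  simp only [map_inv] at e ⊢
  rw [← mul_assoc (g γ).1, e, one_mul]

theorem proj_of_mem {X : Matrix (Fin d) (Fin d) R} (hX : X ∈ D.commutant R) : D.proj R X = X := by
  have h1 : ∀ γ : D.Γ, (mapGL (algebraMap L R) D.Γ.subtype γ).1 * X *
      (mapGL (algebraMap L R) D.Γ.subtype γ⁻¹).1 = X := by
    rintro ⟨_, w, hw, rfl⟩
    have h2 := (D.mem_commutant.mp hX w hw).eq
    change (D.rB R w).1 * X * ((D.rB R w)⁻¹).1 = X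
    rw [← h2, mul_assoc, Units.mul_inv, mul_one]
  unfold proj
  rw [Finset.sum_congr rfl fun γ _ => h1 γ, Finset.sum_const, Finset.card_univ,
    ← Nat.cast_smul_eq_nsmul L, smul_smul, inv_mul_cancel₀ D.card_Γ_ne_zero, one_smul]

theorem map_proj {R' : Type*} [CommRing R'] [Algebra L R'] (f : R →ₐ[L] R')
    (X : Matrix (Fin d) (Fin d) R) : (D.proj R X).map f = D.proj R' (X.map f) := by
  have h1 : ∀ γ, (mapGL (algebraMap L R) D.Γ.subtype γ).1.map f =
      (mapGL (algebraMap L R') D.Γ.subtype γ).1 := by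
    rintro ⟨_, w, hw, rfl⟩
    exact D.map_rB f w
  change f.mapMatrix _ = _
  rw [proj, map_smul, map_sum]
  simp only [map_mul]
  simp only [AlgHom.mapMatrix_apply, h1]
  rfl

/-- The projection is linear and defined over `L`. Hence the commutant over `R` is spanned by
elements coming from the commutant over `L`, and commutativity passes to any base. -/
theorem proj_eq_sum (X : Matrix (Fin d) (Fin d) R) :
    D.proj R X = ∑ i, ∑ j, X i j • (D.proj L (Matrix.single i j 1)).map (algebraMap L R) := by
  have h0 : ∀ i j, (D.proj L (Matrix.single i j 1)).map (algebraMap L R) =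
      D.proj R (Matrix.single i j 1) := fun i j => by
    have := D.map_proj (Algebra.ofId L R) (Matrix.single i j 1)
    rw [Matrix.map_single, map_one] at this
    exact this
  simp only [h0]
  let F : Matrix (Fin d) (Fin d) R →ₗ[R] Matrix (Fin d) (Fin d) R :=
    { toFun := D.proj R
      map_add' := fun X Y => by
        simp only [proj, mul_add, add_mul, Finset.sum_add_distrib, smul_add]
      map_smul' := fun c X => by
        simp only [proj, mul_smul_comm, smul_mul_assoc, ← Finset.smul_sum, RingHom.id_apply]
        rw [smul_comm] }
  change F X = ∑ i, ∑ j, X i j • F (Matrix.single i j 1)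
  conv_lhs => rw [Matrix.matrix_eq_sum_single X]
  simp only [map_sum]
  refine Finset.sum_congr rfl fun i _ => Finset.sum_congr rfl fun j _ => ?_
  rw [← map_smul, Matrix.smul_single, smul_eq_mul, mul_one]

/-- The commutant of inertia is commutative, over an arbitrary base. -/
theorem commutant_commute {X Y : Matrix (Fin d) (Fin d) R} (hX : X ∈ D.commutant R)
    (hY : Y ∈ D.commutant R) : Commute X Y := by
  -- Over `L` itself commutativity is checked after embedding into an algebraic closure.
  have key : ∀ A B : Matrix (Fin d) (Fin d) L, A ∈ D.commutant L → B ∈ D.commutant L →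
      Commute A B := by
    intro A B hA hB
    let ι := Algebra.ofId L (AlgebraicClosure L)
    have : CharZero (AlgebraicClosure L) := charZero_of_injective_algebraMap
      (algebraMap L (AlgebraicClosure L)).injective
    have h1 := D.commutant_commute_of_isAlgClosed ⟨_, D.map_mem_commutant ι hA⟩
      ⟨_, D.map_mem_commutant ι hB⟩
    have h2 := congrArg Subtype.val h1.eq
    simp only [Subalgebra.coe_mul, ← Matrix.map_mul] at h2
    exact Matrix.map_injective (algebraMap L (AlgebraicClosure L)).injective h2
  rw [← D.proj_of_mem hX, ← D.proj_of_mem hY, proj_eq_sum, proj_eq_sum]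
  refine Commute.sum_left _ _ _ fun i _ => Commute.sum_left _ _ _ fun j _ => Commute.smul_left ?_ _
  refine Commute.sum_right _ _ _ fun i' _ => Commute.sum_right _ _ _ fun j' _ =>
    Commute.smul_right ?_ _
  have := congrArg (fun Z => Z.map (algebraMap L R))
    (key _ _ (D.proj_mem (Matrix.single i j 1)) (D.proj_mem (Matrix.single i' j' 1))).eq
  simp only [Matrix.map_mul] at this
  exact this

end Projection

end TameDatum

/-! ### Block matrices -/

/-- Square matrices of size `m` whose entries are square matrices of size `d`. -/
abbrev Blk (m d : ℕ) (R : Type*) : Type _ := Matrix (Fin m) (Fin m) (Matrix (Fin d) (Fin d) R)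

theorem strictLower_pow {m : ℕ} {A : Type*} [Ring A] {X : Matrix (Fin m) (Fin m) A}
    (hX : ∀ i j : Fin m, i ≤ j → X i j = 0) (k : ℕ) :
    ∀ i j : Fin m, (i : ℕ) < j + k → (X ^ k) i j = 0 := by
  induction k with
  | zero =>
    intro i j h
    rw [pow_zero, Matrix.one_apply_ne]
    rintro rfl
    omega
  | succ k ih =>
    intro i j h
    rw [pow_succ', Matrix.mul_apply]
    refine Finset.sum_eq_zero fun l _ => ?_
    by_cases hl : i ≤ l
    · rw [hX i l hl, zero_mul]
    · rw [ih l j (by simp only [not_le, Fin.lt_def] at hl; omega), mul_zero]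

theorem isNilpotent_of_strictLower {m : ℕ} {A : Type*} [Ring A] {X : Matrix (Fin m) (Fin m) A}
    (hX : ∀ i j : Fin m, i ≤ j → X i j = 0) : IsNilpotent X :=
  ⟨m, by
    ext i j
    exact strictLower_pow hX m i j (by omega)⟩

/-- Base change of block matrices. -/
def bmap {L R R' : Type*} [CommRing L] [CommRing R] [Algebra L R] [CommRing R'] [Algebra L R']
    (m d : ℕ) (f : R →ₐ[L] R') : Blk m d R →ₐ[L] Blk m d R' := f.mapMatrix.mapMatrix

@[simp]
theorem bmap_apply {L R R' : Type*} [CommRing L] [CommRing R] [Algebra L R] [CommRing R']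
    [Algebra L R'] {m d : ℕ} (f : R →ₐ[L] R') (X : Blk m d R) (i j : Fin m) :
    bmap m d f X i j = (X i j).map f := rfl

namespace TameDatum

variable {L W : Type*} [Field L] [CharZero L] [Group W] {d : ℕ} (D : TameDatum L W d)

/-! ### The character -/

/-- The unramified character sending Frobenius to `q`. -/
def chi (w : W) : L := (D.q : L) ^ (D.v w).toAdd

theorem q_ne_zero : (D.q : L) ≠ 0 := by
  have := D.two_le
  exact_mod_cast (by omega : D.q ≠ 0)

theorem chi_ne_zero (w : W) : D.chi w ≠ 0 := zpow_ne_zero _ D.q_ne_zero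

theorem chi_mul (w w' : W) : D.chi (w * w') = D.chi w * D.chi w' := by
  rw [chi, map_mul, toAdd_mul, zpow_add₀ D.q_ne_zero]; rfl

theorem chi_one : D.chi 1 = 1 := by simp [chi]

theorem chi_I {w : W} (hw : w ∈ D.I) : D.chi w = 1 := by
  rw [chi, D.mem_I.mp hw]; simp

theorem chi_φ : D.chi D.φ = D.q := by
  rw [chi, D.v_φ]; simp

theorem chi_inv (w : W) : D.chi w⁻¹ = (D.chi w)⁻¹ := by simp [chi]

theorem chi_pow (w : W) (n : ℕ) : D.chi (w ^ n) = D.chi w ^ n := by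
  induction n with
  | zero => simp [chi_one]
  | succ n ih => rw [pow_succ, chi_mul, ih, pow_succ]

theorem t_mul' (w w' : W) : D.t (w * w') = (D.chi w')⁻¹ * D.t w + D.t w' := by
  rw [D.t_mul, chi, zpow_neg]

theorem t_one : D.t 1 = 0 := by
  have := D.t_mul' 1 1
  rw [mul_one, chi_one] at this
  linear_combination -this

/-! ### Twisting by a nilpotent operator -/

section TwistExp

variable {A : Type*} [Ring A] [Algebra L A] [Algebra ℚ A]

/-- Conjugation by `T w` rescales `N`, hence the exponent. The factor is the one occurring in the
cocycle law of `t`. -/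
theorem exp_smul_mul (T : W →* A) {N : A} (hN : IsNilpotent N)
    (h : ∀ w, N * T w = (D.chi w)⁻¹ • (T w * N)) (c : L) (w : W) :
    IsNilpotent.exp (c • N) * T w = T w * IsNilpotent.exp (((D.chi w)⁻¹ * c) • N) := by
  have e1 : T w * T w⁻¹ = 1 := by rw [← map_mul, mul_inv_cancel, map_one]
  have e2 : T w⁻¹ * T w = 1 := by rw [← map_mul, inv_mul_cancel, map_one]
  have h1 : T w⁻¹ * (c • N) * T w = ((D.chi w)⁻¹ * c) • N := by
    rw [mul_assoc, smul_mul_assoc, h, mul_smul_comm, mul_smul_comm, ← mul_assoc, e2, one_mul,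
      smul_smul, mul_comm]
  rw [← h1, exp_conj (hN.smul c) e1 e2, ← mul_assoc, ← mul_assoc, e1, one_mul]

/-- The representation `w ↦ T w * exp (t w • N)`. -/
def twistExp (T : W →* A) {N : A} (hN : IsNilpotent N)
    (h : ∀ w, N * T w = (D.chi w)⁻¹ • (T w * N)) : W →* A where
  toFun w := T w * IsNilpotent.exp (D.t w • N)
  map_one' := by simp [t_one]
  map_mul' w w' := by
    rw [map_mul, t_mul', add_smul, IsNilpotent.exp_add_of_commute
      (((Commute.refl _).smul_left _).smul_right _) (hN.smul _) (hN.smul _), mul_assoc (T w),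
      mul_assoc (T w), ← mul_assoc (IsNilpotent.exp _) (T w'), exp_smul_mul D T hN h, mul_assoc]

end TwistExp

/-! ### Extensions of the inertial type -/

section RhoZero

variable {R R' : Type*} [CommRing R] [Algebra L R] [CommRing R'] [Algebra L R']

/-- Since `e` commutes with the image of inertia, `r φ * e` conjugates that image exactly as `r φ`
does. This is the compatibility that lets a Frobenius value extend `r|I` to all of `W`. -/
theorem conj_zpow_of_commutant {e : GL (Fin d) R} (he : e.1 ∈ D.commutant R) (b : ℤ) :
    ∀ γ ∈ D.I, (D.rB R D.φ * e) ^ b * D.rB R γ = D.rB R (D.φ ^ b * γ * D.φ ^ (-b)) *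
      (D.rB R D.φ * e) ^ b := by
  have he' : ∀ γ ∈ D.I, e * D.rB R γ = D.rB R γ * e := fun γ hγ =>
    Units.ext (D.mem_commutant.mp he γ hγ).eq
  have h1 : ∀ γ ∈ D.I, (D.rB R D.φ * e) * D.rB R γ = D.rB R (D.φ * γ * D.φ⁻¹) *
      (D.rB R D.φ * e) := by
    intro γ hγ
    rw [mul_assoc, he' γ hγ, map_mul, map_mul, map_inv]
    group
  have hc : ∀ γ ∈ D.I, ∀ w, w * γ * w⁻¹ ∈ D.I := fun γ hγ w =>
    (inferInstance : D.I.Normal).conj_mem γ hγ w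
  induction b using Int.induction_on with
  | zero => intro γ _; simp
  | succ b ih =>
    intro γ hγ
    rw [zpow_add_one, mul_assoc, h1 γ hγ, ← mul_assoc, ih _ (hc γ hγ _), mul_assoc]
    congr 2
    group
  | pred b ih =>
    intro γ hγ
    have h2 := h1 _ (by simpa using hc γ hγ D.φ⁻¹)
    have h3 : (D.rB R D.φ * e)⁻¹ * D.rB R γ = D.rB R (D.φ⁻¹ * γ * D.φ) *
        (D.rB R D.φ * e)⁻¹ := by
      rw [inv_mul_eq_iff_eq_mul, ← mul_assoc, h2]
      rw [mul_inv_cancel_right]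
      congr 1
      group
    rw [zpow_sub_one, mul_assoc, h3, ← mul_assoc, ih _ (by simpa using hc γ hγ D.φ⁻¹), mul_assoc]
    congr 2
    group

/-- The representation agreeing with `r` on inertia and sending Frobenius to `r φ * e`. -/
def rhoZero (e : GL (Fin d) R) (he : e.1 ∈ D.commutant R) : W →* GL (Fin d) R where
  toFun w := (D.rB R D.φ * e) ^ (D.v w).toAdd * D.rB R (D.φ ^ (-(D.v w).toAdd) * w)
  map_one' := by simp
  map_mul' w w' := by
    have hI : D.φ ^ (-(D.v w).toAdd) * w ∈ D.I := by
      rw [mem_I, map_mul, map_zpow, D.v_φ]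
      apply Multiplicative.toAdd.injective
      simp
    set a := (D.v w).toAdd
    set b := (D.v w').toAdd
    have h1 := D.conj_zpow_of_commutant he b (D.φ ^ (-b) * (D.φ ^ (-a) * w) * D.φ ^ b) (by
      simpa using (inferInstance : D.I.Normal).conj_mem _ hI (D.φ ^ (-b)))
    have h2 : D.φ ^ b * (D.φ ^ (-b) * (D.φ ^ (-a) * w) * D.φ ^ b) * D.φ ^ (-b) =
      D.φ ^ (-a) * w := by group
    rw [h2] at h1
    have hab : (D.v (w * w')).toAdd = a + b := by rw [map_mul, toAdd_mul]
    rw [hab, zpow_add, mul_assoc, mul_assoc, ← mul_assoc (D.rB R _), ← h1, mul_assoc, ← map_mul]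
    congr 3
    group

theorem rhoZero_apply (e : GL (Fin d) R) (he : e.1 ∈ D.commutant R) (w : W) :
    D.rhoZero e he w =
      (D.rB R D.φ * e) ^ (D.v w).toAdd * D.rB R (D.φ ^ (-(D.v w).toAdd) * w) := rfl

theorem rhoZero_I (e : GL (Fin d) R) (he : e.1 ∈ D.commutant R) {w : W} (hw : w ∈ D.I) :
    D.rhoZero e he w = D.rB R w := by
  rw [rhoZero_apply, D.mem_I.mp hw]; simp

theorem rhoZero_φ (e : GL (Fin d) R) (he : e.1 ∈ D.commutant R) :
    D.rhoZero e he D.φ = D.rB R D.φ * e := by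
  rw [rhoZero_apply, D.v_φ]; simp

theorem hom_ext {M : Type*} [Group M] {f g : W →* M} (hI : ∀ w ∈ D.I, f w = g w)
    (hφ : f D.φ = g D.φ) : f = g := by
  have := D.closure_eq_top (f.eqLocus g) hφ (hI _ D.s_mem_I) fun p hp => hI _ (D.P_le_I hp)
  ext w
  have hw : w ∈ f.eqLocus g := this ▸ Subgroup.mem_top w
  exact hw

/-- Two extensions of `r|I` conjugate inertia in the same way at Frobenius, so `(r φ)⁻¹ * ρ φ` lies
in the commutant. Extensions are thus parametrized by its units. -/
theorem exists_eq_rhoZero {ρ : W →* GL (Fin d) R} (hρ : ∀ w ∈ D.I, ρ w = D.rB R w) :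
    ∃ (e : GL (Fin d) R) (he : e.1 ∈ D.commutant R), ρ = D.rhoZero e he := by
  have he : ((D.rB R D.φ)⁻¹ * ρ D.φ).1 ∈ D.commutant R := by
    rw [mem_commutant]
    intro w hw
    have hw' : D.φ * w * D.φ⁻¹ ∈ D.I := (inferInstance : D.I.Normal).conj_mem w hw _
    have h1 : (D.rB R D.φ)⁻¹ * ρ D.φ * D.rB R w = D.rB R w * ((D.rB R D.φ)⁻¹ * ρ D.φ) := by
      have h2 := hρ _ hw'
      rw [map_mul, map_mul, map_mul, map_mul, hρ w hw, map_inv, map_inv, mul_inv_eq_iff_eq_mul]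
        at h2
      rw [mul_assoc, h2]
      group
    exact congrArg Units.val h1
  refine ⟨_, he, D.hom_ext (fun w hw => by rw [hρ w hw, rhoZero_I _ _ _ hw]) ?_⟩
  rw [rhoZero_φ, mul_inv_cancel_left]

theorem map_rhoZero (f : R →ₐ[L] R') (e : GL (Fin d) R) (he : e.1 ∈ D.commutant R)
    (e' : GL (Fin d) R') (he' : e'.1 ∈ D.commutant R') (h : e.1.map f = e'.1) (w : W) :
    (D.rhoZero e he w).1.map f = (D.rhoZero e' he' w).1 := by
  have h1 : mapGL f.toRingHom (D.rhoZero e he) = D.rhoZero e' he' := by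
    refine D.hom_ext (fun w hw => Units.ext ?_) (Units.ext ?_)
    · rw [rhoZero_I _ _ _ hw, ← D.map_rB f, ← D.rhoZero_I e he hw]
      rfl
    · rw [rhoZero_φ, Units.val_mul, ← h, ← D.map_rB f, ← Matrix.map_mul, ← Units.val_mul,
        ← D.rhoZero_φ e he]
      rfl
  rw [← h1]
  rfl

end RhoZero

/-! ### The standard family -/

section Standard

variable {m : ℕ} {R R' : Type*} [CommRing R] [Algebra L R] [CommRing R'] [Algebra L R']

/-- The sum of the twists of a representation by the powers of the unramified character. -/
def dia (m : ℕ) (ρ : W →* GL (Fin d) R) : W →* Blk m d R where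
  toFun w := Matrix.diagonal fun i : Fin m => D.chi w ^ (i : ℕ) • (ρ w).1
  map_one' := by simp [chi_one]
  map_mul' w w' := by
    rw [Matrix.diagonal_mul_diagonal]
    congr 1
    ext1 i
    rw [chi_mul, map_mul, Units.val_mul, mul_pow, smul_mul_smul_comm]

theorem dia_apply (ρ : W →* GL (Fin d) R) (w : W) :
    D.dia m ρ w = Matrix.diagonal fun i : Fin m => D.chi w ^ (i : ℕ) • (ρ w).1 := rfl

/-- The standard nilpotent operator. -/
def nil {m : ℕ} (x : Fin m → R) : Blk m d R :=
  -- The entry `x j` occupies position `(j + 1, j)`. The last coordinate of `x` never occurs and is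
  -- a harmless free parameter.
  Matrix.of fun i j => if (i : ℕ) = j + 1 then Matrix.scalar (Fin d) (x j) else 0

theorem nil_apply (x : Fin m → R) (i j : Fin m) : (nil x : Blk m d R) i j =
    if (i : ℕ) = j + 1 then Matrix.scalar (Fin d) (x j) else 0 := rfl

theorem isNilpotent_nil (x : Fin m → R) : IsNilpotent (nil x : Blk m d R) :=
  isNilpotent_of_strictLower fun i j hij => by
    rw [nil_apply, if_neg]
    rw [Fin.le_def] at hij
    omega

/-- Consecutive diagonal blocks differ by one twist, and scalar blocks commute with `ρ`. This is
exactly the relation required by `twistExp`. -/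
theorem nil_mul_dia (ρ : W →* GL (Fin d) R) (x : Fin m → R) (w : W) :
    nil x * D.dia m ρ w = (D.chi w)⁻¹ • (D.dia m ρ w * nil x) := by
  refine Matrix.ext fun i j => ?_
  rw [dia_apply, Matrix.mul_diagonal, Matrix.smul_apply, Matrix.diagonal_mul, nil_apply]
  split_ifs with h
  · rw [h, smul_mul_assoc, smul_smul, pow_succ', inv_mul_cancel_left₀ (D.chi_ne_zero w),
      mul_smul_comm]
    congr 1
    exact (Matrix.scalar_commute (x j) (fun _ => Commute.all _ _) _).eq
  · simp

theorem dia_mul_dia_inv (ρ : W →* GL (Fin d) R) (w : W) :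
    D.dia m ρ w * D.dia m ρ w⁻¹ = 1 := by
  rw [← map_mul, mul_inv_cancel, map_one]

theorem dia_inv_mul_dia (ρ : W →* GL (Fin d) R) (w : W) :
    D.dia m ρ w⁻¹ * D.dia m ρ w = 1 := by
  rw [← map_mul, inv_mul_cancel, map_one]

variable [Algebra ℚ R] [Algebra ℚ R']

/-- The standard discrete series representations. -/
def std (ρ : W →* GL (Fin d) R) (x : Fin m → R) : W →* Blk m d R :=
  D.twistExp (D.dia m ρ) (isNilpotent_nil x) (D.nil_mul_dia ρ x)

theorem std_apply (ρ : W →* GL (Fin d) R) (x : Fin m → R) (w : W) :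
    D.std ρ x w = D.dia m ρ w * IsNilpotent.exp (D.t w • nil x) := rfl

theorem bmap_nil (f : R →ₐ[L] R') (x : Fin m → R) :
    bmap m d f (nil x) = nil (fun i => f (x i)) := by
  refine Matrix.ext fun i j => ?_
  rw [bmap_apply, nil_apply, nil_apply]
  split_ifs
  · ext a b
    by_cases hab : a = b
    · subst hab; simp
    · simp [hab]
  · exact Matrix.map_zero _ (map_zero f)

theorem bmap_dia (f : R →ₐ[L] R') {ρ : W →* GL (Fin d) R} {ρ' : W →* GL (Fin d) R'}
    (h : ∀ w, (ρ w).1.map f = (ρ' w).1) (w : W) :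
    bmap m d f (D.dia m ρ w) = D.dia m ρ' w := by
  refine Matrix.ext fun i j => ?_
  rw [bmap_apply, dia_apply, dia_apply]
  by_cases hij : i = j
  · subst hij
    rw [Matrix.diagonal_apply_eq, Matrix.diagonal_apply_eq, ← h]
    exact map_smul f.mapMatrix _ _
  · rw [Matrix.diagonal_apply_ne _ hij, Matrix.diagonal_apply_ne _ hij]
    exact Matrix.map_zero _ (map_zero f)

theorem bmap_std (f : R →ₐ[L] R') {ρ : W →* GL (Fin d) R} {ρ' : W →* GL (Fin d) R'}
    (h : ∀ w, (ρ w).1.map f = (ρ' w).1) (x : Fin m → R) (w : W) :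
    bmap m d f (D.std ρ x w) = D.std ρ' (fun i => f (x i)) w := by
  rw [std_apply, map_mul, bmap_dia D f h, IsNilpotent.map_exp ((isNilpotent_nil x).smul _),
    map_smul, bmap_nil, std_apply]

end Standard

end TameDatum

/-! ### Lower triangular matrices -/

section Lower

variable {m : ℕ} {A : Type*} [Ring A]

/-- Lower triangular matrices. -/
def IsLower (X : Matrix (Fin m) (Fin m) A) : Prop := ∀ i j, i < j → X i j = 0

theorem IsLower.mul_apply_self {X Y : Matrix (Fin m) (Fin m) A} (hX : IsLower X) (hY : IsLower Y)
    (i : Fin m) : (X * Y) i i = X i i * Y i i := by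
  rw [Matrix.mul_apply, Finset.sum_eq_single i]
  · intro j _ hj
    rcases lt_or_gt_of_ne hj with h | h
    · rw [hY j i h, mul_zero]
    · rw [hX i j h, zero_mul]
  · simp

theorem IsLower.mul {X Y : Matrix (Fin m) (Fin m) A} (hX : IsLower X) (hY : IsLower Y) :
    IsLower (X * Y) := by
  intro i j hij
  rw [Matrix.mul_apply]
  refine Finset.sum_eq_zero fun l _ => ?_
  rcases lt_or_ge i l with h | h
  · rw [hX i l h, zero_mul]
  · rw [hY l j (lt_of_le_of_lt h hij), mul_zero]

theorem IsLower.add {X Y : Matrix (Fin m) (Fin m) A} (hX : IsLower X) (hY : IsLower Y) :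
    IsLower (X + Y) := fun i j hij => by
  rw [Matrix.add_apply, hX i j hij, hY i j hij, add_zero]

theorem IsLower.sub {X Y : Matrix (Fin m) (Fin m) A} (hX : IsLower X) (hY : IsLower Y) :
    IsLower (X - Y) := fun i j hij => by
  rw [Matrix.sub_apply, hX i j hij, hY i j hij, sub_zero]

theorem isLower_diagonal (v : Fin m → A) : IsLower (Matrix.diagonal v) := fun _ _ hij =>
  Matrix.diagonal_apply_ne _ hij.ne

theorem isLower_one : IsLower (1 : Matrix (Fin m) (Fin m) A) := fun _ _ hij =>
  Matrix.one_apply_ne hij.ne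

theorem IsLower.smul {k : Type*} [SMulZeroClass k A] {X : Matrix (Fin m) (Fin m) A}
    (hX : IsLower X) (c : k) : IsLower (c • X) := fun i j hij => by
  rw [Matrix.smul_apply, hX i j hij, smul_zero]

theorem IsLower.sum {ι : Type*} {s : Finset ι} {X : ι → Matrix (Fin m) (Fin m) A}
    (hX : ∀ i ∈ s, IsLower (X i)) : IsLower (∑ i ∈ s, X i) := fun i j hij => by
  rw [Matrix.sum_apply]
  exact Finset.sum_eq_zero fun l hl => hX l hl i j hij

theorem IsLower.of_mem_adjoin {k : Type*} [CommRing k] [Algebra k A]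
    {X Y : Matrix (Fin m) (Fin m) A} (hX : IsLower X) (hY : Y ∈ Algebra.adjoin k {X}) :
    IsLower Y := by
  induction hY using Algebra.adjoin_induction with
  | mem x hx => rw [Set.mem_singleton_iff.mp hx]; exact hX
  | algebraMap c =>
    rw [Algebra.algebraMap_eq_smul_one]
    exact isLower_one.smul c
  | add _ _ _ _ h1 h2 => exact h1.add h2
  | mul _ _ _ _ h1 h2 => exact h1.mul h2

theorem IsLower.isNilpotent {X : Matrix (Fin m) (Fin m) A} (hX : IsLower X) (h : ∀ i, X i i = 0) :
    IsNilpotent X := isNilpotent_of_strictLower fun i j hij => by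
  rcases hij.lt_or_eq with hlt | rfl
  · exact hX i j hlt
  · exact h i

theorem IsLower.pow {X : Matrix (Fin m) (Fin m) A} (hX : IsLower X) (n : ℕ) :
    IsLower (X ^ n) := by
  induction n with
  | zero => exact isLower_one
  | succ n ih => rw [pow_succ]; exact ih.mul hX

theorem IsLower.exp [Algebra ℚ A] {X : Matrix (Fin m) (Fin m) A} (hX : IsLower X)
    (h : ∀ i, X i i = 0) :
    IsLower (IsNilpotent.exp X) ∧ ∀ i, IsNilpotent.exp X i i = 1 := by
  obtain ⟨n, hn⟩ := hX.isNilpotent h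
  rw [IsNilpotent.exp_eq_sum (pow_eq_zero_of_le (Nat.le_succ n) hn)]
  constructor
  · exact IsLower.sum fun i _ => (hX.pow i).smul _
  · intro i
    rw [Finset.sum_range_succ', Matrix.add_apply, Matrix.sum_apply, Finset.sum_eq_zero]
    · simp
    · intro l _
      rw [Matrix.smul_apply, pow_succ, (hX.pow l).mul_apply_self hX, h i, mul_zero, smul_zero]

end Lower

theorem isLower_aeval {m : ℕ} {R A : Type*} [CommRing R] [Ring A] [Algebra R A]
    {X : Matrix (Fin m) (Fin m) A} (hX : IsLower X) {c : Fin m → R}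
    (hc : ∀ i, X i i = algebraMap R A (c i)) (f : Polynomial R) :
    IsLower (Polynomial.aeval X f) ∧
      ∀ i, Polynomial.aeval X f i i = algebraMap R A (f.eval (c i)) := by
  induction f using Polynomial.induction_on' with
  | add p q hp hq =>
    rw [map_add]
    refine ⟨hp.1.add hq.1, fun i => ?_⟩
    rw [Matrix.add_apply, hp.2, hq.2, Polynomial.eval_add, map_add]
  | monomial n a =>
    rw [Polynomial.aeval_monomial, ← Algebra.smul_def]
    refine ⟨(hX.pow n).smul a, fun i => ?_⟩
    have : (X ^ n) i i = algebraMap R A (c i ^ n) := by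
      induction n with
      | zero => simp
      | succ n ih => rw [pow_succ, (hX.pow n).mul_apply_self hX, ih, hc, pow_succ, map_mul]
    rw [Matrix.smul_apply, this, Polynomial.eval_monomial, map_mul, Algebra.smul_def]

open Polynomial in
-- Cayley–Hamilton for triangular matrices with central diagonal: the product of the first `k`
-- factors has its first `k` rows equal to zero.
theorem aeval_prod_eq_zero {m : ℕ} {R A : Type*} [CommRing R] [Ring A] [Algebra R A]
    {X : Matrix (Fin m) (Fin m) A} (hX : IsLower X) {c : ℕ → R}
    (hc : ∀ i : Fin m, X i i = algebraMap R A (c i)) :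
    aeval X (∏ i ∈ Finset.range m, (Polynomial.X - C (c i))) = 0 := by
  have key : ∀ k : ℕ, ∀ i j : Fin m, (i : ℕ) < k →
      aeval X (∏ i ∈ Finset.range k, (Polynomial.X - C (c i))) i j = 0 := by
    intro k
    induction k with
    | zero => intro i j h; omega
    | succ k ih =>
      intro i j h
      rw [Finset.prod_range_succ_comm, map_mul, Matrix.mul_apply]
      refine Finset.sum_eq_zero fun l _ => ?_
      have hl := isLower_aeval hX hc (Polynomial.X - C (c k))
      rcases lt_trichotomy i l with h1 | h1 | h1
      · rw [hl.1 i l h1, zero_mul]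
      · subst h1
        by_cases h2 : (i : ℕ) = k
        · rw [hl.2, h2]; simp
        · rw [ih i j (by omega), mul_zero]
      · rw [ih l j (by rw [Fin.lt_def] at h1; omega), mul_zero]
  ext i j
  exact key m i j i.2

/-- A lower triangular matrix whose diagonal entries are central with invertible differences is
diagonalised by a unipotent matrix. -/
theorem exists_diagonalise {m : ℕ} {R A : Type*} [CommRing R] [Ring A] [Algebra R A]
    {X : Matrix (Fin m) (Fin m) A} (hX : IsLower X) {c : ℕ → R}
    (hc : ∀ i : Fin m, X i i = algebraMap R A (c i))
    (hu : ∀ i j : ℕ, i ≠ j → IsUnit (c i - c j)) :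
    ∃ G : Matrix (Fin m) (Fin m) A, IsLower G ∧ (∀ i, G i i = 1) ∧
      X * G = G * Matrix.diagonal fun i : Fin m => algebraMap R A (c i) := by
  classical
  -- Lagrange interpolation. The normalised values of these polynomials at `X` are the spectral
  -- projectors `e i`, and `G` is assembled from the `i`-th column of each `e i`.
  let f : ℕ → Polynomial R := fun i => ∏ j ∈ (Finset.range m).erase i,
    (Polynomial.X - Polynomial.C (c j))
  have hf : ∀ i : ℕ, IsUnit ((f i).eval (c i)) := fun i => by
    rw [Polynomial.eval_prod, IsUnit.prod_iff]
    intro j hj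
    simpa using hu i j (Finset.ne_of_mem_erase hj).symm
  have hfj : ∀ i j : Fin m, i ≠ j → (f i).eval (c j) = 0 := fun i j hij => by
    rw [Polynomial.eval_prod]
    refine Finset.prod_eq_zero (i := (j : ℕ)) ?_ (by simp)
    simp [Fin.val_ne_of_ne hij.symm]
  have hXf : ∀ i : Fin m, X * Polynomial.aeval X (f i) =
      algebraMap R _ (c i) * Polynomial.aeval X (f i) := fun i => by
    have h1 : (Polynomial.X - Polynomial.C (c i)) * f i =
        ∏ j ∈ Finset.range m, (Polynomial.X - Polynomial.C (c j)) :=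
      Finset.mul_prod_erase _ (fun j => Polynomial.X - Polynomial.C (c j))
        (Finset.mem_range.mpr i.2)
    have h2 := congrArg (Polynomial.aeval X) h1
    rw [aeval_prod_eq_zero hX hc, map_mul] at h2
    simpa [sub_mul, sub_eq_zero] using h2
  let e : Fin m → Matrix (Fin m) (Fin m) A := fun i =>
    ((hf i).unit⁻¹ : Rˣ).1 • Polynomial.aeval X (f i)
  have he : ∀ i, IsLower (e i) := fun i => ((isLower_aeval hX hc (f i)).1).smul _
  have hXe : ∀ i, X * e i = c i • e i := fun i => by
    rw [mul_smul_comm, hXf, ← Algebra.smul_def, smul_comm]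
  have hei : ∀ i j, e i j j = if i = j then 1 else 0 := fun i j => by
    change ((hf i).unit⁻¹ : Rˣ).1 • Polynomial.aeval X (f i) j j = _
    rw [(isLower_aeval hX hc (f i)).2]
    split_ifs with h
    · subst h
      rw [Algebra.smul_def, ← map_mul, IsUnit.val_inv_mul, map_one]
    · rw [hfj i j h, map_zero, smul_zero]
  have hs : ∀ i : Fin m, IsLower (Matrix.single i i (1 : A)) := fun i => by
    rw [← Matrix.diagonal_single]
    exact isLower_diagonal _
  refine ⟨∑ i, e i * Matrix.single i i 1, IsLower.sum fun i _ => (he i).mul (hs i), fun j => ?_, ?_⟩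
  · rw [Matrix.sum_apply, Finset.sum_eq_single j]
    · rw [(he j).mul_apply_self (hs j), hei]; simp
    · intro i _ hij
      rw [(he i).mul_apply_self (hs i), hei, if_neg hij, zero_mul]
    · simp
  · rw [Finset.mul_sum, Finset.sum_mul]
    refine Finset.sum_congr rfl fun i _ => ?_
    rw [← mul_assoc, hXe, mul_assoc, smul_mul_assoc, ← mul_smul_comm]
    congr 1
    refine Matrix.ext fun a b => ?_
    rw [Matrix.mul_diagonal, Matrix.smul_apply, Matrix.single_apply]
    split_ifs with h
    · rw [← h.2, one_mul, Algebra.smul_def, mul_one]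
    · simp

namespace TameDatum

variable {L W : Type*} [Field L] [CharZero L] [Group W] {d : ℕ} (D : TameDatum L W d)

/-! ### Subgroups of finite index -/

/-- Cosets are represented by products of lifts of the finite group `Γ` with powers of Frobenius of
exponent below `h`. This finiteness is what permits averaging over `W`. -/
theorem finite_quotient {K : Subgroup W} (hφ : D.φ ^ D.h ∈ K)
    (hI : ∀ w ∈ D.I, D.r w = 1 → w ∈ K) : Finite (W ⧸ K) := by
  have hΓ : ∀ γ : D.Γ, ∃ w ∈ D.I, D.r w = γ := fun γ => γ.2
  choose g hgI hg using hΓ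
  have hh := D.h_pos
  refine Finite.of_surjective
    (fun x : Fin D.h × D.Γ => ((g x.2 * D.φ ^ (x.1 : ℕ) : W) : W ⧸ K)) fun c => ?_
  induction c using QuotientGroup.induction_on with
  | H w =>
  set a := (D.v w).toAdd with ha
  have hγ : w * D.φ ^ (-a) ∈ D.I := by
    rw [mem_I, map_mul, map_zpow, D.v_φ]
    apply Multiplicative.toAdd.injective
    simp [ha]
  have hmod : 0 ≤ a % D.h := Int.emod_nonneg _ (by exact_mod_cast hh.ne')
  have hlt : a % D.h < D.h := Int.emod_lt_of_pos _ (by exact_mod_cast hh)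
  set γ : D.Γ := ⟨D.r (w * D.φ ^ (-a)), D.r_mem_Γ hγ⟩
  refine ⟨(⟨(a % D.h).toNat, by omega⟩, γ), ?_⟩
  rw [QuotientGroup.eq]
  have h1 : D.φ ^ (a % D.h).toNat = D.φ ^ (a % D.h) := by
    rw [← zpow_natCast, Int.toNat_of_nonneg hmod]
  simp only
  rw [h1]
  set b := a % D.h with hb
  set k := a / D.h with hk
  have hab : a = b + D.h * k := (Int.emod_add_mul_ediv a D.h).symm
  have hmem : (g γ)⁻¹ * (w * D.φ ^ (-a)) ∈ D.I := mul_mem (inv_mem (hgI γ)) hγ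
  have hone : D.r ((g γ)⁻¹ * (w * D.φ ^ (-a))) = 1 := by
    rw [map_mul, map_inv, hg]
    exact inv_mul_cancel _
  have e1 : (g γ * D.φ ^ b)⁻¹ * w =
      (D.φ ^ (-b) * ((g γ)⁻¹ * (w * D.φ ^ (-a))) * (D.φ ^ (-b))⁻¹) * (D.φ ^ D.h) ^ k := by
    rw [← zpow_natCast, ← zpow_mul]
    have : (D.h : ℤ) * k = a - b := by omega
    rw [this]
    group
  rw [e1]
  refine mul_mem (hI _ ((inferInstance : D.I.Normal).conj_mem _ hmem _) ?_) (zpow_mem hφ k)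
  rw [map_mul, map_mul, hone, mul_one, map_inv, mul_inv_cancel]

/-! ### Scalars -/

section Scalars

variable {R : Type*} [CommRing R] [Algebra L R]

/-- Schur's lemma for an extension `ρ` of `r|I`. Here `ρ φ = r φ * e`, and `X` commutes with `e`
because the commutant is commutative; so commuting with `ρ φ` amounts to commuting with `r φ`. -/
theorem exists_scalar_of_mem_commutant {ρ : W →* GL (Fin d) R}
    (hρ : ∀ w ∈ D.I, ρ w = D.rB R w) {X : Matrix (Fin d) (Fin d) R} (hX : X ∈ D.commutant R)
    (hφ : Commute X (ρ D.φ).1) : ∃ c : R, X = Matrix.scalar (Fin d) c := by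
  refine D.exists_scalar_of_commute (D.mem_commutant.mp hX) ?_
  obtain ⟨e, he, rfl⟩ := D.exists_eq_rhoZero hρ
  rw [rhoZero_φ, Units.val_mul] at hφ
  have h1 : Commute X e⁻¹.1 := (D.commutant_commute hX he).units_inv_right
  have h2 := hφ.mul_right h1
  rwa [mul_assoc, Units.mul_inv, mul_one] at h2

/-- Conjugation by `φ ^ h` does not change `r` on inertia, so its image under `ρ` lies in the
commutant; it also commutes with `ρ φ`. The scalar is a unit because its `d`-th power is a
determinant. -/
theorem exists_scalar_φ_pow_h {ρ : W →* GL (Fin d) R} (hρ : ∀ w ∈ D.I, ρ w = D.rB R w) :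
    ∃ c : Rˣ, (ρ (D.φ ^ D.h)).1 = Matrix.scalar (Fin d) (c : R) := by
  obtain ⟨c, hc⟩ := D.exists_scalar_of_mem_commutant hρ (X := (ρ (D.φ ^ D.h)).1) (by
    rw [mem_commutant]
    intro w hw
    have hw' : D.φ ^ D.h * w * (D.φ ^ D.h)⁻¹ ∈ D.I :=
      (inferInstance : D.I.Normal).conj_mem w hw _
    have h1 : D.rB R (D.φ ^ D.h * w * (D.φ ^ D.h)⁻¹) = D.rB R w := by
      have : D.r (D.φ ^ D.h * w * (D.φ ^ D.h)⁻¹) = D.r w := by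
        rw [map_mul, map_mul, r_φ_pow_h_mul, map_inv, mul_inv_cancel_right]
      exact congrArg (Matrix.GeneralLinearGroup.map (algebraMap L R)) this
    rw [← hρ _ hw', ← hρ w hw, map_mul, map_mul, map_inv, mul_inv_eq_iff_eq_mul] at h1
    rw [← hρ w hw]
    exact congrArg Units.val h1) (by
    rw [map_pow]
    exact congrArg Units.val ((Commute.refl (ρ D.φ)).pow_left D.h).eq)
  have hu : IsUnit c := by
    have h1 : IsUnit (ρ (D.φ ^ D.h)).1.det := (Matrix.isUnit_iff_isUnit_det _).mp (Units.isUnit _)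
    rw [hc, Matrix.scalar_apply, Matrix.det_diagonal, Finset.prod_const, Finset.card_univ,
      Fintype.card_fin] at h1
    exact (isUnit_pow_iff D.pos.ne').mp h1
  exact ⟨hu.unit, hc⟩

theorem isUnit_q_pow_sub {a b : ℕ} (hab : a ≠ b) : (D.q : L) ^ a - (D.q : L) ^ b ≠ 0 := by
  rw [sub_ne_zero]
  exact_mod_cast fun h => hab (Nat.pow_right_injective D.two_le h)

end Scalars

end TameDatum
namespace TameDatum

variable {L W : Type*} [Field L] [CharZero L] [Group W] {d : ℕ} (D : TameDatum L W d)

/-! ### Triangular representations are standard -/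

theorem s_pow_spec : ∃ k > 0, D.r (D.s ^ k) = 1 := by
  obtain ⟨k, hk, h⟩ := D.exists_s_pow_eq_one
  exact ⟨k, hk, by rw [map_pow, h]⟩

theorem t_pow_I {w : W} (hw : w ∈ D.I) (k : ℕ) : D.t (w ^ k) = k * D.t w := by
  induction k with
  | zero => simp [t_one]
  | succ k ih =>
    rw [pow_succ, t_mul', ih, D.chi_I hw]
    push_cast
    ring

theorem t_φ_pow (k : ℕ) : D.t (D.φ ^ k) = 0 := by
  induction k with
  | zero => simp [t_one]
  | succ k ih => rw [pow_succ, t_mul', ih, D.t_φ]; simp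

theorem rB_eq_one (R : Type*) [CommRing R] [Algebra L R] {w : W} (hw : D.r w = 1) :
    D.rB R w = 1 := by
  change Matrix.GeneralLinearGroup.map (algebraMap L R) (D.r w) = 1
  rw [hw, map_one]

section Triangular

variable {m : ℕ} {R : Type*} [CommRing R] [Algebra L R] [Algebra ℚ R]
  {T : W →* Blk m d R} {ρ : W →* GL (Fin d) R}
  (hρ : ∀ w ∈ D.I, ρ w = D.rB R w) (hlow : ∀ w, IsLower (T w))
  (hdiag : ∀ w i, T w i i = D.chi w ^ (i : ℕ) • (ρ w).1)
  (hP : ∀ p ∈ D.P, ∃ M > 0, T p ^ M = 1)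

include hρ hlow hdiag in
theorem isNilpotent_sub_one {w : W} (hw : w ∈ D.I) (hr : D.r w = 1) :
    IsLower (T w - 1) ∧ ∀ i, (T w - 1) i i = 0 := by
  refine ⟨(hlow w).sub isLower_one, fun i => ?_⟩
  rw [Matrix.sub_apply, hdiag, D.chi_I hw, hρ w hw, D.rB_eq_one R hr]
  simp

include hρ hlow hdiag hP in
-- On the kernel of `r` in inertia a triangular representation is unipotent, and a unipotent element
-- of finite order is trivial over a `ℚ`-algebra.
theorem eq_one_of_mem_P {p : W} (hp : p ∈ D.P) (hr : D.r p = 1) : T p = 1 := by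
  obtain ⟨M, hM, h⟩ := hP p hp
  have h1 := D.isNilpotent_sub_one hρ hlow hdiag (D.P_le_I hp) hr
  have h2 := eq_zero_of_one_add_pow_eq_one (h1.1.isNilpotent h1.2) hM (by simpa using h)
  exact sub_eq_zero.mp h2

include hρ hlow hdiag hP in
/-- The monodromy operator of a triangular representation. -/
theorem exists_monodromy : ∃ N : Blk m d R, IsLower N ∧ (∀ i, N i i = 0) ∧
    (∀ w, N * T w = (D.chi w)⁻¹ • (T w * N)) ∧
    ∃ k > 0, D.r (D.s ^ k) = 1 ∧ T (D.s ^ k) = IsNilpotent.exp (D.t (D.s ^ k) • N) := by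
  obtain ⟨k, hk, hrk⟩ := D.s_pow_spec
  have hkI : D.s ^ k ∈ D.I := pow_mem D.s_mem_I k
  have hP1 : ∀ p ∈ D.P, D.r p = 1 → T p = 1 := fun p hp hr =>
    D.eq_one_of_mem_P hρ hlow hdiag hP hp hr
  have hU := D.isNilpotent_sub_one hρ hlow hdiag hkI hrk
  -- If a power of `s` is wild, then `T (s ^ k)` is unipotent of finite order, hence trivial, and
  -- the monodromy vanishes.
  rcases D.t_s with hts | ⟨ht0, j, hj, hsj⟩
  swap
  · refine ⟨0, fun _ _ _ => rfl, fun _ => rfl, fun w => by simp, k, hk, hrk, ?_⟩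
    have h1 : T (D.s ^ k) ^ j = 1 := by
      rw [← map_pow]
      refine hP1 _ ?_ (by rw [map_pow, hrk, one_pow])
      rw [← pow_mul, mul_comm, pow_mul]
      exact pow_mem hsj k
    have h2 := eq_zero_of_one_add_pow_eq_one (hU.1.isNilpotent hU.2) hj (by simpa using h1)
    rw [sub_eq_zero.mp h2]
    simp
  obtain ⟨Y, hY, hN, hexp⟩ := exists_exp_eq (hU.1.isNilpotent hU.2)
  set U := T (D.s ^ k) with hUdef
  set N := (U - 1) * Y with hNdef
  have hNadj : N ∈ Algebra.adjoin ℚ {U} :=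
    mul_mem (sub_mem (Algebra.self_mem_adjoin_singleton ℚ U) (one_mem _)) hY
  have hYlow : IsLower Y := (hlow _).of_mem_adjoin hY
  have hNlow : IsLower N := hU.1.mul hYlow
  have hNdiag : ∀ i, N i i = 0 := fun i => by
    rw [hNdef, hU.1.mul_apply_self hYlow, hU.2, zero_mul]
  have hinv : ∀ w, T w * T w⁻¹ = 1 := fun w => by rw [← map_mul, mul_inv_cancel, map_one]
  have hinv' : ∀ w, T w⁻¹ * T w = 1 := fun w => by rw [← map_mul, inv_mul_cancel, map_one]
  have hcommP : ∀ w : W, (D.s ^ k)⁻¹ * (w⁻¹ * D.s ^ k * w) ∈ D.P → T w * N = N * T w := by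
    intro w hw
    have h1 := hP1 _ hw (by simp [map_mul, hrk])
    have h2 : U * T w = T w * U := by
      have h3 : D.s ^ k * w = w * D.s ^ k * ((D.s ^ k)⁻¹ * (w⁻¹ * D.s ^ k * w)) := by group
      rw [hUdef, ← map_mul, h3, map_mul, h1, mul_one, map_mul]
    exact (commute_of_mem_adjoin hNadj (show Commute (T w) U from h2.symm)).eq
  -- The wild correction in the tame relation for `s ^ k` is killed by `r`, since `s ^ k` is; so it
  -- is also killed by `T`.
  have hφ : T D.φ * U * T D.φ⁻¹ = U ^ D.q := by
    obtain ⟨p, hp, h1⟩ := D.conj_s_zpow k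
    have h2 : D.φ * D.s ^ k * D.φ⁻¹ = (D.s ^ k) ^ D.q * p := by
      rw [zpow_natCast] at h1
      rw [h1, ← pow_mul, mul_comm k, ← zpow_natCast, Nat.cast_mul]
    have h3 : D.r p = 1 := by
      have := congrArg D.r h2
      simpa [map_mul, map_pow D.r (D.s ^ k), hrk] using this.symm
    rw [hUdef, ← map_mul, ← map_mul, h2, map_mul, hP1 p hp h3, mul_one, map_pow]
  -- Both sides exponentiate to `U ^ q`, so it remains to see that they commute. This follows
  -- because `U` is the `q`-th power of its conjugate by the inverse of Frobenius, and `N` lies in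
  -- the algebra generated by `U`.
  have hφN : T D.φ * N * T D.φ⁻¹ = D.q • N := by
    have hc : Commute (T D.φ * N * T D.φ⁻¹) N := by
      refine commute_of_mem_adjoin hNadj ?_
      have h1 : Commute (T D.φ⁻¹ * U * T D.φ) U := by
        have h2 : U = (T D.φ⁻¹ * U * T D.φ) ^ D.q := by
          have h3 : ∀ n : ℕ, (T D.φ⁻¹ * U * T D.φ) ^ n = T D.φ⁻¹ * U ^ n * T D.φ := by
            intro n
            induction n with
            | zero => simp [hinv']
            | succ n ih =>
              rw [pow_succ, ih, pow_succ]
              calc _ = T D.φ⁻¹ * U ^ n * (T D.φ * T D.φ⁻¹) * U * T D.φ := by noncomm_ring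
                _ = _ := by rw [hinv]; noncomm_ring
          rw [h3, ← hφ]
          calc U = (T D.φ⁻¹ * T D.φ) * U * (T D.φ⁻¹ * T D.φ) := by rw [hinv']; simp
            _ = _ := by noncomm_ring
        conv_rhs => rw [h2]
        exact (Commute.refl _).pow_right _
      have h4 := (commute_of_mem_adjoin hNadj h1).eq
      change _ * _ = _ * _
      calc T D.φ * N * T D.φ⁻¹ * U
          = T D.φ * (N * (T D.φ⁻¹ * U * T D.φ)) * T D.φ⁻¹ := by
            simp only [mul_assoc, hinv, mul_one]
        _ = (T D.φ * T D.φ⁻¹) * U * T D.φ * N * T D.φ⁻¹ := by rw [← h4]; noncomm_ring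
        _ = _ := by rw [hinv]; noncomm_ring
    refine exp_injective_of_commute ?_ (hN.smul _) (hc.smul_right _) ?_
    · obtain ⟨n, hn⟩ := hN
      refine ⟨n, ?_⟩
      have h3 : ∀ n : ℕ, (T D.φ * N * T D.φ⁻¹) ^ n = T D.φ * N ^ n * T D.φ⁻¹ := by
        intro n
        induction n with
        | zero => simp [hinv]
        | succ n ih =>
          rw [pow_succ, ih, pow_succ]
          calc _ = T D.φ * N ^ n * (T D.φ⁻¹ * T D.φ) * N * T D.φ⁻¹ := by noncomm_ring
            _ = _ := by rw [hinv']; noncomm_ring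
      rw [h3, hn]; simp
    · rw [exp_conj hN (hinv' _) (hinv _), hexp, exp_nsmul hN, hexp, hφ]
  have hrel : ∀ w, N * T w = (D.chi w)⁻¹ • (T w * N) := by
    let K : Subgroup W :=
      { carrier := {w | N * T w = (D.chi w)⁻¹ • (T w * N)}
        one_mem' := by simp [chi_one]
        mul_mem' := by
          intro a b ha hb
          simp only [Set.mem_ofPred_eq] at ha hb ⊢
          rw [map_mul, ← mul_assoc, ha, smul_mul_assoc, mul_assoc, hb, mul_smul_comm, smul_smul,
            chi_mul, mul_inv, mul_assoc]
        inv_mem' := by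
          intro a ha
          simp only [Set.mem_ofPred_eq] at ha ⊢
          have h1 := congrArg (fun X => D.chi a • (T a⁻¹ * X * T a⁻¹)) ha
          simp only [mul_smul_comm, smul_mul_assoc, smul_smul,
            mul_inv_cancel₀ (D.chi_ne_zero a), one_smul] at h1
          rw [chi_inv, inv_inv]
          rw [mul_assoc (T a⁻¹), mul_assoc N, hinv, mul_one,
            ← mul_assoc (T a⁻¹) (T a), hinv', one_mul] at h1
          exact h1.symm }
    have hK : K = ⊤ := by
      refine D.closure_eq_top K ?_ ?_ fun p hp => ?_
      · change N * T D.φ = (D.chi D.φ)⁻¹ • (T D.φ * N)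
        have h1 := congrArg (fun X => X * T D.φ) hφN
        simp only [mul_assoc, hinv', mul_one] at h1
        rw [h1, chi_φ, ← Nat.cast_smul_eq_nsmul L, smul_mul_assoc, smul_smul,
          inv_mul_cancel₀ D.q_ne_zero, one_smul]
      · change N * T D.s = _ • _
        rw [D.chi_I D.s_mem_I, inv_one, one_smul, hcommP]
        have : (D.s ^ k)⁻¹ * (D.s⁻¹ * D.s ^ k * D.s) = 1 := by group
        rw [this]
        exact one_mem _
      · change N * T p = _ • _
        rw [D.chi_I (D.P_le_I hp), inv_one, one_smul, hcommP]
        have : (D.s ^ k)⁻¹ * (p⁻¹ * D.s ^ k * p) = ((D.s ^ k)⁻¹ * p⁻¹ * D.s ^ k) * p := by group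
        rw [this]
        refine mul_mem ?_ hp
        simpa using D.normal.conj_mem _ (inv_mem hp) (D.s ^ k)⁻¹
    intro w
    have : w ∈ K := hK ▸ Subgroup.mem_top w
    exact this
  have hk0 : (k : L) ≠ 0 := by exact_mod_cast hk.ne'
  -- Dividing by `k` compensates for `t (s ^ k) = k`.
  refine ⟨(k : L)⁻¹ • N, hNlow.smul _, fun i => ?_, fun w => ?_, k, hk, hrk, ?_⟩
  · rw [Matrix.smul_apply, hNdiag, smul_zero]
  · rw [smul_mul_assoc, hrel, mul_smul_comm, smul_comm]
  · rw [D.t_pow_I D.s_mem_I, hts, mul_one, smul_smul, mul_inv_cancel₀ hk0, one_smul, hexp]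

include hρ hlow hdiag hP in
/-- A block triangular representation with the diagonal blocks of a standard one is conjugate to
a standard one. -/
theorem exists_conj_std : ∃ (G : (Blk m d R)ˣ) (x : Fin m → R), ∀ w,
    T w * G.1 = G.1 * D.std ρ x w := by
  obtain ⟨N, hNlow, hNdiag, hrel, k, hk, hrk, hTk⟩ := D.exists_monodromy hρ hlow hdiag hP
  have hNn : IsNilpotent N := hNlow.isNilpotent hNdiag
  have hrel' : ∀ w, -N * T w = (D.chi w)⁻¹ • (T w * -N) := fun w => by
    rw [neg_mul, hrel, mul_neg, smul_neg]
  -- Twisting by `-N` removes the monodromy: the new representation sends `s ^ k` to `1` and has the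
  -- same diagonal blocks.
  let T' : W →* Blk m d R := D.twistExp T hNn.neg hrel'
  have hT' : ∀ w, T' w = T w * IsNilpotent.exp (D.t w • -N) := fun w => rfl
  have hTT' : ∀ w, T w = T' w * IsNilpotent.exp (D.t w • N) := fun w => by
    rw [hT', mul_assoc, smul_neg, IsNilpotent.exp_neg_mul_exp_self (hNn.smul _), mul_one]
  have hNe : ∀ c : L, IsLower (c • -N) ∧ ∀ i, (c • -N) i i = 0 := fun c =>
    ⟨by rw [smul_neg, ← neg_smul]; exact hNlow.smul _, fun i => by simp [hNdiag]⟩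
  have hlow' : ∀ w, IsLower (T' w) := fun w => (hlow w).mul ((hNe _).1.exp (hNe _).2).1
  have hdiag' : ∀ w i, T' w i i = D.chi w ^ (i : ℕ) • (ρ w).1 := fun w i => by
    rw [hT', (hlow w).mul_apply_self ((hNe _).1.exp (hNe _).2).1, ((hNe _).1.exp (hNe _).2).2,
      mul_one, hdiag]
  have hPt : ∀ p ∈ D.P, T' p = T p := fun p hp => by rw [hT', D.t_P p hp]; simp
  have hsk : T' (D.s ^ k) = 1 := by
    rw [hT', hTk, smul_neg, IsNilpotent.exp_mul_exp_neg_self (hNn.smul _)]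
  have hP' : ∀ p ∈ D.P, ∃ M > 0, T' p ^ M = 1 := fun p hp => by rw [hPt p hp]; exact hP p hp
  -- the twisted representation is trivial on the kernel of `r` in inertia
  have hH : ∀ w ∈ D.I, D.r w = 1 → T' w = 1 := by
    intro w hw hr
    have h1 := D.isNilpotent_sub_one hρ hlow' hdiag' hw hr
    obtain ⟨a, b, p, hp, rfl⟩ := D.form_I hw
    -- Modulo `P`, the `k`-th power of `s ^ b * p` is a power of `s ^ k`, which now acts trivially,
    -- while wild elements act with finite order.
    have h2 : ∃ M > 0, T' (D.s ^ b * p) ^ M = 1 := by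
      have h3 : ((D.s ^ k) ^ b)⁻¹ * (D.s ^ b * p) ^ k ∈ D.P := by
        rw [← QuotientGroup.eq, QuotientGroup.mk_pow, QuotientGroup.mk_mul,
          (QuotientGroup.eq_one_iff p).mpr hp, mul_one, ← QuotientGroup.mk_pow]
        congr 1
        rw [← zpow_natCast, ← zpow_natCast, ← zpow_mul, ← zpow_mul, mul_comm]
      obtain ⟨M, hM, h4⟩ := hP' _ h3
      refine ⟨k * M, Nat.mul_pos hk hM, ?_⟩
      have h5 : (D.s ^ b * p) ^ k = (D.s ^ k) ^ b * (((D.s ^ k) ^ b)⁻¹ * (D.s ^ b * p) ^ k) := by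
        group
      have h6 : T' ((D.s ^ k) ^ b) = 1 := by
        have : ((D.s ^ k) ^ b) ∈ T'.ker := zpow_mem (MonoidHom.mem_ker.mpr hsk) b
        exact this
      rw [pow_mul, ← map_pow, h5, map_mul, h6, one_mul, h4]
    obtain ⟨M, hM, h3⟩ := h2
    have h4 : T' ((D.φ ^ a)⁻¹ * (D.s ^ b * p) * D.φ ^ a) ^ M = 1 := by
      have : ((D.φ ^ a)⁻¹ * (D.s ^ b * p) * D.φ ^ a) ^ M =
          (D.φ ^ a)⁻¹ * (D.s ^ b * p) ^ M * D.φ ^ a := by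
        have := conj_pow (a := (D.φ ^ a)⁻¹) (b := D.s ^ b * p) (i := M)
        simpa using this
      rw [← map_pow, this, map_mul, map_mul, map_pow, h3, mul_one, ← map_mul, inv_mul_cancel,
        map_one]
    have h5 := eq_zero_of_one_add_pow_eq_one (h1.1.isNilpotent h1.2) hM (by simpa using h4)
    exact sub_eq_zero.mp h5
  -- diagonalise the scalar power of Frobenius
  obtain ⟨α, hα⟩ := D.exists_scalar_φ_pow_h hρ
  -- The diagonal scalars of `φ ^ h`. Their differences are units because `q ≥ 2` has distinct
  -- powers in the characteristic zero field `L` and `α` is a unit.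
  let c : ℕ → R := fun i => algebraMap L R ((D.q : L) ^ (D.h * i)) * α
  have hcu : ∀ i j : ℕ, i ≠ j → IsUnit (c i - c j) := fun i j hij => by
    rw [← sub_mul, ← map_sub]
    refine IsUnit.mul (IsUnit.map _ (isUnit_iff_ne_zero.mpr (D.isUnit_q_pow_sub ?_))) α.isUnit
    exact fun h => hij (Nat.eq_of_mul_eq_mul_left D.h_pos h)
  have hψ : ∀ i : Fin m, T' (D.φ ^ D.h) i i = algebraMap R _ (c i) := fun i => by
    rw [hdiag', hα, chi_pow, chi_φ, ← pow_mul]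
    ext a b
    rw [Matrix.smul_apply, Matrix.algebraMap_matrix_apply, Matrix.scalar_apply,
      Matrix.diagonal_apply]
    split_ifs
    · rw [Algebra.smul_def]; rfl
    · simp
  obtain ⟨G₀, hG₀low, hG₀diag, hG₀⟩ := exists_diagonalise (hlow' (D.φ ^ D.h)) hψ hcu
  have hG₀' : T' (D.φ ^ D.h) * G₀ = G₀ * D.dia m ρ (D.φ ^ D.h) := by
    rw [hG₀]
    congr 1
    rw [dia_apply]
    congr 1
    ext1 i
    rw [← hψ, hdiag']
  -- average
  let K : Subgroup W :=
    { carrier := {w | T' w * G₀ = G₀ * D.dia m ρ w}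
      one_mem' := by simp
      mul_mem' := by
        intro a b ha hb
        simp only [Set.mem_ofPred_eq] at ha hb ⊢
        rw [map_mul, map_mul, mul_assoc, hb, ← mul_assoc, ha, mul_assoc]
      inv_mem' := by
        intro a ha
        simp only [Set.mem_ofPred_eq] at ha ⊢
        have h1 := congrArg (fun X => T' a⁻¹ * X * D.dia m ρ a⁻¹) ha
        rw [← mul_assoc, ← map_mul, inv_mul_cancel, map_one, one_mul, mul_assoc, mul_assoc,
          dia_mul_dia_inv, mul_one] at h1
        exact h1.symm }
  have hfin : Finite (W ⧸ K) := D.finite_quotient hG₀' fun w hw hr => by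
    change T' w * G₀ = G₀ * D.dia m ρ w
    rw [hH w hw hr, dia_apply, D.chi_I hw, hρ w hw, D.rB_eq_one R hr]
    simp
  have := Fintype.ofFinite (W ⧸ K)
  -- Each term is lower triangular with identity diagonal blocks, and depends only on the coset of
  -- `w`. The average is therefore unipotent, so it is an invertible intertwiner.
  let f : W → Blk m d R := fun w => T' w * G₀ * D.dia m ρ w⁻¹
  have hfK : ∀ g, ∀ k ∈ K, f (g * k) = f g := by
    intro g k hk
    change T' (g * k) * G₀ * D.dia m ρ (g * k)⁻¹ = T' g * G₀ * D.dia m ρ g⁻¹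
    have hk' : T' k * G₀ = G₀ * D.dia m ρ k := hk
    rw [map_mul, mul_assoc (T' g), hk', mul_inv_rev, map_mul, ← mul_assoc (T' g),
      mul_assoc, ← mul_assoc (D.dia m ρ k), dia_mul_dia_inv, one_mul]
  let S : Blk m d R := ∑ c : W ⧸ K, f c.out
  have hS : ∀ w, T' w * S * D.dia m ρ w⁻¹ = S := fun w =>
    map_sum_quotient_out f hfK w
      ((AddMonoidHom.mulRight (D.dia m ρ w⁻¹)).comp (AddMonoidHom.mulLeft (T' w))) fun g => by
        change T' w * (T' g * G₀ * D.dia m ρ g⁻¹) * D.dia m ρ w⁻¹ =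
          T' (w * g) * G₀ * D.dia m ρ (w * g)⁻¹
        rw [mul_inv_rev, map_mul, map_mul]
        simp only [mul_assoc]
  have hflow : ∀ w, IsLower (f w) := fun w =>
    ((hlow' w).mul hG₀low).mul (isLower_diagonal _)
  have hfdiag : ∀ w i, f w i i = 1 := fun w i => by
    have hd : IsLower (D.dia m ρ w⁻¹) := isLower_diagonal _
    have hd' : D.dia m ρ w⁻¹ i i = D.chi w⁻¹ ^ (i : ℕ) • (ρ w⁻¹).1 := Matrix.diagonal_apply_eq _ _
    change (T' w * G₀ * D.dia m ρ w⁻¹) i i = 1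
    rw [((hlow' w).mul hG₀low).mul_apply_self hd, (hlow' w).mul_apply_self hG₀low,
      hG₀diag, mul_one, hdiag', hd', smul_mul_smul_comm, ← mul_pow,
      ← chi_mul, ← Units.val_mul, ← map_mul, mul_inv_cancel]
    simp [chi_one]
  have hcard : (Fintype.card (W ⧸ K) : L) ≠ 0 := by
    have : 0 < Fintype.card (W ⧸ K) := Fintype.card_pos
    exact_mod_cast this.ne'
  set G : Blk m d R := (Fintype.card (W ⧸ K) : L)⁻¹ • S with hGdef
  have hGlow : IsLower (G - 1) :=
    ((IsLower.sum fun c _ => hflow c.out).smul _).sub isLower_one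
  have hGdiag : ∀ i, (G - 1) i i = 0 := fun i => by
    have hSi : S i i = ∑ c : W ⧸ K, f c.out i i := Matrix.sum_apply ..
    rw [Matrix.sub_apply, hGdef, Matrix.smul_apply, hSi,
      Finset.sum_congr rfl fun c _ => hfdiag c.out i, Finset.sum_const, Finset.card_univ,
      ← Nat.cast_smul_eq_nsmul L, smul_smul, inv_mul_cancel₀ hcard, one_smul]
    simp
  have hGu : IsUnit G := by
    have := (hGlow.isNilpotent hGdiag).isUnit_add_one
    rwa [sub_add_cancel] at this
  have hG : ∀ w, T' w * G = G * D.dia m ρ w := fun w => by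
    have h1 := congrArg (fun X => X * D.dia m ρ w) (hS w)
    simp only [mul_assoc, dia_inv_mul_dia, mul_one] at h1
    rw [hGdef, mul_smul_comm, smul_mul_assoc, h1]
  -- the monodromy operator in the new coordinates
  clear_value G
  obtain ⟨G, rfl⟩ := hGu
  set N' : Blk m d R := G⁻¹.1 * N * G.1 with hN'
  have hNG : N * G.1 = G.1 * N' := by
    rw [hN', ← mul_assoc, ← mul_assoc, Units.mul_inv, one_mul]
  have hN'n : IsNilpotent N' := by
    obtain ⟨n, hn⟩ := hNn
    refine ⟨n, ?_⟩
    have := Units.conj_pow' G N n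
    rw [hN', this, hn]; simp
  have hrelT' : ∀ w, N * T' w = (D.chi w)⁻¹ • (T' w * N) := fun w => by
    have h1 : Commute N (IsNilpotent.exp (D.t w • -N)) :=
      commute_exp (hNn.neg.smul _) (((Commute.refl N).neg_right).smul_right _)
    rw [hT', ← mul_assoc, hrel, smul_mul_assoc, mul_assoc, mul_assoc, h1.eq]
  have hrelD : ∀ w, N' * D.dia m ρ w = (D.chi w)⁻¹ • (D.dia m ρ w * N') := fun w => by
    have h1 : G.1 * (N' * D.dia m ρ w) = G.1 * ((D.chi w)⁻¹ • (D.dia m ρ w * N')) := by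
      rw [← mul_assoc, ← hNG, mul_assoc, ← hG, ← mul_assoc, hrelT', smul_mul_assoc, mul_assoc,
        hNG, ← mul_assoc, hG, mul_smul_comm, mul_assoc]
    exact (Units.mul_right_inj G).mp h1
  have hent : ∀ w (i j : Fin m), N' i j * (D.chi w ^ (j : ℕ) • (ρ w).1) =
      (D.chi w)⁻¹ • ((D.chi w ^ (i : ℕ) • (ρ w).1) * N' i j) := fun w i j => by
    have := congrFun (congrFun (hrelD w) i) j
    rwa [dia_apply, Matrix.mul_diagonal, Matrix.smul_apply, Matrix.diagonal_mul] at this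
  -- Comparing the action of `φ ^ h` on the two sides multiplies the `(i, j)` block by `q ^ (h * (j
  -- + 1)) - q ^ (h * i)`, which is nonzero off the first subdiagonal.
  have hzero : ∀ i j : Fin m, (i : ℕ) ≠ j + 1 → N' i j = 0 := fun i j hij => by
    have h1 := hent (D.φ ^ D.h) i j
    rw [hα, chi_pow, chi_φ] at h1
    have h2 : ∀ X : Matrix (Fin d) (Fin d) R, Matrix.scalar (Fin d) (α : R) * X = (α : R) • X :=
      fun X => by rw [Matrix.scalar_apply, Matrix.smul_eq_diagonal_mul]
    have h3 : N' i j * Matrix.scalar (Fin d) (α : R) = (α : R) • N' i j := by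
      rw [← h2]
      exact (Matrix.scalar_commute _ (fun _ => Commute.all _ _) _).eq.symm
    rw [mul_smul_comm, smul_mul_assoc, h2, h3, smul_smul] at h1
    have hq := D.q_ne_zero
    have h4 : (((D.q : L) ^ D.h) ^ ((j : ℕ) + 1) - ((D.q : L) ^ D.h) ^ (i : ℕ)) •
        ((α : R) • N' i j) = 0 := by
      have h5 := congrArg (fun X => ((D.q : L) ^ D.h) • X) h1
      simp only [smul_smul] at h5
      rw [mul_inv_cancel_left₀ (pow_ne_zero _ hq)] at h5
      rw [sub_smul, pow_succ', sub_eq_zero]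
      exact h5
    have h6 := (smul_eq_zero.mp h4).resolve_left (by
      rw [← pow_mul, ← pow_mul]
      exact D.isUnit_q_pow_sub fun h => hij (Nat.eq_of_mul_eq_mul_left D.h_pos h).symm)
    have h7 : α • N' i j = 0 := h6
    exact (smul_eq_zero_iff_eq α).mp h7
  -- On the first subdiagonal the twists cancel, so the block commutes with all of `ρ` and Schur's
  -- lemma applies.
  have hscal : ∀ i j : Fin m, (i : ℕ) = j + 1 → ∃ x : R, N' i j = Matrix.scalar (Fin d) x := by
    intro i j hij
    have h1 : ∀ w, Commute (N' i j) (ρ w).1 := fun w => by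
      have h2 := hent w i j
      rw [hij, mul_smul_comm, smul_mul_assoc, smul_smul, pow_succ',
        inv_mul_cancel_left₀ (D.chi_ne_zero w)] at h2
      exact (smul_right_injective _ (pow_ne_zero (j : ℕ) (D.chi_ne_zero w))) h2
    refine D.exists_scalar_of_mem_commutant hρ (D.mem_commutant.mpr fun w hw => ?_) (h1 _)
    rw [← hρ w hw]
    exact h1 w
  have hx : ∃ x : Fin m → R, N' = nil x := by
    have : ∀ j : Fin m, ∃ y : R, ∀ i : Fin m, (i : ℕ) = j + 1 →
        N' i j = Matrix.scalar (Fin d) y := by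
      intro j
      by_cases hj : (j : ℕ) + 1 < m
      · obtain ⟨y, hy⟩ := hscal ⟨j + 1, hj⟩ j rfl
        refine ⟨y, fun i hi => ?_⟩
        have : i = ⟨j + 1, hj⟩ := Fin.ext hi
        rw [this, hy]
      · exact ⟨0, fun i hi => absurd i.2 (by omega)⟩
    choose x hx using this
    refine ⟨x, Matrix.ext fun i j => ?_⟩
    rw [nil_apply]
    split_ifs with h
    · exact hx j i h
    · exact hzero i j h
  obtain ⟨x, hx⟩ := hx
  refine ⟨G, x, fun w => ?_⟩
  have hexp : IsNilpotent.exp (D.t w • N) * G.1 = G.1 * IsNilpotent.exp (D.t w • N') := by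
    have h1 : G⁻¹.1 * (D.t w • N) * G.1 = D.t w • N' := by
      rw [hN', mul_smul_comm, smul_mul_assoc]
    rw [← h1, exp_conj (hNn.smul _) (Units.mul_inv G) (Units.inv_mul G), ← mul_assoc, ← mul_assoc,
      Units.mul_inv, one_mul]
  rw [hTT', mul_assoc, hexp, ← mul_assoc, hG, mul_assoc, hx, std_apply]

end Triangular

end TameDatum

/-! ### Base change of block families and Zariski localization -/

/-- The rational algebra structure of an algebra over a field of characteristic zero. -/
abbrev ratAlgebra (L R : Type*) [Field L] [CharZero L] [CommRing R] [Algebra L R] : Algebra ℚ R :=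
  ((algebraMap L R).comp (algebraMap ℚ L)).toAlgebra

/-- Base change of a family of block matrices. -/
def bmapHom {L W R R' : Type*} [CommRing L] [Group W] [CommRing R] [Algebra L R] [CommRing R']
    [Algebra L R'] {m d : ℕ} (f : R →ₐ[L] R') (T : W →* Blk m d R) : W →* Blk m d R' :=
  ((bmap m d f : Blk m d R →* Blk m d R')).comp T

theorem bmapHom_apply {L W R R' : Type*} [CommRing L] [Group W] [CommRing R] [Algebra L R]
    [CommRing R'] [Algebra L R'] {m d : ℕ} (f : R →ₐ[L] R') (T : W →* Blk m d R) (w : W) :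
    bmapHom f T w = bmap m d f (T w) := rfl

theorem bmapHom_apply_apply {L W R R' : Type*} [CommRing L] [Group W] [CommRing R] [Algebra L R]
    [CommRing R'] [Algebra L R'] {m d : ℕ} (f : R →ₐ[L] R') (T : W →* Blk m d R) (w : W)
    (i j : Fin m) (a b : Fin d) : bmapHom f T w i j a b = f (T w i j a b) := rfl

theorem bmapHom_comp {L W R R' R'' : Type*} [CommRing L] [Group W] [CommRing R] [Algebra L R]
    [CommRing R'] [Algebra L R'] [CommRing R''] [Algebra L R''] {m d : ℕ} (g : R' →ₐ[L] R'')
    (f : R →ₐ[L] R') (T : W →* Blk m d R) : bmapHom g (bmapHom f T) = bmapHom (g.comp f) T := rfl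

theorem blk_hom_ext {W R : Type*} [Group W] [CommRing R] {m d : ℕ} {T T' : W →* Blk m d R}
    (h : ∀ w i j a b, T w i j a b = T' w i j a b) : T = T' :=
  MonoidHom.ext fun w => Matrix.ext fun i j => Matrix.ext fun a b => h w i j a b

/-- The localization map as a map of algebras. -/
abbrev awayHom (L : Type*) {R : Type*} [CommRing L] [CommRing R] [Algebra L R] (f : R) :
    R →ₐ[L] Localization.Away f := IsScalarTower.toAlgHom L R (Localization.Away f)

/-- The map of localizations induced by a map of algebras. -/
def awayMap {L R R' : Type*} [CommRing L] [CommRing R] [Algebra L R] [CommRing R'] [Algebra L R']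
    (g : R →ₐ[L] R') (f : R) : Localization.Away f →ₐ[L] Localization.Away (g f) :=
  Localization.awayMapₐ g f

theorem awayMap_comp {L R R' : Type*} [CommRing L] [CommRing R] [Algebra L R] [CommRing R']
    [Algebra L R'] (g : R →ₐ[L] R') (f : R) :
    (awayMap g f).comp (awayHom L f) = (awayHom L (g f)).comp g :=
  AlgHom.ext fun x => IsLocalization.map_eq (S := Localization.Away f)
    (Q := Localization.Away (g f)) (g := (g : R →+* R')) (M := Submonoid.powers f)
    (T := Submonoid.powers (g f)) (by
      rw [Submonoid.powers_le]
      exact ⟨1, pow_one _⟩) x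

theorem awayMap_injective {L R R' : Type*} [CommRing L] [CommRing R] [Algebra L R] [CommRing R']
    [Algebra L R'] (g : R →ₐ[L] R') (hg : Function.Injective g) (f : R) :
    Function.Injective (awayMap g f) := by
  have h : Submonoid.powers (g f) = (Submonoid.powers f).map (g : R →+* R') := by simp
  have : IsLocalization ((Submonoid.powers f).map (g : R →+* R')) (Localization.Away (g f)) := by
    rw [← h]; infer_instance
  exact IsLocalization.map_injective_of_injective (Submonoid.powers f) (Localization.Away f)
    (Localization.Away (g f)) hg

theorem eq_of_awayHom_eq {L R : Type*} [CommRing L] [CommRing R] [Algebra L R] {S : Set R}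
    (hS : Ideal.span S = ⊤) {x y : R} (h : ∀ f ∈ S, awayHom L f x = awayHom L f y) : x = y := by
  refine Localization.algebraMap_injective_of_span_eq_top S hS (a₁ := x) (a₂ := y) ?_
  funext f
  exact h f f.2

/-! ### Standard and locally standard families -/

namespace TameDatum

variable {L W : Type*} [Field L] [CharZero L] [Group W] {d : ℕ} (D : TameDatum L W d)

section IsStd

variable {m : ℕ} {R R' : Type*} [CommRing R] [Algebra L R] [CommRing R'] [Algebra L R']

/-- A family of block matrices is standard if it is conjugate to a standard discrete series. -/
def IsStd (T : W →* Blk m d R) : Prop :=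
  letI := ratAlgebra L R
  ∃ (G : (Blk m d R)ˣ) (ρ : W →* GL (Fin d) R) (x : Fin m → R),
    (∀ w ∈ D.I, ρ w = D.rB R w) ∧ ∀ w, T w * G.1 = G.1 * D.std ρ x w

theorem IsStd.map {T : W →* Blk m d R} (h : D.IsStd T) (g : R →ₐ[L] R') :
    D.IsStd (bmapHom g T) := by
  let := ratAlgebra L R
  let := ratAlgebra L R'
  obtain ⟨G, ρ, x, hρ, h⟩ := h
  refine ⟨Units.map (bmap m d g : Blk m d R →* Blk m d R') G, mapGL g.toRingHom ρ, fun i => g (x i),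
    fun w hw => Units.ext ?_, fun w => ?_⟩
  · rw [← D.map_rB g, ← hρ w hw]
    rfl
  · have := congrArg (bmap m d g) (h w)
    rw [map_mul, map_mul, D.bmap_std g (ρ' := mapGL g.toRingHom ρ) fun w => rfl] at this
    exact this

/-- A family of block matrices is locally standard if it is standard on a Zariski cover. -/
def IsLocStd (T : W →* Blk m d R) : Prop :=
  ∃ S : Set R, Ideal.span S = ⊤ ∧ ∀ f ∈ S, D.IsStd (bmapHom (awayHom L f) T)

theorem IsLocStd.map {T : W →* Blk m d R} (h : D.IsLocStd T) (g : R →ₐ[L] R') :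
    D.IsLocStd (bmapHom g T) := by
  obtain ⟨S, hS, h⟩ := h
  refine ⟨g '' S, ?_, ?_⟩
  · have := congrArg (Ideal.map (g : R →+* R')) hS
    rwa [Ideal.map_span, Ideal.map_top] at this
  · rintro _ ⟨f, hf, rfl⟩
    rw [bmapHom_comp, ← awayMap_comp, ← bmapHom_comp]
    exact (h f hf).map D _

end IsStd

end TameDatum

/-! ### Block determinants and families conjugate to standard ones over an extension -/

/-- The determinant of a block matrix. -/
def bdet {m d : ℕ} {R : Type*} [CommRing R] (X : Blk m d R) : R :=
  (Matrix.comp (Fin m) (Fin m) (Fin d) (Fin d) R X).det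

theorem comp_mul {m d : ℕ} {R : Type*} [CommRing R] (X Y : Blk m d R) :
    Matrix.comp _ _ _ _ R (X * Y) = Matrix.comp _ _ _ _ R X * Matrix.comp _ _ _ _ R Y :=
  map_mul (Matrix.compRingEquiv (Fin m) (Fin d) R) X Y

theorem bdet_mul {m d : ℕ} {R : Type*} [CommRing R] (X Y : Blk m d R) :
    bdet (X * Y) = bdet X * bdet Y := by
  rw [bdet, comp_mul, Matrix.det_mul]; rfl

theorem isUnit_of_bdet {m d : ℕ} {R : Type*} [CommRing R] {X : Blk m d R} (h : IsUnit (bdet X)) :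
    IsUnit X :=
  (MulEquiv.isUnit_map (Matrix.compRingEquiv (Fin m) (Fin d) R)).mp
    ((Matrix.isUnit_iff_isUnit_det _).mpr h)

theorem isUnit_bdet {m d : ℕ} {R : Type*} [CommRing R] {X : Blk m d R} (h : IsUnit X) :
    IsUnit (bdet X) :=
  (Matrix.isUnit_iff_isUnit_det _).mp (h.map (Matrix.compRingEquiv (Fin m) (Fin d) R))

theorem map_bdet {L R R' : Type*} [CommRing L] [CommRing R] [Algebra L R] [CommRing R']
    [Algebra L R'] {m d : ℕ} (f : R →ₐ[L] R') (X : Blk m d R) :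
    f (bdet X) = bdet (bmap m d f X) :=
  AlgHom.map_det f _

theorem bmap_injective {L R R' : Type*} [CommRing L] [CommRing R] [Algebra L R] [CommRing R']
    [Algebra L R'] {m d : ℕ} {f : R →ₐ[L] R'} (hf : Function.Injective f) :
    Function.Injective (bmap m d f) := fun _ _ h => Matrix.ext fun i j => Matrix.ext fun a b =>
  hf (congrFun (congrFun (congrFun (congrFun h i) j) a) b)

theorem isLower_std_aux {m d : ℕ} {R : Type*} [CommRing R] (x : Fin m → R) :
    IsLower (TameDatum.nil x : Blk m d R) ∧ ∀ i, (TameDatum.nil x : Blk m d R) i i = 0 := by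
  refine ⟨fun i j hij => ?_, fun i => ?_⟩ <;> rw [TameDatum.nil_apply, if_neg]
  · rw [Fin.lt_def] at hij; omega
  · omega

namespace TameDatum

variable {L W : Type*} [Field L] [CharZero L] [Group W] {d : ℕ} (D : TameDatum L W d)

variable {m : ℕ}

section

variable {R : Type*} [CommRing R] [Algebra L R]

theorem isLower_std [Algebra ℚ R] (ρ : W →* GL (Fin d) R) (x : Fin m → R) (w : W) :
    IsLower (D.std ρ x w) ∧ ∀ i, D.std ρ x w i i = D.chi w ^ (i : ℕ) • (ρ w).1 := by
  have h1 := isLower_std_aux (d := d) x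
  have h2 := (h1.1.smul (D.t w)).exp fun i => by rw [Matrix.smul_apply, h1.2, smul_zero]
  have h3 : IsLower (D.dia m ρ w) := isLower_diagonal _
  rw [std_apply]
  refine ⟨h3.mul h2.1, fun i => ?_⟩
  rw [h3.mul_apply_self h2.1, h2.2, mul_one]
  exact Matrix.diagonal_apply_eq _ _

theorem std_P [Algebra ℚ R] {ρ : W →* GL (Fin d) R} (hρ : ∀ w ∈ D.I, ρ w = D.rB R w)
    (x : Fin m → R) {p : W} (hp : p ∈ D.P) (hr : D.r p = 1) : D.std ρ x p = 1 := by
  rw [std_apply, D.t_P p hp, dia_apply, D.chi_I (D.P_le_I hp), hρ p (D.P_le_I hp),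
    D.rB_eq_one R hr]
  simp

theorem exists_r_pow_eq_one {p : W} (hp : p ∈ D.P) : ∃ M > 0, D.r (p ^ M) = 1 := by
  refine ⟨Nat.card D.Γ, Nat.card_pos, ?_⟩
  have := pow_card_eq_one' (x := (⟨D.r p, D.r_mem_Γ (D.P_le_I hp)⟩ : D.Γ))
  rw [map_pow]
  exact congrArg Subtype.val this

end

/-- Conjugating a homomorphism by a unit. -/
def conjHom {A : Type*} [Monoid A] (G : Aˣ) (T : W →* A) : W →* A where
  toFun w := G⁻¹.1 * T w * G.1
  map_one' := by simp
  map_mul' w w' := by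
    rw [map_mul]
    simp only [mul_assoc, Units.mul_inv_cancel_left]

section Descent

variable {A B : Type*} [CommRing A] [Algebra L A] [CommRing B] [Algebra L B]

/-- A family of block matrices which, over an extension, is conjugate to a standard one by a
matrix differing from a unit matrix over the base by a suitable diagonal matrix, is standard. -/
theorem isStd_of_conj [NeZero m] {ι : A →ₐ[L] B} (hι : Function.Injective ι) {T : W →* Blk m d A}
    [Algebra ℚ B] {ρ : W →* GL (Fin d) B} (hρ : ∀ w ∈ D.I, ρ w = D.rB B w) {x : Fin m → B}
    {G : (Blk m d B)ˣ} (hT : ∀ w, bmap m d ι (T w) * G.1 = G.1 * D.std ρ x w)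
    (G' : (Blk m d A)ˣ) {j : Fin m → B} {z : Matrix (Fin d) (Fin d) B}
    (hz : z ∈ D.commutant B)
    (hG : bmap m d ι G'.1 = G.1 * Matrix.diagonal fun i => j i • z) : D.IsStd T := by
  let := ratAlgebra L A
  let T' : W →* Blk m d A := conjHom G' T
  have hT' : ∀ w, T w * G'.1 = G'.1 * T' w := fun w => by
    change _ = G'.1 * (G'⁻¹.1 * T w * G'.1)
    rw [← mul_assoc, ← mul_assoc, Units.mul_inv, one_mul]
  let Z : Blk m d B := Matrix.diagonal fun i => j i • z
  have hZu : IsUnit Z := by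
    have h1 : IsUnit (bmap m d ι G'.1) := G'.isUnit.map (bmap m d ι)
    rw [hG] at h1
    exact (Units.isUnit_units_mul G _).mp h1
  have hjz : ∀ i, IsUnit (j i • z) := fun i => by
    obtain ⟨u, hu⟩ := hZu
    have h1 := congrFun (congrFun (show Z * u⁻¹.1 = 1 by rw [← hu, Units.mul_inv]) i) i
    have h2 := congrFun (congrFun (show u⁻¹.1 * Z = 1 by rw [← hu, Units.inv_mul]) i) i
    rw [Matrix.diagonal_mul, Matrix.one_apply_eq] at h1
    rw [Matrix.mul_diagonal, Matrix.one_apply_eq] at h2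
    exact ⟨⟨_, _, h1, h2⟩, rfl⟩
  -- Conjugation by `G'` over the base differs from the standardising conjugation only by the block
  -- diagonal `Z`. The triangular shape of the standard family thus descends through the injection.
  have hmain : ∀ w, Z * bmap m d ι (T' w) = D.std ρ x w * Z := fun w => by
    have h1 := congrArg (bmap m d ι) (hT' w)
    rw [map_mul, map_mul, hG, ← mul_assoc, hT, mul_assoc, mul_assoc] at h1
    exact ((Units.mul_right_inj G).mp h1).symm
  have hent : ∀ w i k, j i • z * ((T' w i k).map ι) = D.std ρ x w i k * (j k • z) := fun w i k => by
    have h1 := congrFun (congrFun (hmain w) i) k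
    rwa [Matrix.diagonal_mul, Matrix.mul_diagonal] at h1
  have hinjm : ∀ X Y : Matrix (Fin d) (Fin d) A, X.map ι = Y.map ι → X = Y := fun X Y h =>
    Matrix.map_injective hι h
  have hlow : ∀ w, IsLower (T' w) := fun w i k hik => by
    have h1 := hent w i k
    rw [(D.isLower_std ρ x w).1 i k hik, zero_mul] at h1
    refine hinjm _ _ ?_
    rw [Matrix.map_zero _ (map_zero ι)]
    exact (hjz i).mul_right_eq_zero.mp h1
  have hdiag0 : ∀ w i, z * ((T' w i i).map ι) = D.chi w ^ (i : ℕ) • ((ρ w).1 * z) := fun w i => by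
    have h1 := hent w i i
    rw [(D.isLower_std ρ x w).2 i] at h1
    have h2 : IsUnit (j i • (1 : Matrix (Fin d) (Fin d) B)) := by
      have h3 : j i • z = (j i • (1 : Matrix (Fin d) (Fin d) B)) * z := by simp
      have h4 := hjz i
      rw [h3] at h4
      exact isUnit_of_mul_isUnit_left h4
    refine h2.mul_left_cancel ?_
    rw [smul_mul_assoc, one_mul, smul_mul_assoc, one_mul, ← smul_mul_assoc, h1, mul_smul_comm,
      smul_mul_assoc]
  have hzu : IsUnit z := by
    have h4 := hjz 0
    have h3 : j 0 • z = (j 0 • (1 : Matrix (Fin d) (Fin d) B)) * z := by simp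
    rw [h3] at h4
    exact isUnit_of_mul_isUnit_right h4
  -- The extension of the inertial type is read off from the first diagonal block. The others are
  -- its twists, because cancelling the scalars `j i` leaves conjugation by the same `z` in every
  -- block.
  let ρ₁ : W →* Matrix (Fin d) (Fin d) A :=
    { toFun := fun w => T' w 0 0
      map_one' := by rw [map_one, Matrix.one_apply_eq]
      map_mul' := fun w w' => by rw [map_mul, (hlow w).mul_apply_self (hlow w')] }
  let ρ' : W →* GL (Fin d) A := ρ₁.toHomUnits
  have hρ' : ∀ w, (ρ' w).1 = T' w 0 0 := fun w => rfl
  have hdiag : ∀ w i, T' w i i = D.chi w ^ (i : ℕ) • (ρ' w).1 := fun w i => by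
    refine hinjm _ _ (hzu.mul_left_cancel ?_)
    rw [hdiag0, hρ']
    have h1 : (D.chi w ^ (i : ℕ) • T' w 0 0).map ι = D.chi w ^ (i : ℕ) • (T' w 0 0).map ι :=
      map_smul ι.mapMatrix _ _
    rw [h1, mul_smul_comm, hdiag0, Fin.val_zero, pow_zero, one_smul]
  -- As `z` lies in the commutant of inertia, conjugation by it does not change `r|I`.
  have hρ'I : ∀ w ∈ D.I, ρ' w = D.rB A w := fun w hw => by
    refine Units.ext (hinjm _ _ (hzu.mul_left_cancel ?_))
    rw [hρ', hdiag0, D.map_rB, Fin.val_zero, pow_zero, one_smul, hρ w hw]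
    exact (D.mem_commutant.mp hz w hw).eq.symm
  have hP : ∀ p ∈ D.P, ∃ M > 0, T' p ^ M = 1 := fun p hp => by
    obtain ⟨M, hM, hr⟩ := D.exists_r_pow_eq_one hp
    refine ⟨M, hM, ?_⟩
    have h1 := hmain (p ^ M)
    rw [D.std_P hρ x (pow_mem hp M) hr, one_mul] at h1
    have h2 : bmap m d ι (T' (p ^ M)) = bmap m d ι 1 := by
      rw [map_one]
      exact hZu.mul_left_cancel (by rw [h1, mul_one])
    rw [← map_pow]
    exact bmap_injective hι h2
  obtain ⟨G'', y, h⟩ := D.exists_conj_std hρ'I hlow hdiag hP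
  refine ⟨G' * G'', ρ', y, hρ'I, fun w => ?_⟩
  rw [Units.val_mul, ← mul_assoc, hT', mul_assoc, h, mul_assoc]

end Descent

end TameDatum

/-! ### Traces, and block matrices whose conjugates descend to the base -/

/-- The trace of a block matrix. -/
def btr {m d : ℕ} {R : Type*} [CommRing R] (X : Blk m d R) : R :=
  (Matrix.comp (Fin m) (Fin m) (Fin d) (Fin d) R X).trace

theorem btr_mul_comm {m d : ℕ} {R : Type*} [CommRing R] (X Y : Blk m d R) :
    btr (X * Y) = btr (Y * X) := by
  rw [btr, btr, comp_mul, comp_mul, Matrix.trace_mul_comm]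

theorem btr_eq_sum {m d : ℕ} {R : Type*} [CommRing R] (X : Blk m d R) :
    btr X = ∑ i, (X i i).trace := by
  rw [btr, Matrix.trace, Fintype.sum_prod_type]
  rfl

theorem btr_single {m d : ℕ} {R : Type*} [CommRing R] (i : Fin m) (X : Matrix (Fin d) (Fin d) R) :
    btr (Matrix.single i i X : Blk m d R) = X.trace := by
  rw [btr_eq_sum, Finset.sum_eq_single i]
  · rw [Matrix.single_apply_same]
  · intro k _ hk
    rw [Matrix.single_apply_of_ne _ _ _ _ _ (fun h => hk h.1.symm), Matrix.trace_zero]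
  · simp

theorem btr_conj {m d : ℕ} {R : Type*} [CommRing R] (G : (Blk m d R)ˣ) (X : Blk m d R) :
    btr (G.1 * X * G⁻¹.1) = btr X := by
  rw [btr_mul_comm, ← mul_assoc, Units.inv_mul, one_mul]

theorem map_btr {L R R' : Type*} [CommRing L] [CommRing R] [Algebra L R] [CommRing R']
    [Algebra L R'] {m d : ℕ} (f : R →ₐ[L] R') (X : Blk m d R) :
    f (btr X) = btr (bmap m d f X) := by
  rw [btr_eq_sum, btr_eq_sum, map_sum]
  refine Finset.sum_congr rfl fun i _ => ?_
  simp only [Matrix.trace, map_sum]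
  rfl

/-- Positivity over `ℚ` survives as nonvanishing in characteristic zero. It makes invertible the
factor by which the trace of a power of Frobenius differs from a scalar. -/
theorem sum_rat_pow_ne_zero {L : Type*} [Field L] [CharZero L] {m : ℕ} [NeZero m] {y : ℚ}
    (hy : 0 < y) : ∑ i : Fin m, (y : L) ^ (i : ℕ) ≠ 0 := by
  have h : 0 < ∑ i : Fin m, y ^ (i : ℕ) :=
    Finset.sum_pos (fun i _ => pow_pos hy _) ⟨0, Finset.mem_univ _⟩
  exact_mod_cast h.ne'

theorem bmap_single {L R R' : Type*} [CommRing L] [CommRing R] [Algebra L R] [CommRing R']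
    [Algebra L R'] {m d : ℕ} (f : R →ₐ[L] R') (i k : Fin m) (X : Matrix (Fin d) (Fin d) R) :
    bmap m d f (Matrix.single i k X) = Matrix.single i k (X.map f) := by
  refine Matrix.ext fun a b => ?_
  rw [bmap_apply, Matrix.single_apply, Matrix.single_apply]
  split_ifs
  · rfl
  · exact Matrix.map_zero _ (map_zero f)

namespace TameDatum

variable {L W : Type*} [Field L] [CharZero L] [Group W] {d : ℕ} (D : TameDatum L W d)

section Descent

variable {m : ℕ} [NeZero m] {A B : Type*} [CommRing A] [Algebra L A] [CommRing B] [Algebra L B]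
  [Algebra ℚ B] {ι : A →ₐ[L] B} (hι : Function.Injective ι) {T : W →* Blk m d A}
  {ρ : W →* GL (Fin d) B} (hρ : ∀ w ∈ D.I, ρ w = D.rB B w) {x : Fin m → B}
  {G : (Blk m d B)ˣ} (hT : ∀ w, bmap m d ι (T w) * G.1 = G.1 * D.std ρ x w)

/-- The matrices whose conjugates are defined over the base. -/
def descended (ι : A →ₐ[L] B) (G : (Blk m d B)ˣ) : Subalgebra L (Blk m d B) where
  carrier := {X | ∃ Y, bmap m d ι Y * G.1 = G.1 * X}
  mul_mem' := by
    rintro X X' ⟨Y, h⟩ ⟨Y', h'⟩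
    exact ⟨Y * Y', by rw [map_mul, mul_assoc, h', ← mul_assoc, h, mul_assoc]⟩
  one_mem' := ⟨1, by simp⟩
  add_mem' := by
    rintro X X' ⟨Y, h⟩ ⟨Y', h'⟩
    exact ⟨Y + Y', by rw [map_add, add_mul, h, h', mul_add]⟩
  zero_mem' := ⟨0, by simp⟩
  algebraMap_mem' c := ⟨algebraMap L _ c, by
    rw [AlgHom.commutes]; exact Algebra.commutes _ _⟩

theorem conj_mem_descended (Y : Blk m d A) : G⁻¹.1 * bmap m d ι Y * G.1 ∈ descended ι G :=
  ⟨Y, by rw [mul_assoc, Units.mul_inv_cancel_left]⟩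

theorem smul_mem_descended {X : Blk m d B} (hX : X ∈ descended ι G) (a : A) :
    ι a • X ∈ descended ι G := by
  obtain ⟨Y, h⟩ := hX
  refine ⟨a • Y, ?_⟩
  have : bmap m d ι (a • Y) = ι a • bmap m d ι Y :=
    Matrix.ext fun i j => Matrix.ext fun k l => map_mul ι a (Y i j k l)
  rw [this, smul_mul_assoc, h, mul_smul_comm]

include hT in
theorem std_mem_descended (w : W) : D.std ρ x w ∈ descended ι G := ⟨T w, hT w⟩

include hρ hT in
/-- The inverse of the scalar by which a power of Frobenius acts is defined over the base. -/
theorem exists_scalar_inv : ∃ (α : Bˣ) (a : A), (ρ (D.φ ^ D.h)).1 = Matrix.scalar (Fin d) (α : B) ∧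
    ι a = α⁻¹.1 := by
  obtain ⟨α, hα⟩ := D.exists_scalar_φ_pow_h hρ
  have hα' : (ρ (D.φ ^ D.h)⁻¹).1 = Matrix.scalar (Fin d) (α⁻¹.1 : B) := by
    rw [map_inv]
    refine Units.inv_eq_of_mul_eq_one_right ?_
    rw [hα, ← map_mul, Units.mul_inv, map_one]
  -- The trace of a representation over the base lies in the base; for the inverse of `φ ^ h` it is
  -- `α⁻¹` times a nonzero element of `L`.
  have h1 : ι (btr (T (D.φ ^ D.h)⁻¹)) =
      ((∑ i : Fin m, D.chi (D.φ ^ D.h)⁻¹ ^ (i : ℕ)) * d) • α⁻¹.1 := by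
    rw [map_btr]
    have h2 : bmap m d ι (T (D.φ ^ D.h)⁻¹) = G.1 * D.std ρ x (D.φ ^ D.h)⁻¹ * G⁻¹.1 := by
      rw [← hT, Units.mul_inv_cancel_right]
    rw [h2, btr_conj, btr_eq_sum, Finset.sum_mul, Finset.sum_smul]
    refine Finset.sum_congr rfl fun i _ => ?_
    rw [(D.isLower_std ρ x _).2, hα', Matrix.trace_smul, mul_smul]
    congr 1
    rw [Matrix.scalar_apply, Matrix.trace_diagonal, Finset.sum_const, Finset.card_univ,
      Fintype.card_fin, Nat.cast_smul_eq_nsmul]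
  have h2 : (∑ i : Fin m, D.chi (D.φ ^ D.h)⁻¹ ^ (i : ℕ)) * (d : L) ≠ 0 := by
    refine mul_ne_zero ?_ (by exact_mod_cast D.pos.ne')
    have h3 : D.chi (D.φ ^ D.h)⁻¹ = (((D.q : ℚ) ^ D.h)⁻¹ : ℚ) := by
      rw [chi_inv, chi_pow, chi_φ]; push_cast; rfl
    rw [h3]
    refine sum_rat_pow_ne_zero (inv_pos.mpr (pow_pos ?_ _))
    have := D.two_le
    exact_mod_cast (by omega : 0 < D.q)
  refine ⟨α, ((∑ i : Fin m, D.chi (D.φ ^ D.h)⁻¹ ^ (i : ℕ)) * (d : L))⁻¹ •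
    btr (T (D.φ ^ D.h)⁻¹), hα, ?_⟩
  rw [map_smul, h1, inv_smul_smul₀ h2]

include hρ hT in
-- Since `t` vanishes on powers of Frobenius, `α⁻¹` times the standard matrix of `φ ^ h` is block
-- diagonal with distinct scalars in `L`. Lagrange interpolation in this one matrix produces the
-- block idempotents.
theorem single_mem_descended (i : Fin m) : Matrix.single i i 1 ∈ descended ι G := by
  obtain ⟨α, a, hα, ha⟩ := D.exists_scalar_inv hρ hT
  let ev : ℕ → L := fun k => ((D.q : L) ^ D.h) ^ k
  have hev : ∀ k k', k ≠ k' → ev k - ev k' ≠ 0 := fun k k' hk => by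
    simp only [ev, ← pow_mul]
    exact D.isUnit_q_pow_sub fun h => hk (Nat.eq_of_mul_eq_mul_left D.h_pos h)
  have hd : ∀ f g : Fin m → L, (Matrix.diagonal fun k => f k • (1 : Matrix (Fin d) (Fin d) B)) *
      (Matrix.diagonal fun k => g k • 1) = (Matrix.diagonal fun k => (f k * g k) • 1 :
        Blk m d B) := fun f g => by
    rw [Matrix.diagonal_mul_diagonal]
    congr 1
    ext1 k
    rw [smul_mul_smul_comm, one_mul]
  have h1 : (Matrix.diagonal fun k : Fin m => ev k • 1 : Blk m d B) ∈ descended ι G := by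
    have h2 := smul_mem_descended (D.std_mem_descended hT (D.φ ^ D.h)) a
    rw [ha, std_apply, D.t_φ_pow, zero_smul, IsNilpotent.exp_zero, mul_one, dia_apply] at h2
    convert h2 using 1
    rw [← Matrix.diagonal_smul]
    congr 1
    ext1 k
    rw [Pi.smul_apply, hα, chi_pow, chi_φ, smul_comm]
    congr 1
    rw [Matrix.scalar_apply, ← Matrix.diagonal_smul]
    ext a b
    by_cases hab : a = b
    · subst hab; simp
    · simp [hab]
  have h2 : ∀ s : Finset (Fin m), (Matrix.diagonal fun k : Fin m =>
      (∏ j ∈ s, (ev k - ev j)) • 1 : Blk m d B) ∈ descended ι G := fun s => by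
    induction s using Finset.induction_on with
    | empty => simp
    | insert j s hj ih =>
      have h3 : (Matrix.diagonal fun k : Fin m => (ev k - ev j) • 1 : Blk m d B) ∈
          descended ι G := by
        have h4 := sub_mem h1 ((descended ι G).smul_mem (one_mem _) (ev j))
        convert h4 using 1
        have h5 : ev j • (1 : Blk m d B) = Matrix.diagonal fun _ => ev j • 1 := by
          rw [← Matrix.diagonal_one (n := Fin m), ← Matrix.diagonal_smul]
          rfl
        rw [h5, Matrix.diagonal_sub]
        simp only [sub_smul]
      have h4 := mul_mem h3 ih
      rw [hd] at h4
      simpa only [Finset.prod_insert hj] using h4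
  have h3 := (descended ι G).smul_mem (h2 (Finset.univ.erase i))
    (∏ j ∈ Finset.univ.erase i, (ev i - ev j))⁻¹
  convert h3 using 1
  refine Matrix.ext fun k l => ?_
  rw [Matrix.smul_apply, Matrix.single_apply, Matrix.diagonal_apply]
  by_cases hkl : k = l
  · subst hkl
    by_cases hik : i = k
    · subst hik
      rw [if_pos ⟨rfl, rfl⟩, if_pos rfl, inv_smul_smul₀]
      refine Finset.prod_ne_zero_iff.mpr fun j hj => hev _ _ ?_
      exact fun h => (Finset.ne_of_mem_erase hj) (Fin.ext h.symm)
    · rw [if_neg (fun h => hik h.1), if_pos rfl,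
        Finset.prod_eq_zero (f := fun j : Fin m => ev k - ev j) (Finset.mem_erase.mpr ⟨fun h => hik h.symm, Finset.mem_univ k⟩)
          (sub_self _), zero_smul, smul_zero]
  · rw [if_neg (fun h => hkl (h.1.symm.trans h.2)), if_neg hkl, smul_zero]

include hρ hT in
-- Compress the standard matrix of `w` between two copies of the `i`-th block idempotent and divide
-- by the twist.
theorem single_rho_mem_descended (i : Fin m) (w : W) :
    Matrix.single i i (ρ w).1 ∈ descended ι G := by
  have h1 := D.single_mem_descended hρ hT i
  have h2 := (descended ι G).smul_mem
    (mul_mem (mul_mem h1 (D.std_mem_descended hT w)) h1) (D.chi w ^ (i : ℕ))⁻¹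
  rw [Matrix.single_mul_mul_single, one_mul, mul_one, (D.isLower_std ρ x w).2, Matrix.smul_single,
    inv_smul_smul₀ (pow_ne_zero _ (D.chi_ne_zero w))] at h2
  exact h2

include hρ hT in
/-- By Schur's lemma, averaging an off-diagonal block gives a scalar. -/
theorem trace_smul_single_mem_descended {Y : Blk m d B} (hY : Y ∈ descended ι G) (i k : Fin m) :
    (Y i k).trace • Matrix.single i k 1 ∈ descended ι G := by
  -- The conjugates of `Z` under `ρ` take only finitely many values, so they can be summed over the
  -- cosets of the stabiliser `K`; the sum is `W`-invariant, hence a scalar.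
  set Z := Y i k with hZ
  let K : Subgroup W :=
    { carrier := {w | (ρ w).1 * Z = Z * (ρ w).1}
      one_mem' := by simp
      mul_mem' := by
        intro a b ha hb
        simp only [Set.mem_ofPred_eq] at ha hb ⊢
        rw [map_mul, Units.val_mul, mul_assoc, hb, ← mul_assoc, ha, mul_assoc]
      inv_mem' := by
        intro a ha
        have ha' : Commute Z (ρ a).1 := Commute.symm ha
        rw [Set.mem_ofPred_eq, map_inv]
        exact ha'.units_inv_right.eq.symm }
  obtain ⟨α, hα⟩ := D.exists_scalar_φ_pow_h hρ
  have hfin : Finite (W ⧸ K) := by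
    refine D.finite_quotient ?_ fun w hw hr => ?_
    · change _ * _ = _ * _
      rw [hα]
      exact Matrix.scalar_commute _ (fun _ => Commute.all _ _) _
    · change _ * _ = _ * _
      rw [hρ w hw, D.rB_eq_one B hr]
      simp
  have := Fintype.ofFinite (W ⧸ K)
  let f : W → Matrix (Fin d) (Fin d) B := fun w => (ρ w).1 * Z * (ρ w⁻¹).1
  have hfK : ∀ g, ∀ k ∈ K, f (g * k) = f g := by
    intro g k hk
    have hk' : (ρ k).1 * Z = Z * (ρ k).1 := hk
    have e : (ρ k).1 * (ρ k⁻¹).1 = 1 := by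
      rw [← Units.val_mul, ← map_mul, mul_inv_cancel, map_one, Units.val_one]
    change (ρ (g * k)).1 * Z * (ρ (g * k)⁻¹).1 = _
    rw [map_mul, Units.val_mul, mul_assoc (ρ g).1, hk', mul_inv_rev, map_mul, Units.val_mul]
    calc _ = (ρ g).1 * Z * ((ρ k).1 * (ρ k⁻¹).1) * (ρ g⁻¹).1 := by simp only [mul_assoc]
      _ = f g := by rw [e, mul_one]
  let S : Matrix (Fin d) (Fin d) B := ∑ c : W ⧸ K, f c.out
  have hS : ∀ w, (ρ w).1 * S * (ρ w⁻¹).1 = S := fun w =>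
    map_sum_quotient_out f hfK w
      ((AddMonoidHom.mulRight (ρ w⁻¹).1).comp (AddMonoidHom.mulLeft (ρ w).1)) fun g => by
        change (ρ w).1 * ((ρ g).1 * Z * (ρ g⁻¹).1) * (ρ w⁻¹).1 =
          (ρ (w * g)).1 * Z * (ρ (w * g)⁻¹).1
        rw [mul_inv_rev, map_mul, map_mul, Units.val_mul, Units.val_mul]
        simp only [mul_assoc]
  have hSc : ∀ w, Commute S (ρ w).1 := fun w => by
    have h1 := congrArg (fun X => X * (ρ w).1) (hS w)
    have e : (ρ w⁻¹).1 * (ρ w).1 = 1 := by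
      rw [← Units.val_mul, ← map_mul, inv_mul_cancel, map_one, Units.val_one]
    simp only [mul_assoc, e, mul_one] at h1
    exact h1.symm
  obtain ⟨y, hy⟩ := D.exists_scalar_of_mem_commutant hρ (D.mem_commutant.mpr fun w hw => by
    rw [← hρ w hw]; exact hSc w) (hSc _)
  have hmem : (Matrix.single i k S : Blk m d B) ∈ descended ι G := by
    have h1 : (Matrix.single i k S : Blk m d B) = ∑ c : W ⧸ K, Matrix.single i k (f c.out) :=
      map_sum (Matrix.singleAddMonoidHom i k) _ _
    rw [h1]
    refine sum_mem fun c _ => ?_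
    have h2 := mul_mem (mul_mem (D.single_rho_mem_descended hρ hT i c.out) hY)
      (D.single_rho_mem_descended hρ hT k c.out⁻¹)
    rwa [Matrix.single_mul_mul_single] at h2
  -- Conjugation preserves traces, so comparing traces identifies the scalar with `Z.trace` up to a
  -- nonzero factor in `L`.
  have htr : (Fintype.card (W ⧸ K) : L) • Z.trace = (d : L) • y := by
    have h1 : S.trace = Fintype.card (W ⧸ K) • Z.trace := by
      rw [Matrix.trace_sum, Finset.sum_congr rfl (g := fun _ => Z.trace), Finset.sum_const,
        Finset.card_univ]
      intro c _
      change ((ρ c.out).1 * Z * (ρ c.out⁻¹).1).trace = _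
      rw [Matrix.trace_mul_comm, ← mul_assoc, ← Units.val_mul, ← map_mul, inv_mul_cancel, map_one,
        Units.val_one, one_mul]
    rw [Nat.cast_smul_eq_nsmul, ← h1, hy, Matrix.scalar_apply, Matrix.trace_diagonal,
      Finset.sum_const, Finset.card_univ, Fintype.card_fin, Nat.cast_smul_eq_nsmul]
  have hcard : (Fintype.card (W ⧸ K) : L) ≠ 0 := by
    have : 0 < Fintype.card (W ⧸ K) := Fintype.card_pos
    exact_mod_cast this.ne'
  have h3 := (descended ι G).smul_mem hmem ((Fintype.card (W ⧸ K) : L)⁻¹ * d)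
  convert h3 using 1
  have h4 : Z.trace = ((Fintype.card (W ⧸ K) : L)⁻¹ * d) • y := by
    rw [mul_smul, ← htr, inv_smul_smul₀ hcard]
  rw [h4, Matrix.smul_single, Matrix.smul_single, hy]
  congr 1
  rw [Matrix.scalar_apply, smul_assoc, Matrix.smul_one_eq_diagonal]

end Descent

end TameDatum

theorem trace_single_one_mul {d : ℕ} {R : Type*} [CommRing R] (a b : Fin d)
    (X : Matrix (Fin d) (Fin d) R) : (Matrix.single a b 1 * X).trace = X b a := by
  rw [Matrix.trace, Finset.sum_eq_single a]
  · simp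
  · intro c _ hc
    simp [hc]
  · simp

theorem btr_single_mul {m d : ℕ} {R : Type*} [CommRing R] (k l : Fin m)
    (S : Matrix (Fin d) (Fin d) R) (X : Blk m d R) :
    btr (Matrix.single k l S * X) = (S * X l k).trace := by
  rw [btr_eq_sum, Finset.sum_eq_single k]
  · rw [Matrix.single_mul_apply_same]
  · intro c _ hc
    rw [Matrix.single_mul_apply_of_ne _ _ _ _ _ hc, Matrix.trace_zero]
  · simp

theorem btr_mul_eq_sum {m d : ℕ} {R : Type*} [CommRing R] (X Y : Blk m d R) :
    btr (X * Y) = ∑ k, ∑ l, ∑ a, ∑ b, X l k b a * Y k l a b := by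
  rw [btr_mul_comm, btr_eq_sum]
  refine Finset.sum_congr rfl fun k _ => ?_
  rw [Matrix.mul_apply, Matrix.trace_sum]
  refine Finset.sum_congr rfl fun l _ => ?_
  rw [Matrix.trace]
  refine Finset.sum_congr rfl fun a _ => ?_
  rw [Matrix.diag_apply, Matrix.mul_apply]
  exact Finset.sum_congr rfl fun b _ => mul_comm _ _

/-- The rectangular intertwiners are stored in square block matrices: `X` occupies the first block
column and `Y` the first block row, so that all products stay in one ring. -/
theorem exists_blk_intertwiner {k G : Type*} [Field k] [CharZero k] [Group G] [Finite G] {m d : ℕ}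
    [NeZero m] (σ : G →* Matrix (Fin d) (Fin d) k) (τ : G → Blk m d k)
    (hτ : ∀ g h, τ (g * h) = τ g * τ h) (htr : ∀ g, btr (τ g) = (σ g).trace) :
    ∃ X Y : Blk m d k, Y * X = Matrix.single 0 0 1 ∧ X * Matrix.single 0 0 1 = X ∧
      Matrix.single 0 0 1 * Y = Y ∧ (∀ g, τ g * X = X * Matrix.single 0 0 (σ g)) ∧
      ∀ g, Y * τ g = Matrix.single 0 0 (σ g) * Y := by
  obtain ⟨X, Y, hYX, hXY, hX⟩ := exists_matrix_intertwiner σ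
    (fun g => Matrix.comp _ _ _ _ k (τ g)) (fun g h => by rw [hτ, comp_mul]) htr
  have hY : ∀ g, Y * Matrix.comp _ _ _ _ k (τ g) = σ g * Y := fun g => by
    have h1 : Matrix.comp _ _ _ _ k (τ g) =
        Matrix.comp _ _ _ _ k (τ g) * Matrix.comp _ _ _ _ k (τ 1) := by
      rw [← comp_mul, ← hτ, mul_one]
    rw [h1, ← hXY, ← Matrix.mul_assoc, ← Matrix.mul_assoc, Matrix.mul_assoc Y, hX,
      ← Matrix.mul_assoc, hYX, one_mul]
  let X' : Fin m → Matrix (Fin d) (Fin d) k := fun i => Matrix.of fun a b => X (i, a) b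
  let Y' : Fin m → Matrix (Fin d) (Fin d) k := fun i => Matrix.of fun a b => Y a (i, b)
  have e1 : ∑ i, Y' i * X' i = 1 := by
    rw [← hYX]
    ext a b
    rw [Matrix.sum_apply, Matrix.mul_apply, Fintype.sum_prod_type]
    rfl
  have e2 : ∀ g i, ∑ j, τ g i j * X' j = X' i * σ g := fun g i => by
    ext a b
    have := congrFun (congrFun (hX g) (i, a)) b
    rw [Matrix.mul_apply, Fintype.sum_prod_type] at this
    rw [Matrix.sum_apply]
    exact this
  have e3 : ∀ g i, ∑ j, Y' j * τ g j i = σ g * Y' i := fun g i => by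
    ext a b
    have := congrFun (congrFun (hY g) a) (i, b)
    rw [Matrix.mul_apply, Fintype.sum_prod_type] at this
    rw [Matrix.sum_apply]
    exact this
  refine ⟨Matrix.of fun i j => if j = 0 then X' i else 0,
    Matrix.of fun i j => if i = 0 then Y' j else 0, ?_, ?_, ?_, fun g => ?_, fun g => ?_⟩
  · refine Matrix.ext fun i j => ?_
    rw [Matrix.mul_apply, Matrix.single_apply]
    simp only [Matrix.of_apply]
    by_cases hi : i = 0
    · by_cases hj : j = 0
      · subst hi hj; simp [e1]
      · simp [hj, Ne.symm hj]
    · simp [hi, Ne.symm hi]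
  · refine Matrix.ext fun i j => ?_
    by_cases hj : j = 0
    · subst hj
      rw [Matrix.mul_single_apply_same, mul_one]
    · rw [Matrix.mul_single_apply_of_ne _ _ _ _ _ hj]
      simp [hj]
  · refine Matrix.ext fun i j => ?_
    by_cases hj : i = 0
    · subst hj
      rw [Matrix.single_mul_apply_same, one_mul]
    · rw [Matrix.single_mul_apply_of_ne _ _ _ _ _ hj]
      simp [hj]
  · refine Matrix.ext fun i j => ?_
    by_cases hj : j = 0
    · subst hj
      rw [Matrix.mul_single_apply_same, Matrix.mul_apply]
      simpa using e2 g i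
    · rw [Matrix.mul_single_apply_of_ne _ _ _ _ _ hj, Matrix.mul_apply]
      simp [hj]
  · refine Matrix.ext fun i j => ?_
    by_cases hj : i = 0
    · subst hj
      rw [Matrix.single_mul_apply_same, Matrix.mul_apply]
      simpa using e3 g j
    · rw [Matrix.single_mul_apply_of_ne _ _ _ _ _ hj, Matrix.mul_apply]
      simp [hj]

namespace TameDatum

variable {L W : Type*} [Field L] [CharZero L] [Group W] {d : ℕ} (D : TameDatum L W d)

section Descent

variable {m : ℕ} [NeZero m] {A B : Type*} [CommRing A] [Algebra L A] [CommRing B] [Algebra L B]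
  [Algebra ℚ B] {ι : A →ₐ[L] B} (hι : Function.Injective ι) {T : W →* Blk m d A}
  {ρ : W →* GL (Fin d) B} (hρ : ∀ w ∈ D.I, ρ w = D.rB B w) {x : Fin m → B}
  {G : (Blk m d B)ˣ} (hT : ∀ w, bmap m d ι (T w) * G.1 = G.1 * D.std ρ x w)

/-- The conjugate of a block matrix unit. -/
abbrev conjSingle (G : (Blk m d B)ˣ) (i k : Fin m) : Blk m d B :=
  G.1 * Matrix.single i k 1 * G⁻¹.1

include hρ hT in
-- Apply the trace statement to the conjugate of an elementary matrix over the base. Its trace in a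
-- given block is an entry of a conjugated block matrix unit.
theorem entry_smul_single_mem_descended (i k : Fin m) (k' l' : Fin m) (a b : Fin d) :
    (conjSingle G k i) l' k' b a • Matrix.single i k 1 ∈ descended ι G := by
  have h1 := D.trace_smul_single_mem_descended hρ hT
    (conj_mem_descended (ι := ι) (G := G) (Matrix.single k' l' (Matrix.single a b 1))) i k
  convert h1 using 2
  have h2 : (Matrix.single a b (1 : A)).map ι = Matrix.single a b 1 := by
    rw [Matrix.map_single, map_one]
  rw [bmap_single, h2]
  set S : Blk m d B := Matrix.single k' l' (Matrix.single a b 1) with hS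
  calc conjSingle G k i l' k' b a = btr (S * conjSingle G k i) := by
        rw [hS, btr_single_mul, trace_single_one_mul]
    _ = btr (Matrix.single k i 1 * (G⁻¹.1 * S * G.1)) := by
        rw [conjSingle, ← mul_assoc, btr_mul_comm, ← mul_assoc, ← mul_assoc, btr_mul_comm]
    _ = ((G⁻¹.1 * S * G.1) i k).trace := by rw [btr_single_mul, one_mul]

include hι hρ hT in
-- The entries of the conjugates of the block units at `(i, 0)` and `(0, i)` have paired products
-- lying in `A`. These products sum to the trace of the conjugate of the idempotent at `(i, i)`,
-- which is the unit `d`; so one of them avoids the prime ideal.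
theorem exists_smul_single (𝔪 : Ideal A) [𝔪.IsPrime] (i : Fin m) : ∃ (u j : B) (f : A), f ∉ 𝔪 ∧
    ι f = u * j ∧ u • Matrix.single 0 i 1 ∈ descended ι G ∧
    j • Matrix.single i 0 1 ∈ descended ι G := by
  have h1 := D.entry_smul_single_mem_descended hρ hT 0 i
  have h2 := D.entry_smul_single_mem_descended hρ hT i 0
  choose Y hY using h1
  have h3 : ∀ k l a b, ι (Y k l a b k l a b) = (conjSingle G i 0) l k b a *
      (conjSingle G 0 i) k l a b := fun k l a b => by
    have h4 : bmap m d ι (Y k l a b) = (conjSingle G i 0) l k b a •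
        (conjSingle G 0 i) := by
      have h5 := congrArg (fun X => X * G⁻¹.1) (hY k l a b)
      simp only [Units.mul_inv_cancel_right] at h5
      rw [h5, conjSingle, mul_smul_comm, smul_mul_assoc]
    exact congrFun (congrFun (congrFun (congrFun h4 k) l) a) b
  by_cases hall : ∀ k l a b, Y k l a b k l a b ∈ 𝔪
  · exfalso
    have h4 : ∑ k, ∑ l, ∑ a, ∑ b, Y k l a b k l a b = algebraMap L A d := by
      apply hι
      simp only [map_sum, h3]
      rw [← btr_mul_eq_sum, AlgHom.commutes]
      have h5 : conjSingle G i 0 * (conjSingle G 0 i) =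
          conjSingle G i i := by
        have h6 : (Matrix.single i i 1 : Blk m d B) =
            Matrix.single i 0 1 * Matrix.single 0 i 1 := by
          rw [Matrix.single_mul_single_same, mul_one]
        rw [conjSingle, conjSingle, conjSingle, h6]
        simp only [mul_assoc, Units.inv_mul_cancel_left]
      rw [h5, btr_conj, btr_single, Matrix.trace_one, Fintype.card_fin, map_natCast]
    have h5 : algebraMap L A d ∈ 𝔪 := by
      rw [← h4]
      exact sum_mem fun k _ => sum_mem fun l _ => sum_mem fun a _ => sum_mem fun b _ => hall k l a b
    refine (inferInstance : 𝔪.IsPrime).ne_top (Ideal.eq_top_of_isUnit_mem _ h5 ?_)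
    refine IsUnit.map _ (isUnit_iff_ne_zero.mpr ?_)
    exact_mod_cast D.pos.ne'
  · push Not at hall
    obtain ⟨k, l, a, b, h⟩ := hall
    exact ⟨_, _, _, h, h3 k l a b, ⟨_, hY k l a b⟩, h2 l k b a⟩

end Descent

end TameDatum

theorem bmap_surjective {L R R' : Type*} [CommRing L] [CommRing R] [Algebra L R] [CommRing R']
    [Algebra L R'] {m d : ℕ} {f : R →ₐ[L] R'} (hf : Function.Surjective f) :
    Function.Surjective (bmap m d f) := fun X =>
  ⟨fun i j => Matrix.of fun a b => Function.surjInv hf (X i j a b),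
    Matrix.ext fun i j => Matrix.ext fun a b => Function.surjInv_eq hf (X i j a b)⟩

/-! ### Bases near a maximal ideal, and descent of standardness to a subring -/

namespace TameDatum

variable {L W : Type*} [Field L] [CharZero L] [Group W] {d : ℕ} (D : TameDatum L W d)

/-- The inclusion of the image of inertia, over an algebra. -/
abbrev ΓB (R : Type*) [CommRing R] [Algebra L R] : D.Γ →* GL (Fin d) R :=
  mapGL (algebraMap L R) D.Γ.subtype

theorem map_ΓB {R R' : Type*} [CommRing R] [Algebra L R] [CommRing R'] [Algebra L R']
    (f : R →ₐ[L] R') (γ : D.Γ) : (D.ΓB R γ).1.map f = (D.ΓB R' γ).1 := by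
  obtain ⟨_, w, hw, rfl⟩ := γ
  exact D.map_rB f w

section Descent

variable {m : ℕ} [NeZero m] {A B : Type*} [CommRing A] [Algebra L A] [CommRing B] [Algebra L B]
  [Algebra ℚ B] {ι : A →ₐ[L] B} (hι : Function.Injective ι) {T : W →* Blk m d A}
  {ρ : W →* GL (Fin d) B} (hρ : ∀ w ∈ D.I, ρ w = D.rB B w) {x : Fin m → B}
  {G : (Blk m d B)ˣ} (hT : ∀ w, bmap m d ι (T w) * G.1 = G.1 * D.std ρ x w)

include hι hρ hT in
/-- Locally over the base there is a basis of the multiplicity-free part on which inertia acts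
through `r`. -/
theorem exists_basis (𝔪 : Ideal A) [𝔪.IsMaximal] : ∃ (X Y : Blk m d A)
    (y z : Matrix (Fin d) (Fin d) B), z ∈ D.commutant B ∧
    bmap m d ι X = G.1 * Matrix.single 0 0 z ∧ bmap m d ι Y * G.1 = Matrix.single 0 0 y ∧
    bmap m d (Ideal.Quotient.mkₐ L 𝔪) (Y * X) = Matrix.single 0 0 1 := by
  -- Inertia acting on the first block alone, conjugated by `G`, is defined over the base. It is
  -- multiplicative but not unital, with the traces of `r`.
  have hQ : ∀ γ : D.Γ, ∃ Q : Blk m d A,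
      bmap m d ι Q * G.1 = G.1 * Matrix.single 0 0 (D.ΓB B γ).1 := by
    rintro ⟨_, w, hw, rfl⟩
    have h1 := D.single_rho_mem_descended hρ hT 0 w
    rw [hρ w hw] at h1
    exact h1
  choose Q hQ using hQ
  have hQ' : ∀ γ, bmap m d ι (Q γ) = G.1 * Matrix.single 0 0 (D.ΓB B γ).1 * G⁻¹.1 := fun γ => by
    rw [← hQ, Units.mul_inv_cancel_right]
  have hQmul : ∀ γ δ, Q (γ * δ) = Q γ * Q δ := fun γ δ => by
    refine bmap_injective hι ?_
    rw [map_mul, hQ', hQ', hQ', map_mul, Units.val_mul, ← Matrix.single_mul_single_same (j := (0 : Fin m))]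
    simp only [mul_assoc, Units.inv_mul_cancel_left]
  let := Ideal.Quotient.field 𝔪
  set π := Ideal.Quotient.mkₐ L 𝔪 with hπ
  have : CharZero (A ⧸ 𝔪) := charZero_of_injective_algebraMap (algebraMap L (A ⧸ 𝔪)).injective
  have htr : ∀ γ, btr (bmap m d π (Q γ)) = (D.ΓB (A ⧸ 𝔪) γ).1.trace := fun γ => by
    have h1 : btr (Q γ) = (D.ΓB A γ).1.trace := by
      apply hι
      rw [map_btr, hQ', btr_conj, btr_single, ← D.map_ΓB ι]
      exact (AddMonoidHom.map_trace ι _).symm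
    rw [← map_btr, h1, ← D.map_ΓB π]
    exact AddMonoidHom.map_trace π _
  -- Over the residue field, of characteristic zero, equal characters identify the reduction of this
  -- action on its image with `r`.
  obtain ⟨X, Y, hYX, hX0, hY0, hX, hY⟩ := exists_blk_intertwiner
    ((Units.coeHom _).comp (D.ΓB (A ⧸ 𝔪))) (fun γ => bmap m d π (Q γ))
    (fun γ δ => by rw [hQmul, map_mul]) htr
  obtain ⟨X₀, rfl⟩ := bmap_surjective (Ideal.Quotient.mkₐ_surjective L 𝔪) X
  obtain ⟨Y₀, rfl⟩ := bmap_surjective (Ideal.Quotient.mkₐ_surjective L 𝔪) Y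
  rw [← hπ] at *
  let c : L := Fintype.card D.Γ
  have hc : c ≠ 0 := D.card_Γ_ne_zero
  -- Arbitrary lifts of the intertwiners are averaged over the finite group `Γ` to become
  -- equivariant over `A`. The reductions are unchanged, being equivariant already.
  let X₁ : Blk m d A := c⁻¹ • ∑ γ, Q γ * X₀ * Matrix.single 0 0 (D.ΓB A γ⁻¹).1
  let Y₁ : Blk m d A := c⁻¹ • ∑ γ, Matrix.single 0 0 (D.ΓB A γ).1 * Y₀ * Q γ⁻¹
  have e1 : ∀ γ, (D.ΓB (A ⧸ 𝔪) γ).1 * (D.ΓB (A ⧸ 𝔪) γ⁻¹).1 = 1 := fun γ => by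
    rw [← Units.val_mul, ← map_mul, mul_inv_cancel, map_one, Units.val_one]
  have hX₁ : bmap m d π X₁ = bmap m d π X₀ := by
    have h1 : ∀ γ, bmap m d π (Q γ * X₀ * Matrix.single 0 0 (D.ΓB A γ⁻¹).1) =
        bmap m d π X₀ := fun γ => by
      rw [map_mul, map_mul, hX, bmap_single, D.map_ΓB, mul_assoc, Matrix.single_mul_single_same]
      exact (congrArg (fun z => bmap m d π X₀ * Matrix.single 0 0 z) (e1 γ)).trans hX0
    rw [map_smul, map_sum, Finset.sum_congr rfl fun γ _ => h1 γ, Finset.sum_const,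
      Finset.card_univ, ← Nat.cast_smul_eq_nsmul L, inv_smul_smul₀ hc]
  have hY₁ : bmap m d π Y₁ = bmap m d π Y₀ := by
    have h1 : ∀ γ, bmap m d π (Matrix.single 0 0 (D.ΓB A γ).1 * Y₀ * Q γ⁻¹) =
        bmap m d π Y₀ := fun γ => by
      rw [map_mul, map_mul, mul_assoc, hY, bmap_single, D.map_ΓB, ← mul_assoc,
        Matrix.single_mul_single_same]
      exact (congrArg (fun z => Matrix.single 0 0 z * bmap m d π Y₀) (e1 γ)).trans hY0
    rw [map_smul, map_sum, Finset.sum_congr rfl fun γ _ => h1 γ, Finset.sum_const,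
      Finset.card_univ, ← Nat.cast_smul_eq_nsmul L, inv_smul_smul₀ hc]
  refine ⟨X₁, Y₁, D.proj B ((bmap m d ι Y₀ * G.1) 0 0), D.proj B ((G⁻¹.1 * bmap m d ι X₀) 0 0),
    D.proj_mem _, ?_, ?_, ?_⟩
  · rw [map_smul, map_sum, proj, ← Matrix.smul_single, mul_smul_comm]
    congr 1
    rw [← Matrix.singleAddMonoidHom_apply, map_sum, Finset.mul_sum]
    refine Finset.sum_congr rfl fun γ _ => ?_
    rw [map_mul, map_mul, hQ', bmap_single, D.map_ΓB, Matrix.singleAddMonoidHom_apply,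
      ← Matrix.single_mul_mul_single]
    simp only [mul_assoc]
  · rw [map_smul, map_sum, proj, ← Matrix.smul_single, smul_mul_assoc]
    congr 1
    rw [← Matrix.singleAddMonoidHom_apply, map_sum, Finset.sum_mul]
    refine Finset.sum_congr rfl fun γ _ => ?_
    rw [map_mul, map_mul, mul_assoc, hQ, bmap_single, D.map_ΓB, Matrix.singleAddMonoidHom_apply,
      ← Matrix.single_mul_mul_single]
    simp only [mul_assoc]
  · rw [map_mul, hX₁, hY₁, hYX]

theorem sum_single_diagonal {R : Type*} [CommRing R] (f : Fin m → Matrix (Fin d) (Fin d) R) :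
    ∑ i, (Matrix.single i i (f i) : Blk m d R) = Matrix.diagonal f := by
  refine Matrix.ext fun k l => ?_
  have h : (∑ i, (Matrix.single i i (f i) : Blk m d R)) k l =
      ∑ i, (Matrix.single i i (f i) : Blk m d R) k l := Matrix.sum_apply ..
  rw [h, Matrix.diagonal_apply, Finset.sum_eq_single k]
  · by_cases hkl : k = l
    · subst hkl; simp
    · rw [Matrix.single_apply_of_ne _ _ _ _ _ (fun h => hkl h.2), if_neg hkl]
  · intro i _ hi
    exact Matrix.single_apply_of_ne _ _ _ _ _ fun h => hi h.1
  · simp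

include hι hρ hT in
/-- A family of block matrices which becomes standard over an extension is locally conjugate
to a standard one. -/
theorem exists_conj_diagonal (𝔪 : Ideal A) [𝔪.IsMaximal] : ∃ (G' : Blk m d A) (j : Fin m → B)
    (z : Matrix (Fin d) (Fin d) B), bdet G' ∉ 𝔪 ∧ z ∈ D.commutant B ∧
    bmap m d ι G' = G.1 * Matrix.diagonal fun i => j i • z := by
  obtain ⟨X, Y, y, z, hz, hX, hY, hYX⟩ := D.exists_basis hι hρ hT 𝔪
  choose u j f hf hfuj hu hj using D.exists_smul_single hι hρ hT 𝔪
  choose U hU using hu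
  choose J hJ using hj
  -- Here `X` is a basis for block `0`, and `J i`, the descended multiple of a block unit, carries
  -- it to block `i`. The matrix `H'` goes back, and modulo `𝔪` the product `H' * G'` is block
  -- diagonal with the nonzero scalars `f i`; so `G'` is invertible near `𝔪`.
  let G' : Blk m d A := ∑ i, J i * X * Matrix.single 0 i 1
  let H' : Blk m d A := ∑ i, Matrix.single i 0 1 * Y * U i
  have h1 : (1 : Matrix (Fin d) (Fin d) A).map ι = 1 := Matrix.map_one _ (map_zero _) (map_one _)
  have hG' : bmap m d ι G' = G.1 * Matrix.diagonal fun i => j i • z := by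
    rw [map_sum, ← sum_single_diagonal, Finset.mul_sum]
    refine Finset.sum_congr rfl fun i _ => ?_
    rw [map_mul, map_mul, hX, ← mul_assoc, hJ, bmap_single, h1, mul_assoc, mul_assoc,
      Matrix.single_mul_single_same, Matrix.smul_single, Matrix.single_mul_single_same,
      mul_one, smul_mul_assoc, one_mul]
  have hH' : bmap m d ι H' * G.1 = Matrix.diagonal fun i => u i • y := by
    rw [map_sum, ← sum_single_diagonal, Finset.sum_mul]
    refine Finset.sum_congr rfl fun i _ => ?_
    rw [map_mul, map_mul, mul_assoc, hU, bmap_single, h1, ← mul_assoc, mul_assoc _ _ G.1, hY,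
      Matrix.single_mul_single_same, one_mul, Matrix.smul_single, Matrix.single_mul_single_same,
      mul_smul_comm, mul_one]
  have hYX' : (bmap m d ι (Y * X)) = Matrix.single 0 0 (y * z) := by
    rw [map_mul, hX, ← mul_assoc, hY, Matrix.single_mul_single_same]
  have hHG : H' * G' = Matrix.diagonal fun i => f i • (Y * X) 0 0 := by
    refine bmap_injective hι ?_
    rw [map_mul, hG', ← mul_assoc, hH', Matrix.diagonal_mul_diagonal]
    refine Matrix.ext fun k l => ?_
    rw [bmap_apply, Matrix.diagonal_apply, Matrix.diagonal_apply]
    split_ifs with h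
    · have h2 : (f k • (Y * X) 0 0).map ι = ι (f k) • ((Y * X) 0 0).map ι :=
        Matrix.ext fun a b => map_mul ι _ _
      rw [h2, ← bmap_apply, hYX', Matrix.single_apply_same, hfuj, smul_mul_smul_comm]
    · exact (Matrix.map_zero _ (map_zero ι)).symm
  refine ⟨G', j, z, fun hmem => ?_, hz, hG'⟩
  let := Ideal.Quotient.field 𝔪
  set π := Ideal.Quotient.mkₐ L 𝔪 with hπ
  have h2 : bmap m d π (H' * G') = Matrix.diagonal fun i => π (f i) • 1 := by
    rw [hHG]
    refine Matrix.ext fun k l => ?_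
    rw [bmap_apply, Matrix.diagonal_apply, Matrix.diagonal_apply]
    split_ifs with h
    · have h2 : (f k • (Y * X) 0 0).map π = π (f k) • ((Y * X) 0 0).map π :=
        Matrix.ext fun a b => map_mul π _ _
      rw [h2, ← bmap_apply, hYX, Matrix.single_apply_same]
    · exact (Matrix.map_zero _ (map_zero π))
  have h3 : IsUnit (bmap m d π (H' * G')) := by
    rw [h2]
    have hne : ∀ i, π (f i) ≠ 0 := fun i h => hf i (Ideal.Quotient.eq_zero_iff_mem.mp h)
    refine IsUnit.of_mul_eq_one (Matrix.diagonal fun i => (π (f i))⁻¹ • 1) ?_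
    rw [Matrix.diagonal_mul_diagonal]
    simp only [smul_mul_smul_comm, one_mul, mul_inv_cancel₀ (hne _), one_smul]
    exact Matrix.diagonal_one
  have h4 := isUnit_bdet h3
  rw [← map_bdet, bdet_mul, map_mul] at h4
  have h5 : π (bdet G') = 0 := Ideal.Quotient.eq_zero_iff_mem.mpr hmem
  rw [h5, mul_zero] at h4
  exact h4.ne_zero rfl

include hι hρ hT in
/-- A family of block matrices which becomes standard over an extension is locally standard. -/
theorem isLocStd_of_injective : D.IsLocStd T := by
  have key : ∀ 𝔪 : Ideal A, 𝔪.IsMaximal → ∃ f ∉ 𝔪, D.IsStd (bmapHom (awayHom L f) T) := by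
    intro 𝔪 h𝔪
    obtain ⟨G', j, z, hdet, hz, hG'⟩ := D.exists_conj_diagonal hι hρ hT 𝔪
    refine ⟨bdet G', hdet, ?_⟩
    set f := bdet G'
    let ι' := awayMap ι f
    have hι' : Function.Injective ι' := awayMap_injective ι hι f
    let g := awayHom L (ι f)
    let := ratAlgebra L (Localization.Away (ι f))
    have hcomp : ∀ Y : Blk m d A, bmap m d ι' (bmap m d (awayHom L f) Y) =
        bmap m d g (bmap m d ι Y) := fun Y => by
      have h1 := awayMap_comp ι f
      exact Matrix.ext fun i k => Matrix.ext fun a b => DFunLike.congr_fun h1 (Y i k a b)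
    have hu : IsUnit (bmap m d (awayHom L f) G') := by
      refine isUnit_of_bdet ?_
      rw [← map_bdet]
      exact IsLocalization.Away.algebraMap_isUnit f
    obtain ⟨G'', hG''⟩ := hu
    refine D.isStd_of_conj (ι := ι') hι' (ρ := mapGL g.toRingHom ρ) (x := fun i => g (x i))
      (fun w hw => Units.ext ?_) (G := Units.map (bmap m d g : Blk m d B →* _) G) (fun w => ?_)
      G'' (j := fun i => g (j i)) (z := z.map g) (D.map_mem_commutant g hz) ?_
    · rw [← D.map_rB g, ← hρ w hw]
      rfl
    · rw [bmapHom_apply, hcomp]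
      have h2 := congrArg (bmap m d g) (hT w)
      rwa [map_mul, map_mul, D.bmap_std g (ρ' := mapGL g.toRingHom ρ) fun w => rfl] at h2
    · rw [hG'', hcomp, hG', map_mul]
      change _ = bmap m d g G.1 * _
      congr 1
      refine Matrix.ext fun k l => ?_
      rw [bmap_apply, Matrix.diagonal_apply, Matrix.diagonal_apply]
      split_ifs with h
      · exact Matrix.ext fun a b => map_mul g _ _
      · exact Matrix.map_zero _ (map_zero g)
  refine ⟨{f | D.IsStd (bmapHom (awayHom L f) T)}, ?_, fun f hf => hf⟩
  by_contra hne
  obtain ⟨𝔪, h𝔪, hle⟩ := Ideal.exists_le_maximal _ hne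
  obtain ⟨f, hf, hstd⟩ := key 𝔪 h𝔪
  exact hf (hle (Ideal.subset_span hstd))

end Descent

end TameDatum

/-! ### Smoothness of retracts and localizations -/

/-- A retract of a smooth algebra over a noetherian ring is smooth. -/
theorem smooth_of_retract {L R S : Type*} [CommRing L] [IsNoetherianRing L] [CommRing R]
    [Algebra L R] [CommRing S] [Algebra L S] [Algebra.Smooth L S] (f : R →ₐ[L] S) (g : S →ₐ[L] R)
    (h : ∀ x, g (f x) = x) : Algebra.Smooth L R where
  formallySmooth := by
    refine Algebra.FormallySmooth.of_comp_surjective fun C _ _ I hI p => ?_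
    obtain ⟨p', hp'⟩ := Algebra.FormallySmooth.comp_surjective L S I hI (p.comp g)
    refine ⟨p'.comp f, ?_⟩
    rw [← AlgHom.comp_assoc, hp']
    ext x
    simp [h]
  finitePresentation := by
    have hg : Function.Surjective g := fun x => ⟨f x, h x⟩
    exact Algebra.FinitePresentation.of_finiteType.mp
      (Algebra.FiniteType.of_surjective g hg)

theorem smooth_of_span {L R : Type u} [CommRing L] [CommRing R] [Algebra L R] (S : Set R)
    (hS : Ideal.span S = ⊤) (h : ∀ f ∈ S, Algebra.Smooth L (Localization.Away f)) :
    Algebra.Smooth L R := by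
  rw [← RingHom.smooth_algebraMap]
  refine RingHom.Smooth.ofLocalizationSpanTarget _ S hS fun f => ?_
  rw [← IsScalarTower.algebraMap_eq]
  exact RingHom.smooth_algebraMap.mpr (h f f.2)

theorem smooth_localization {L R : Type*} [CommRing L] [CommRing R] [Algebra L R]
    [Algebra.Smooth L R] (f : R) : Algebra.Smooth L (Localization.Away f) :=
  have : Algebra.Smooth R (Localization.Away f) := Algebra.Smooth.of_isLocalization_Away f
  Algebra.Smooth.comp L R _

/-! ### The universal locally standard family -/

namespace TameDatum

variable {L : Type u} {W : Type w} [Field L] [CharZero L] [Group W] {d : ℕ} (D : TameDatum L W d)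

section Universal

variable (m : ℕ)

/-- The variables: a change of basis, a matrix whose projection is the twist of Frobenius, and the
entries of the monodromy operator. -/
abbrev Param (m d : ℕ) : Type := (Fin m × Fin m × Fin d × Fin d) ⊕ (Fin d × Fin d) ⊕ Fin m

/-- The polynomial ring in the parameters. -/
abbrev ParamRing (L : Type u) [Field L] (m d : ℕ) : Type u := MvPolynomial (Param m d) L

/-- The universal change of basis. -/
def genG (L : Type u) [Field L] (m d : ℕ) : Blk m d (ParamRing L m d) := fun i j a b =>
  MvPolynomial.X (Sum.inl (i, j, a, b))

/-- The universal matrix. -/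
def genX (L : Type u) [Field L] (m d : ℕ) : Matrix (Fin d) (Fin d) (ParamRing L m d) := fun a b =>
  MvPolynomial.X (Sum.inr (Sum.inl (a, b)))

/-- The determinant to be inverted. -/
def genDet : ParamRing L m d := bdet (genG L m d) * (D.proj _ (genX L m d)).det

/-- The ring parametrizing standard discrete series with a basis. -/
abbrev StdRing : Type u := Localization.Away (D.genDet m)

theorem isUnit_genDet : IsUnit (awayHom L (D.genDet m) (D.genDet m)) :=
  IsLocalization.Away.algebraMap_isUnit _

theorem exists_stdG : ∃ G : (Blk m d (D.StdRing m))ˣ, G.1 = bmap m d (awayHom L _) (genG L m d) := by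
  have h := D.isUnit_genDet m
  rw [genDet, map_mul, map_bdet] at h
  obtain ⟨G, hG⟩ := isUnit_of_bdet (isUnit_of_mul_isUnit_left h)
  exact ⟨G, hG⟩

theorem exists_stdE : ∃ e : GL (Fin d) (D.StdRing m),
    e.1 = D.proj _ ((genX L m d).map (awayHom L (D.genDet m))) := by
  have h := D.isUnit_genDet m
  rw [genDet, map_mul] at h
  have h1 := isUnit_of_mul_isUnit_right h
  rw [AlgHom.map_det, AlgHom.mapMatrix_apply, map_proj] at h1
  obtain ⟨G, hG⟩ := (Matrix.isUnit_iff_isUnit_det _).mpr h1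
  exact ⟨G, hG⟩

/-- The universal change of basis. -/
def stdG : (Blk m d (D.StdRing m))ˣ := (D.exists_stdG m).choose

theorem stdG_val : (D.stdG m).1 = bmap m d (awayHom L _) (genG L m d) := (D.exists_stdG m).choose_spec

/-- The universal twist of Frobenius. -/
def stdE : GL (Fin d) (D.StdRing m) := (D.exists_stdE m).choose

theorem stdE_val : (D.stdE m).1 = D.proj _ ((genX L m d).map (awayHom L (D.genDet m))) :=
  (D.exists_stdE m).choose_spec

theorem stdE_mem : (D.stdE m).1 ∈ D.commutant (D.StdRing m) := by
  rw [stdE_val]; exact D.proj_mem _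

/-- The universal entries of the monodromy operator. -/
def stdX : Fin m → D.StdRing m := fun i => awayHom L _ (MvPolynomial.X (Sum.inr (Sum.inr i)))

/-- The universal standard discrete series. -/
def stdHom : W →* Blk m d (D.StdRing m) :=
  letI := ratAlgebra L (D.StdRing m)
  conjHom (D.stdG m)⁻¹ (D.std (D.rhoZero (D.stdE m) (D.stdE_mem m)) (D.stdX m))

theorem stdHom_mul (w : W) : letI := ratAlgebra L (D.StdRing m)
    D.stdHom m w * (D.stdG m).1 =
      (D.stdG m).1 * D.std (D.rhoZero (D.stdE m) (D.stdE_mem m)) (D.stdX m) w := by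
  simp [stdHom, conjHom]

instance : Algebra.Smooth L (D.StdRing m) :=
  have : Algebra.Smooth L (ParamRing L m d) := ⟨inferInstance, inferInstance⟩
  smooth_localization _

variable {m}

/-- Evaluate the variables at the entries of `G`, `e` and `x`. The projection fixes `e`, so `e`
itself serves as the matrix whose projection is prescribed. -/
theorem exists_hom_stdRing {R : Type*} [CommRing R] [Algebra L R] {T : W →* Blk m d R}
    (hT : D.IsStd T) : ∃ f : D.StdRing m →ₐ[L] R, bmapHom f (D.stdHom m) = T := by
  let := ratAlgebra L R
  let := ratAlgebra L (D.StdRing m)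
  obtain ⟨G, ρ, x, hρ, hT⟩ := hT
  obtain ⟨e, he, rfl⟩ := D.exists_eq_rhoZero hρ
  let f₀ : ParamRing L m d →ₐ[L] R := MvPolynomial.aeval
    (Sum.elim (fun p => G.1 p.1 p.2.1 p.2.2.1 p.2.2.2) (Sum.elim (fun p => e.1 p.1 p.2) x))
  have hG₀ : bmap m d f₀ (genG L m d) = G.1 :=
    Matrix.ext fun i j => Matrix.ext fun a b => MvPolynomial.aeval_X _ _
  have hX₀ : (genX L m d).map f₀ = e.1 := Matrix.ext fun a b => MvPolynomial.aeval_X _ _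
  have hu : IsUnit (f₀ (D.genDet m)) := by
    rw [genDet, map_mul, map_bdet, hG₀, AlgHom.map_det, AlgHom.mapMatrix_apply, map_proj, hX₀,
      D.proj_of_mem he]
    exact (isUnit_bdet G.isUnit).mul ((Matrix.isUnit_iff_isUnit_det _).mp e.isUnit)
  let f : D.StdRing m →ₐ[L] R := IsLocalization.Away.liftAlgHom (D.genDet m) hu
  have hf : ∀ y, f (awayHom L (D.genDet m) y) = f₀ y := fun y =>
    IsLocalization.Away.lift_eq (D.genDet m) hu y
  have hG : bmap m d f (D.stdG m).1 = G.1 := by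
    rw [stdG_val, ← hG₀]
    exact Matrix.ext fun i j => Matrix.ext fun a b => hf _
  have hE : (D.stdE m).1.map f = e.1 := by
    rw [stdE_val, map_proj, ← D.proj_of_mem he, ← hX₀]
    congr 1
    exact Matrix.ext fun a b => hf _
  have hx : (fun i => f (D.stdX m i)) = x := by
    ext i
    exact (hf _).trans (MvPolynomial.aeval_X _ _)
  refine ⟨f, MonoidHom.ext fun w => ?_⟩
  have h1 := congrArg (bmap m d f) (D.stdHom_mul m w)
  rw [map_mul, map_mul, D.bmap_std f (D.map_rhoZero f _ (D.stdE_mem m) e he hE), hG, hx, ← hT]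
    at h1
  exact (Units.mul_left_inj G).mp h1

variable (m)

/-- The polynomial ring on the matrix entries of the universal standard family, mapping to the
standard ring. -/
def entryHom : MvPolynomial (W × Fin m × Fin m × Fin d × Fin d) L →ₐ[L] D.StdRing m :=
  MvPolynomial.aeval fun p => D.stdHom m p.1 p.2.1 p.2.2.1 p.2.2.2.1 p.2.2.2.2

/-- The ring generated by the matrix entries of the universal standard family. -/
abbrev univRing : Type u := (D.entryHom m).range

theorem entryHom_X (w : W) (i j : Fin m) (a b : Fin d) :
    D.entryHom m (MvPolynomial.X (w, i, j, a, b)) = D.stdHom m w i j a b :=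
  MvPolynomial.aeval_X _ _

/-- The inclusion of the universal ring. -/
abbrev univVal : D.univRing m →ₐ[L] D.StdRing m := (D.entryHom m).range.val

theorem univVal_injective : Function.Injective (D.univVal m) := Subtype.val_injective

/-- The matrices of the universal family. -/
def univMat (w : W) : Blk m d (D.univRing m) := fun i j a b =>
  (D.entryHom m).rangeRestrict (MvPolynomial.X (w, i, j, a, b))

theorem bmap_univMat (w : W) : bmap m d (D.univVal m) (D.univMat m w) = D.stdHom m w :=
  Matrix.ext fun i j => Matrix.ext fun a b => D.entryHom_X m w i j a b

/-- The universal family. -/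
def univHom : W →* Blk m d (D.univRing m) where
  toFun := D.univMat m
  map_one' := bmap_injective (D.univVal_injective m) (by rw [bmap_univMat, map_one, map_one])
  map_mul' w w' := bmap_injective (D.univVal_injective m)
    (by rw [map_mul, bmap_univMat, bmap_univMat, bmap_univMat, map_mul])

theorem univHom_apply (w : W) (i j : Fin m) (a b : Fin d) : D.univHom m w i j a b =
    (D.entryHom m).rangeRestrict (MvPolynomial.X (w, i, j, a, b)) := rfl

theorem bmapHom_univHom : bmapHom (D.univVal m) (D.univHom m) = D.stdHom m :=
  MonoidHom.ext fun w => D.bmap_univMat m w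

/-- The family is standard over `StdRing` by construction, and `univRing` is a subring of it, so the
descent theorem applies. -/
theorem isLocStd_univHom [NeZero m] : D.IsLocStd (D.univHom m) := by
  let := ratAlgebra L (D.StdRing m)
  refine D.isLocStd_of_injective (ι := D.univVal m) (D.univVal_injective m)
    (fun w hw => D.rhoZero_I _ (D.stdE_mem m) hw) (x := D.stdX m) (G := D.stdG m) fun w => ?_
  have h := D.stdHom_mul m w
  rw [← bmap_univMat] at h
  exact h

variable {m}

theorem univHom_hom_ext {R : Type*} [CommRing R] [Algebra L R] {f g : D.univRing m →ₐ[L] R}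
    (h : bmapHom f (D.univHom m) = bmapHom g (D.univHom m)) : f = g := by
  have h1 : f.comp (D.entryHom m).rangeRestrict = g.comp (D.entryHom m).rangeRestrict := by
    refine MvPolynomial.algHom_ext fun ⟨w, i, j, a, b⟩ => ?_
    rw [AlgHom.comp_apply, AlgHom.comp_apply, ← univHom_apply]
    exact congrFun (congrFun (congrFun (congrFun (DFunLike.congr_fun h w) i) j) a) b
  refine AlgHom.ext fun y => ?_
  obtain ⟨y, rfl⟩ := (D.entryHom m).rangeRestrict_surjective y
  exact DFunLike.congr_fun h1 y

/-- On each piece of a cover the family is induced from `StdRing`, so every polynomial relation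
among the universal entries holds there. Relations that hold locally hold globally. -/
theorem exists_hom_univRing {R : Type*} [CommRing R] [Algebra L R] {T : W →* Blk m d R}
    (hT : D.IsLocStd T) : ∃ f : D.univRing m →ₐ[L] R, bmapHom f (D.univHom m) = T := by
  obtain ⟨S, hS, hT⟩ := hT
  let g : MvPolynomial (W × Fin m × Fin m × Fin d × Fin d) L →ₐ[L] R :=
    MvPolynomial.aeval fun p => T p.1 p.2.1 p.2.2.1 p.2.2.2.1 p.2.2.2.2
  have hsurj := (D.entryHom m).rangeRestrict_surjective
  have hker : ∀ y ∈ RingHom.ker (D.entryHom m).rangeRestrict, g y = 0 := by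
    intro y hy
    refine eq_of_awayHom_eq (L := L) hS fun f hf => ?_
    rw [map_zero]
    obtain ⟨k, hk⟩ := D.exists_hom_stdRing (hT f hf)
    have h1 : (awayHom L f).comp g = k.comp (D.entryHom m) := by
      refine MvPolynomial.algHom_ext fun ⟨w, i, j, a, b⟩ => ?_
      rw [AlgHom.comp_apply, AlgHom.comp_apply, MvPolynomial.aeval_X, entryHom_X]
      exact congrFun (congrFun (congrFun (congrFun (DFunLike.congr_fun hk w) i) j) a) b |>.symm
    have h2 : D.entryHom m y = 0 := congrArg Subtype.val (RingHom.mem_ker.mp hy)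
    have h3 := DFunLike.congr_fun h1 y
    rw [AlgHom.comp_apply, AlgHom.comp_apply, h2, map_zero] at h3
    exact h3
  let f : D.univRing m →ₐ[L] R := (Ideal.Quotient.liftₐ _ g hker).comp
    (Ideal.quotientKerAlgEquivOfSurjective hsurj).symm.toAlgHom
  have hf : ∀ y, f ((D.entryHom m).rangeRestrict y) = g y := fun y => by
    have h1 : (Ideal.quotientKerAlgEquivOfSurjective hsurj).symm ((D.entryHom m).rangeRestrict y) =
        Ideal.Quotient.mk _ y := by
      rw [AlgEquiv.symm_apply_eq]
      rfl
    change (Ideal.Quotient.liftₐ _ g hker) ((Ideal.quotientKerAlgEquivOfSurjective hsurj).symm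
      ((D.entryHom m).rangeRestrict y)) = g y
    rw [h1]
    rfl
  refine ⟨f, blk_hom_ext fun w i j a b => ?_⟩
  rw [bmapHom_apply_apply, univHom_apply, hf]
  exact MvPolynomial.aeval_X _ _

variable (m)

/-- The ring generated by the entries of the universal standard family is smooth. -/
theorem smooth_univRing [NeZero m] : Algebra.Smooth L (D.univRing m) := by
  obtain ⟨S, hS, h⟩ := D.isLocStd_univHom m
  refine smooth_of_span S hS fun f hf => ?_
  obtain ⟨k, hk⟩ := D.exists_hom_stdRing (h f hf)
  -- Both maps carry the universal family to its localization, and maps out of `univRing` are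
  -- determined by the entries. Thus `k` gives a retraction after localizing `StdRing` at `f`.
  have h1 : k.comp (D.univVal m) = awayHom L f := D.univHom_hom_ext (by
    rw [← bmapHom_comp, bmapHom_univHom, hk])
  have hu : IsUnit (k (D.univVal m f)) := by
    have h2 := DFunLike.congr_fun h1 f
    rw [AlgHom.comp_apply] at h2
    rw [h2]
    exact IsLocalization.Away.algebraMap_isUnit f
  let k' : Localization.Away (D.univVal m f) →ₐ[L] Localization.Away f :=
    IsLocalization.Away.liftAlgHom _ hu
  have := smooth_localization (L := L) (D.univVal m f)
  refine smooth_of_retract (awayMap (D.univVal m) f) k' fun y => ?_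
  have h3 : (k'.comp (awayMap (D.univVal m) f)) = AlgHom.id L _ := by
    refine AlgHom.coe_ringHom_injective (IsLocalization.ringHom_ext (Submonoid.powers f) ?_)
    ext y
    have h4 := DFunLike.congr_fun (awayMap_comp (D.univVal m) f) y
    have h5 : k' (awayHom L _ (D.univVal m y)) = k (D.univVal m y) :=
      IsLocalization.Away.lift_eq _ hu _
    have h6 := DFunLike.congr_fun h1 y
    rw [AlgHom.comp_apply, AlgHom.comp_apply] at h4
    rw [AlgHom.comp_apply] at h6
    change k' (awayMap _ f (awayHom L f y)) = awayHom L f y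
    rw [h4, h5, h6]
  exact DFunLike.congr_fun h3 y

end Universal

end TameDatum

/-! ### Filtrations and block triangular matrices -/

section Flags

variable {W R : Type*} [Group W] [CommRing R] {n m d : ℕ}

/-- The block matrix attached to a matrix. -/
def toBlk (R : Type*) [CommRing R] (e : Fin m × Fin d ≃ Fin n) :
    Matrix (Fin n) (Fin n) R ≃ₐ[R] Blk m d R :=
  (Matrix.reindexAlgEquiv R R e.symm).trans (Matrix.compAlgEquiv (Fin m) (Fin d) R R).symm

theorem subquotient_mk {V : Type*} [AddCommGroup V] [Module R V] {ρ : Representation R W V}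
    (A B : Subrepresentation ρ) (w : W) (x : A.toSubmodule) :
    subquotient A B w (Submodule.Quotient.mk x) =
      Submodule.Quotient.mk ⟨ρ w x, A.apply_mem_toSubmodule w x.2⟩ := rfl

/-- A filtration with graded pieces identified with twists of a fixed representation. -/
structure Flag (ρ : W →* GL (Fin n) R) (m : ℕ) (χ : W →* Rˣ) (ρ₀ : W →* GL (Fin d) R) where
  F : ℕ → Submodule R (Fin n → R)
  anti : Antitone F
  top : F 0 = ⊤
  bot : F m = ⊥
  stable : ∀ i w, ∀ v ∈ F i, (ρ w).1.mulVec v ∈ F i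
  θ : ∀ i, F i →ₗ[R] (Fin d → R)
  surj : ∀ i < m, Function.Surjective (θ i)
  ker : ∀ i < m, ∀ x : F i, θ i x = 0 ↔ x.1 ∈ F (i + 1)
  equiv : ∀ i < m, ∀ w (x : F i), θ i ⟨(ρ w).1.mulVec x, stable i w x x.2⟩ =
    (χ w : R) ^ i • (ρ₀ w).1.mulVec (θ i x)

/-- The condition defining discrete series, for a general group. -/
def HasFiltration (ρ : W →* GL (Fin n) R) (m : ℕ) (χ : W →* Rˣ) (I : Subgroup W)
    (τ : W →* GL (Fin d) R) : Prop :=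
  ∃ Fil : ℕ → Subrepresentation (toRep ρ),
    Antitone Fil ∧ (Fil 0).toSubmodule = ⊤ ∧ (Fil m).toSubmodule = ⊥ ∧
    (∀ i, ∃ C : Submodule R (Fin n → R), IsCompl (Fil i).toSubmodule C) ∧
    (∀ i < m, Nonempty ((subquotient (Fil i) (Fil (i + 1))).Equiv
      (twist (subquotient (Fil 0) (Fil 1)) (χ ^ i)))) ∧
    Nonempty (Representation.Equiv ((subquotient (Fil 0) (Fil 1)).comp I.subtype)
      ((toRep τ).comp I.subtype))

/-- Identify the first graded piece with column vectors by the inertial equivalence. The action of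
the whole group in these coordinates is `ρ₀`, and the other graded pieces are transported to its
twists. -/
theorem HasFiltration.exists_flag {ρ : W →* GL (Fin n) R} {χ : W →* Rˣ} {I : Subgroup W}
    {τ : W →* GL (Fin d) R} (h : HasFiltration ρ m χ I τ) :
    ∃ ρ₀ : W →* GL (Fin d) R, (∀ w ∈ I, ρ₀ w = τ w) ∧ Nonempty (Flag ρ m χ ρ₀) := by
  obtain ⟨Fil, hanti, htop, hbot, -, hgr, ⟨ε⟩⟩ := h
  let q := subquotient (Fil 0) (Fil 1)
  let e₀ := ε.toLinearEquiv
  let ρ₁ : W →* Matrix (Fin d) (Fin d) R :=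
    { toFun := fun w => LinearMap.toMatrix' (e₀.conj (q w))
      map_one' := by
        rw [map_one]
        change LinearMap.toMatrix' (e₀.conj LinearMap.id) = 1
        rw [LinearEquiv.conj_id, LinearMap.toMatrix'_id]
      map_mul' := fun w w' => by
        rw [map_mul]
        change LinearMap.toMatrix' (e₀.conj (q w ∘ₗ q w')) = _
        rw [LinearEquiv.conj_comp, LinearMap.toMatrix'_comp] }
  have hρ₁ : ∀ w y, (ρ₁ w).mulVec (e₀ y) = e₀ (q w y) := fun w y => by
    change (LinearMap.toMatrix' (e₀.conj (q w))).mulVec (e₀ y) = _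
    rw [LinearMap.toMatrix'_mulVec, LinearEquiv.conj_apply_apply, LinearEquiv.symm_apply_apply]
  refine ⟨ρ₁.toHomUnits, fun w hw => Units.ext ?_, ?_⟩
  · change LinearMap.toMatrix' (e₀.conj (q w)) = (τ w).1
    have h1 : e₀.conj (q w) = toRep τ w := by
      refine LinearMap.ext fun y => ?_
      rw [LinearEquiv.conj_apply_apply]
      have h2 := congrArg (fun f => f (e₀.symm y)) (ε.isIntertwining' ⟨w, hw⟩)
      have h3 : e₀ (q w (e₀.symm y)) = toRep τ w (e₀ (e₀.symm y)) := h2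
      rw [h3, LinearEquiv.apply_symm_apply]
    rw [h1]
    exact LinearMap.toMatrix'_toLin' _
  · have E := hgr
    let θ : ∀ i, (Fil i).toSubmodule →ₗ[R] (Fin d → R) := fun i =>
      if h : i < m then (e₀.toLinearMap ∘ₗ (E i h).some.toLinearEquiv.toLinearMap) ∘ₗ
        Submodule.mkQ _ else 0
    have hθ : ∀ i (h : i < m) x, θ i x =
        e₀ ((E i h).some.toLinearEquiv (Submodule.Quotient.mk x)) := fun i h x => by
      simp only [θ, dif_pos h]; rfl
    refine ⟨⟨fun i => (Fil i).toSubmodule, fun i j hij => hanti hij, htop, hbot,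
      fun i w v hv => (Fil i).apply_mem_toSubmodule w hv, θ, fun i hi y => ?_,
      fun i hi x => ?_, fun i hi w x => ?_⟩⟩
    · obtain ⟨x, hx⟩ := Submodule.Quotient.mk_surjective _
        ((E i hi).some.toLinearEquiv.symm (e₀.symm y))
      refine ⟨x, ?_⟩
      rw [hθ i hi, hx, LinearEquiv.apply_symm_apply, LinearEquiv.apply_symm_apply]
    · rw [hθ i hi, LinearEquiv.map_eq_zero_iff, LinearEquiv.map_eq_zero_iff,
        Submodule.Quotient.mk_eq_zero]
      rfl
    · rw [hθ i hi, hθ i hi]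
      have h1 := congrArg (fun f => f (Submodule.Quotient.mk x)) ((E i hi).some.isIntertwining' w)
      have h2 : (E i hi).some.toLinearEquiv
          (subquotient (Fil i) (Fil (i + 1)) w (Submodule.Quotient.mk x)) =
          (((χ ^ i) w : Rˣ) : R) •
            q w ((E i hi).some.toLinearEquiv (Submodule.Quotient.mk x)) := h1
      rw [subquotient_mk] at h2
      change e₀ _ = _ • (ρ₁ w).mulVec _
      rw [hρ₁, ← map_smul]
      congr 1

theorem Flag.hasFiltration {ρ : W →* GL (Fin n) R} {χ : W →* Rˣ} {I : Subgroup W}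
    {τ ρ₀ : W →* GL (Fin d) R} (f : Flag ρ m χ ρ₀) (hm : 0 < m) (hτ : ∀ w ∈ I, ρ₀ w = τ w)
    (hc : ∀ i, ∃ C : Submodule R (Fin n → R), IsCompl (f.F i) C) : HasFiltration ρ m χ I τ := by
  let Fil : ℕ → Subrepresentation (toRep ρ) := fun i => ⟨f.F i, fun w v hv => f.stable i w v hv⟩
  have hker : ∀ i < m, LinearMap.ker (f.θ i) = (f.F (i + 1)).submoduleOf (f.F i) := fun i hi => by
    ext x
    rw [LinearMap.mem_ker, f.ker i hi]
    rfl
  let E : ∀ i (_ : i < m), (f.F i ⧸ (f.F (i + 1)).submoduleOf (f.F i)) ≃ₗ[R] (Fin d → R) :=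
    fun i hi => (Submodule.quotEquivOfEq _ _ (hker i hi).symm).trans
      ((f.θ i).quotKerEquivOfSurjective (f.surj i hi))
  have hE : ∀ i (hi : i < m) x, E i hi (Submodule.Quotient.mk x) = f.θ i x := fun i hi x => rfl
  have hEw : ∀ i (hi : i < m) w x, E i hi (subquotient (Fil i) (Fil (i + 1)) w x) =
      (χ w : R) ^ i • (ρ₀ w).1.mulVec (E i hi x) := fun i hi w x => by
    obtain ⟨x, rfl⟩ := Submodule.Quotient.mk_surjective _ x
    exact f.equiv i hi w x
  refine ⟨Fil, f.anti, f.top, f.bot, hc, fun i hi => ⟨Representation.Equiv.mk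
    ((E i hi).trans (E 0 hm).symm) fun w => LinearMap.ext fun x => ?_⟩, ⟨Representation.Equiv.mk
    (E 0 hm) fun w => LinearMap.ext fun x => ?_⟩⟩
  · apply (E 0 hm).injective
    change E 0 hm ((E 0 hm).symm (E i hi _)) =
      E 0 hm ((((χ ^ i) w : Rˣ) : R) • subquotient (Fil 0) (Fil 1) w ((E 0 hm).symm (E i hi x)))
    rw [LinearEquiv.apply_symm_apply, map_smul, hEw i hi, hEw 0 hm, LinearEquiv.apply_symm_apply,
      pow_zero, one_smul, MonoidHom.pow_apply, Units.val_pow_eq_pow_val]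
  · change E 0 hm (subquotient (Fil 0) (Fil 1) w.1 x) = (τ w.1).1.mulVec (E 0 hm x)
    rw [hEw 0 hm, pow_zero, one_smul, hτ w.1 w.2]

/-- Each quotient map `θ i` splits because its target is free. The sum of the sections is an
isomorphism, whose matrix is a basis adapted to the filtration. -/
theorem Flag.exists_conj {ρ : W →* GL (Fin n) R} {χ : W →* Rˣ} {ρ₀ : W →* GL (Fin d) R}
    (f : Flag ρ m χ ρ₀) (e : Fin m × Fin d ≃ Fin n) : ∃ M : GL (Fin n) R, ∀ w,
      IsLower (toBlk R e (M⁻¹ * ρ w * M).1) ∧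
      ∀ i, toBlk R e (M⁻¹ * ρ w * M).1 i i = (χ w : R) ^ (i : ℕ) • (ρ₀ w).1 := by
  have hsec : ∀ i : Fin m, ∃ σ : (Fin d → R) →ₗ[R] f.F i, (f.θ i) ∘ₗ σ = LinearMap.id :=
    fun i => Module.projective_lifting_property _ _ (f.surj i i.2)
  choose σ hσ using hsec
  have hσ' : ∀ (i : Fin m) y, f.θ i (σ i y) = y := fun i y => LinearMap.congr_fun (hσ i) y
  let Φ : (Fin n → R) →ₗ[R] (Fin n → R) :=
    ∑ i : Fin m, ((f.F i).subtype ∘ₗ σ i) ∘ₗ LinearMap.funLeft R R fun a => e (i, a)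
  have hΦ : ∀ u, Φ u = ∑ i : Fin m, (σ i fun a => u (e (i, a)) : Fin n → R) := fun u => by
    simp [Φ]; rfl
  -- surjectivity by successive approximation
  have hsurj : Function.Surjective Φ := by
    have h1 : ∀ k, ∀ i, i + k = m → ∀ x ∈ f.F i, x ∈ LinearMap.range Φ := by
      intro k
      induction k with
      | zero =>
        intro i hi x hx
        rw [add_zero] at hi
        rw [hi, f.bot, Submodule.mem_bot] at hx
        rw [hx]
        exact zero_mem _
      | succ k ih =>
        intro i hi x hx
        have him : i < m := by omega
        set y := f.θ i ⟨x, hx⟩ with hy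
        let i' : Fin m := ⟨i, him⟩
        have h2 : x - (σ i' y).1 ∈ f.F (i + 1) := by
          have h3 := (f.ker i him (⟨x, hx⟩ - σ i' y)).mp (by
            rw [map_sub, ← hy, sub_eq_zero]
            exact (hσ' i' y).symm)
          exact h3
        have h4 : (σ i' y).1 ∈ LinearMap.range Φ := by
          refine ⟨fun p => if (e.symm p).1 = i' then y (e.symm p).2 else 0, ?_⟩
          rw [hΦ, Finset.sum_eq_single i']
          · simp
          · intro j _ hj
            have : (fun a => if (e.symm (e (j, a))).1 = i' then y (e.symm (e (j, a))).2 else 0) =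
                (0 : Fin d → R) := by
              ext a
              simp [hj]
            rw [this, map_zero]
            rfl
          · simp
        have h5 := add_mem (ih (i + 1) (by omega) _ h2) h4
        rwa [sub_add_cancel] at h5
    intro x
    exact h1 m 0 (by omega) x (by rw [f.top]; trivial)
  -- A surjective endomorphism of a finite free module over a commutative ring is injective.
  have hbij : Function.Bijective Φ :=
    ⟨OrzechProperty.injective_of_surjective_endomorphism Φ hsurj, hsurj⟩
  let blk : (Fin n → R) → Fin m → Fin d → R := fun u k a => u (e (k, a))
  have hΦ' : ∀ u, Φ u = ∑ i : Fin m, (σ i (blk u i) : Fin n → R) := hΦ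
  -- If the blocks before `i` vanish, the vector lies in step `i` of the filtration and its image
  -- under `θ i` is block `i`; `hA` is the converse for membership.
  have hB : ∀ (u : Fin n → R) (i : Fin m), (∀ k < i, blk u k = 0) →
      ∃ h : Φ u ∈ f.F i, f.θ i ⟨Φ u, h⟩ = blk u i := by
    intro u i hu
    have h1 : Φ u - (σ i (blk u i)).1 ∈ f.F (i + 1) := by
      rw [hΦ', ← Finset.sum_erase_eq_sub (Finset.mem_univ i)]
      refine sum_mem fun j hj => ?_
      rcases lt_or_gt_of_ne (Finset.ne_of_mem_erase hj) with h | h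
      · rw [hu j h, map_zero]
        exact zero_mem _
      · exact f.anti (Nat.succ_le_of_lt h) (σ j (blk u j)).2
    have h2 : Φ u ∈ f.F i := by
      have := add_mem (f.anti (Nat.le_succ i) h1) (σ i (blk u i)).2
      rwa [sub_add_cancel] at this
    refine ⟨h2, ?_⟩
    have h3 := (f.ker i i.2 (⟨Φ u, h2⟩ - σ i (blk u i))).mpr h1
    rwa [map_sub, hσ', sub_eq_zero] at h3
  have hA : ∀ (u : Fin n → R) (i : ℕ), Φ u ∈ f.F i → ∀ k : Fin m, (k : ℕ) < i → blk u k = 0 := by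
    intro u i hi k
    induction k using WellFoundedLT.induction with
    | ind k ih =>
      intro hk
      obtain ⟨h1, h2⟩ := hB u k fun j hj => ih j hj (lt_trans hj hk)
      rw [← h2, f.ker k k.2]
      exact f.anti (Nat.succ_le_of_lt hk) hi
  let Ψ := LinearEquiv.ofBijective Φ hbij
  have hΦΨ : Φ ∘ₗ Ψ.symm.toLinearMap = LinearMap.id :=
    LinearMap.ext fun x => Ψ.apply_symm_apply x
  have hΨΦ : Ψ.symm.toLinearMap ∘ₗ Φ = LinearMap.id :=
    LinearMap.ext fun x => Ψ.symm_apply_apply x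
  let M : GL (Fin n) R := ⟨LinearMap.toMatrix' Φ, LinearMap.toMatrix' Ψ.symm.toLinearMap,
    by rw [← LinearMap.toMatrix'_comp, hΦΨ, LinearMap.toMatrix'_id],
    by rw [← LinearMap.toMatrix'_comp, hΨΦ, LinearMap.toMatrix'_id]⟩
  have hM : ∀ u, M.1.mulVec u = Φ u := fun u => LinearMap.toMatrix'_mulVec _ _
  have hcol : ∀ w (i : Fin m) (b : Fin d), ∃ u : Fin n → R,
      (∀ k a, toBlk R e (M⁻¹ * ρ w * M).1 k i a b = blk u k a) ∧
      (∀ k < i, blk u k = 0) ∧ blk u i = (χ w : R) ^ (i : ℕ) • (ρ₀ w).1.mulVec (Pi.single b 1) := by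
    intro w i b
    let v : Fin n → R := Pi.single (e (i, b)) 1
    have hv : ∀ k, blk v k = if k = i then Pi.single b 1 else 0 := fun k => by
      ext a
      simp only [blk, v, Pi.single_apply, EmbeddingLike.apply_eq_iff_eq, Prod.mk.injEq]
      by_cases hk : k = i <;> simp [hk, Pi.single_apply]
    let u : Fin n → R := (M⁻¹ * ρ w * M).1.mulVec v
    have hu : Φ u = (ρ w).1.mulVec (Φ v) := by
      rw [← hM, ← hM, Matrix.mulVec_mulVec, Matrix.mulVec_mulVec, ← Units.val_mul, ← Units.val_mul]
      congr 2
      group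
    obtain ⟨h1, h2⟩ := hB v i fun k hk => by rw [hv, if_neg hk.ne]
    have h3 : Φ u ∈ f.F i := hu ▸ f.stable i w _ h1
    have h4 : ∀ k < i, blk u k = 0 := fun k hk => hA u i h3 k hk
    refine ⟨u, fun k a => ?_, h4, ?_⟩
    · change _ = ((M⁻¹ * ρ w * M).1.mulVec (Pi.single (e (i, b)) 1)) (e (k, a))
      rw [Matrix.mulVec_single_one]
      rfl
    · obtain ⟨h5, h6⟩ := hB u i h4
      have h7 := f.equiv i i.2 w ⟨Φ v, h1⟩
      rw [h2, hv, if_pos rfl] at h7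
      rw [← h6, ← h7]
      congr 1
      exact Subtype.ext hu
  refine ⟨M, fun w => ⟨fun i j hij => ?_, fun i => ?_⟩⟩
  · ext a b
    obtain ⟨u, h1, h2, -⟩ := hcol w j b
    rw [h1, h2 i hij]
    rfl
  · ext a b
    obtain ⟨u, h1, -, h3⟩ := hcol w i b
    rw [h1, h3, Matrix.mulVec_single_one]
    rfl

/-- In the coordinates given by `M`, step `i` consists of the vectors whose first `i` blocks vanish.
The vectors whose remaining blocks vanish form the required complement. -/
theorem exists_flag_of_conj {ρ : W →* GL (Fin n) R} {χ : W →* Rˣ} {ρ₀ : W →* GL (Fin d) R}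
    (e : Fin m × Fin d ≃ Fin n) (M : GL (Fin n) R)
    (h : ∀ w, IsLower (toBlk R e (M⁻¹ * ρ w * M).1) ∧
      ∀ i, toBlk R e (M⁻¹ * ρ w * M).1 i i = (χ w : R) ^ (i : ℕ) • (ρ₀ w).1) :
    ∃ f : Flag ρ m χ ρ₀, ∀ i, ∃ C : Submodule R (Fin n → R), IsCompl (f.F i) C := by
  let p : Fin m → (Fin n → R) →ₗ[R] (Fin d → R) := fun k =>
    (LinearMap.funLeft R R fun a => e (k, a)) ∘ₗ Matrix.toLin' M⁻¹.1
  have hp : ∀ k v a, p k v a = (M⁻¹.1.mulVec v) (e (k, a)) := fun k v a => rfl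
  -- a vector with prescribed components
  have hsec : ∀ y : Fin m → Fin d → R, ∃ v, ∀ k, p k v = y k := fun y => by
    refine ⟨M.1.mulVec fun x => y (e.symm x).1 (e.symm x).2, fun k => ?_⟩
    ext a
    rw [hp, Matrix.mulVec_mulVec, ← Units.val_mul, inv_mul_cancel, Units.val_one, Matrix.one_mulVec,
      Equiv.symm_apply_apply]
  have hinj : ∀ v, (∀ k, p k v = 0) → v = 0 := fun v hv => by
    have h1 : M⁻¹.1.mulVec v = 0 := by
      ext x
      have := congrFun (hv (e.symm x).1) (e.symm x).2
      rwa [hp, Prod.mk.eta, Equiv.apply_symm_apply] at this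
    have h2 := congrArg M.1.mulVec h1
    rwa [Matrix.mulVec_mulVec, ← Units.val_mul, mul_inv_cancel, Units.val_one, Matrix.one_mulVec,
      Matrix.mulVec_zero] at h2
  have hact : ∀ w v k, p k ((ρ w).1.mulVec v) =
      ∑ j, (toBlk R e (M⁻¹ * ρ w * M).1 k j).mulVec (p j v) := fun w v k => by
    ext a
    have h1 : M⁻¹.1.mulVec ((ρ w).1.mulVec v) =
        (M⁻¹ * ρ w * M).1.mulVec (M⁻¹.1.mulVec v) := by
      rw [Matrix.mulVec_mulVec, Matrix.mulVec_mulVec, ← Units.val_mul, ← Units.val_mul,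
        mul_inv_cancel_right]
    rw [hp, h1, Finset.sum_apply, Matrix.mulVec, dotProduct, ← e.sum_comp, Fintype.sum_prod_type]
    rfl
  let F : ℕ → Submodule R (Fin n → R) := fun i => ⨅ k : Fin m, ⨅ _ : (k : ℕ) < i, LinearMap.ker (p k)
  have hF : ∀ i v, v ∈ F i ↔ ∀ k : Fin m, (k : ℕ) < i → p k v = 0 := fun i v => by
    simp [F, Submodule.mem_iInf]
  have hrow : ∀ i w, ∀ v ∈ F i, ∀ k : Fin m, (k : ℕ) ≤ i →
      p k ((ρ w).1.mulVec v) = (χ w : R) ^ (k : ℕ) • (ρ₀ w).1.mulVec (p k v) := by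
    intro i w v hv k hk
    rw [hact, Finset.sum_eq_single k]
    · rw [(h w).2, Matrix.smul_mulVec]
    · intro j _ hj
      rcases lt_or_gt_of_ne hj with hjk | hjk
      · rw [(hF i v).mp hv j (lt_of_lt_of_le hjk hk), Matrix.mulVec_zero]
      · rw [(h w).1 k j hjk, Matrix.zero_mulVec]
    · simp
  refine ⟨⟨F, fun i j hij v hv => ?_, ?_, ?_, fun i w v hv => ?_,
    fun i => if hi : i < m then p ⟨i, hi⟩ ∘ₗ (F i).subtype else 0, fun i hi y => ?_,
    fun i hi x => ?_, fun i hi w x => ?_⟩, fun i => ?_⟩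
  · rw [hF] at hv ⊢
    exact fun k hk => hv k (lt_of_lt_of_le hk hij)
  · rw [eq_top_iff]
    exact fun v _ => (hF 0 v).mpr fun k hk => absurd hk (Nat.not_lt_zero _)
  · rw [eq_bot_iff]
    exact fun v hv => hinj v fun k => (hF m v).mp hv k k.2
  · rw [hF]
    intro k hk
    rw [hrow i w v hv k hk.le, (hF i v).mp hv k hk, Matrix.mulVec_zero, smul_zero]
  · obtain ⟨v, hv⟩ := hsec (Pi.single ⟨i, hi⟩ y)
    refine ⟨⟨v, (hF i v).mpr fun k hk => ?_⟩, ?_⟩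
    · rw [hv, Pi.single_eq_of_ne]
      exact fun h => hk.ne (congrArg Fin.val h)
    · simp only [dif_pos hi]
      exact (hv _).trans (Pi.single_eq_same _ _)
  · simp only [dif_pos hi, hF]
    constructor
    · intro hx k hk
      rcases Nat.lt_succ_iff_lt_or_eq.mp hk with hk | rfl
      · exact (hF i x).mp x.2 k hk
      · exact hx
    · intro hx
      exact hx ⟨i, hi⟩ (Nat.lt_succ_self i)
  · simp only [dif_pos hi]
    exact hrow i w x x.2 ⟨i, hi⟩ le_rfl
  · let C : Submodule R (Fin n → R) := ⨅ k : Fin m, ⨅ _ : i ≤ (k : ℕ), LinearMap.ker (p k)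
    have hC : ∀ v, v ∈ C ↔ ∀ k : Fin m, i ≤ (k : ℕ) → p k v = 0 := fun v => by
      simp [C, Submodule.mem_iInf]
    refine ⟨C, Submodule.disjoint_def.mpr fun v h1 h2 => hinj v fun k => ?_,
      codisjoint_iff.mpr (eq_top_iff.mpr fun v _ => ?_)⟩
    · rcases lt_or_ge (k : ℕ) i with hk | hk
      · exact (hF i v).mp h1 k hk
      · exact (hC v).mp h2 k hk
    · obtain ⟨v₁, h1⟩ := hsec fun k => if (k : ℕ) < i then 0 else p k v
      refine Submodule.mem_sup.mpr ⟨v₁, (hF i v₁).mpr fun k hk => ?_, v - v₁,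
        (hC _).mpr fun k hk => ?_, add_sub_cancel _ _⟩
      · rw [h1, if_pos hk]
      · rw [map_sub, h1, if_neg (not_lt.mpr hk), sub_self]

end Flags


/-! ### Discrete series over the generic fibre are the locally standard families -/

theorem exists_pow_mem_of_isOpen {G : Type*} [Group G] [TopologicalSpace G]
    [IsTopologicalGroup G] [CompactSpace G] {U : Subgroup G} (hU : IsOpen (U : Set G)) (g : G) :
    ∃ M > 0, g ^ M ∈ U := by
  have : Finite (G ⧸ U) := U.quotient_finite_of_isOpen hU
  have : U.FiniteIndex := Subgroup.finiteIndex_of_finite_quotient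
  obtain ⟨M, hM, -, h⟩ := Subgroup.exists_pow_mem_of_index_ne_zero
    (Subgroup.FiniteIndex.index_ne_zero (H := U)) g
  exact ⟨M, hM, h⟩

section Compatible

variable {OK : Type v} [CommRing OK] {K : Type w} [Field K] [Algebra OK K]
  {l : ℕ} [Fact l.Prime] {O : Type u} [CommRing O] [Algebra ℤ_[l] O] {d : ℕ}
  {φ s : Gal(AlgebraicClosure K/K)} {L : Type u} [Field L] [CharZero L] [Algebra O L]

variable (l) in
/-- The tame datum is the one attached to the Weil group and the representation `r`. -/
structure IsCompatible (r : Gal(AlgebraicClosure K/K) →* GL (Fin d) O)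
    (D : TameDatum L (weilGroup OK K φ s) d) : Prop where
  r_eq : ∀ w : weilGroup OK K φ s, D.r w = Matrix.GeneralLinearGroup.map (algebraMap O L) (r w)
  mem_P : ∀ w, w ∈ D.P ↔ w.1 ∈ wildInertia OK K
  mem_I : ∀ w, w ∈ D.I ↔ w.1 ∈ inertiaGroup OK K
  chi_eq : ∀ w, algebraMap O L (cycChar K l O w.1 : O) = D.chi w
  open_ker : ∃ U : Subgroup Gal(AlgebraicClosure K/K),
    IsOpen (U : Set Gal(AlgebraicClosure K/K)) ∧ ∀ w ∈ D.P, w.1 ∈ U → D.r w = 1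

variable [CompactSpace Gal(AlgebraicClosure K/K)]
  {r : Gal(AlgebraicClosure K/K) →* GL (Fin d) O} {D : TameDatum L (weilGroup OK K φ s) d}
  (hD : IsCompatible l r D) {m n : ℕ} [NeZero m] (e : Fin m × Fin d ≃ Fin n)

/-- The family of block matrices attached to a representation. -/
def blkHom {W R : Type*} [Group W] [CommRing R] (e : Fin m × Fin d ≃ Fin n)
    (ρ : W →* GL (Fin n) R) : W →* Blk m d R :=
  ((toBlk R e : Matrix (Fin n) (Fin n) R →* Blk m d R).comp (Units.coeHom _)).comp ρ

theorem blkHom_apply {W R : Type*} [Group W] [CommRing R] (ρ : W →* GL (Fin n) R) (w : W) :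
    blkHom e ρ w = toBlk R e (ρ w).1 := rfl

/-- The representation attached to a family of block matrices. -/
def unblkHom {W R : Type*} [Group W] [CommRing R] (e : Fin m × Fin d ≃ Fin n)
    (T : W →* Blk m d R) : W →* GL (Fin n) R :=
  (((toBlk R e).symm : Blk m d R →* Matrix (Fin n) (Fin n) R).comp T).toHomUnits

theorem blkHom_unblkHom {W R : Type*} [Group W] [CommRing R] (T : W →* Blk m d R) :
    blkHom e (unblkHom e T) = T :=
  MonoidHom.ext fun w => (toBlk R e).apply_symm_apply (T w)

theorem blkHom_injective {W R : Type*} [Group W] [CommRing R] :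
    Function.Injective (blkHom e : (W →* GL (Fin n) R) → (W →* Blk m d R)) := fun _ _ h =>
  MonoidHom.ext fun w => Units.ext ((toBlk R e).injective (DFunLike.congr_fun h w))

/-- The conjugate of a representation. -/
def conjGL {W R : Type*} [Group W] [CommRing R] (M : GL (Fin n) R) (ρ : W →* GL (Fin n) R) :
    W →* GL (Fin n) R where
  toFun w := M⁻¹ * ρ w * M
  map_one' := by simp
  map_mul' w w' := by rw [map_mul]; group

theorem blkHom_away {W R : Type*} [Group W] [CommRing R] [Algebra L R] (f : R)
    (ρ : W →* GL (Fin n) R) :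
    blkHom e (mapGL (algebraMap R (Localization.Away f)) ρ) =
      bmapHom (awayHom L f) (blkHom e ρ) := rfl

theorem blkHom_mapGL {W R R' : Type*} [Group W] [CommRing R] [CommRing R'] [Algebra L R]
    [Algebra L R'] (f : R →ₐ[L] R') (ρ : W →* GL (Fin n) R) :
    blkHom e (mapGL f.toRingHom ρ) = bmapHom f (blkHom e ρ) := rfl

section Ring

variable {R : Type*} [CommRing R] [Algebra O R] [Algebra L R] [IsScalarTower O L R]

include hD in
theorem IsCompatible.rB_eq (w : weilGroup OK K φ s) :
    ((mapGL (algebraMap O R) r).comp (weilGroup OK K φ s).subtype) w = D.rB R w := by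
  refine Units.ext (Matrix.ext fun i j => ?_)
  have h1 : (D.rB R w).1 i j = algebraMap L R ((D.r w).1 i j) := rfl
  rw [h1, hD.r_eq]
  exact IsScalarTower.algebraMap_apply O L R _

include hD in
theorem IsCompatible.chi_smul {M : Type*} [AddCommGroup M] [Module R M] [Module L M]
    [IsScalarTower L R M] (w : weilGroup OK K φ s) (i : ℕ) (x : M) :
    ((((Units.map (algebraMap O R : O →* R)).comp
      ((cycChar K l O).comp (weilGroup OK K φ s).subtype)) w : Rˣ) : R) ^ i • x =
      D.chi w ^ i • x := by
  have h1 : ((((Units.map (algebraMap O R : O →* R)).comp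
      ((cycChar K l O).comp (weilGroup OK K φ s).subtype)) w : Rˣ) : R) =
      algebraMap L R (D.chi w) := by
    rw [← hD.chi_eq, ← IsScalarTower.algebraMap_apply]
    rfl
  rw [h1, ← map_pow, algebraMap_smul]

include hD in
-- An adapted basis makes the family triangular. The open wild kernel makes wild elements act with
-- finite order, as `exists_conj_std` requires.
theorem IsCompatible.isStd {ρ : weilGroup OK K φ s →* GL (Fin n) R}
    (h : IsDiscreteSeries OK l φ s m r R ρ) (hw : HasOpenWildKernel OK φ s ρ) :
    D.IsStd (blkHom e ρ) := by
  let := ratAlgebra L R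
  have h' : HasFiltration ρ m ((Units.map (algebraMap O R : O →* R)).comp
      ((cycChar K l O).comp (weilGroup OK K φ s).subtype)) (weilInertia OK K φ s)
      ((mapGL (algebraMap O R) r).comp (weilGroup OK K φ s).subtype) := h
  obtain ⟨ρ₀, hρ₀, ⟨f⟩⟩ := h'.exists_flag
  obtain ⟨M, hM⟩ := f.exists_conj e
  let T : weilGroup OK K φ s →* Blk m d R := blkHom e (conjGL M ρ)
  have hI : ∀ w ∈ D.I, ρ₀ w = D.rB R w := fun w hw => by
    rw [← hD.rB_eq, hρ₀ w ((hD.mem_I w).mp hw)]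
  have hP : ∀ p ∈ D.P, ∃ N > 0, T p ^ N = 1 := fun p hp => by
    obtain ⟨U, hU, hUρ⟩ := hw
    obtain ⟨N, hN, hpN⟩ := exists_pow_mem_of_isOpen hU p.1
    refine ⟨N, hN, ?_⟩
    have h1 := hUρ (p ^ N) (by
      rw [Subgroup.coe_pow]
      exact pow_mem ((hD.mem_P p).mp hp) N) (by rwa [Subgroup.coe_pow])
    have h2 : conjGL M ρ (p ^ N) = 1 := by
      change M⁻¹ * ρ (p ^ N) * M = 1
      rw [h1]; group
    rw [← map_pow, blkHom_apply, h2]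
    exact map_one (toBlk R e)
  have hT : ∀ w, T w = toBlk R e (M⁻¹ * ρ w * M).1 := fun w => rfl
  have hlow : ∀ w, IsLower (T w) := fun w => by rw [hT]; exact (hM w).1
  have hdiag : ∀ w i, T w i i = D.chi w ^ (i : ℕ) • (ρ₀ w).1 := fun w i => by
    rw [hT, (hM w).2, hD.chi_smul]
  obtain ⟨G, x, hG⟩ := D.exists_conj_std hI hlow hdiag hP
  refine ⟨Units.map (toBlk R e : Matrix (Fin n) (Fin n) R →* Blk m d R) M * G, ρ₀, x, hI,
    fun w => ?_⟩
  change toBlk R e (ρ w).1 * (toBlk R e M.1 * G.1) = toBlk R e M.1 * G.1 * _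
  rw [mul_assoc _ G.1, ← hG]
  rw [hT, ← mul_assoc, ← mul_assoc, ← map_mul, ← map_mul, ← Units.val_mul, ← Units.val_mul]
  rw [show M * (M⁻¹ * ρ w * M) = ρ w * M by group]

include hD in
theorem IsCompatible.isDiscreteSeries {ρ : weilGroup OK K φ s →* GL (Fin n) R}
    (h : D.IsStd (blkHom e ρ)) : IsDiscreteSeries OK l φ s m r R ρ := by
  let := ratAlgebra L R
  obtain ⟨G, ρ₀, x, hI, hG⟩ := h
  let M : GL (Fin n) R :=
    Units.map ((toBlk R e).symm : Blk m d R →* Matrix (Fin n) (Fin n) R) G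
  have hM : toBlk R e M.1 = G.1 := (toBlk R e).apply_symm_apply G.1
  have hM' : toBlk R e M⁻¹.1 = G⁻¹.1 := (toBlk R e).apply_symm_apply G⁻¹.1
  have h1 : ∀ w, toBlk R e (M⁻¹ * ρ w * M).1 = D.std ρ₀ x w := fun w => by
    rw [Units.val_mul, Units.val_mul, map_mul, map_mul, hM, hM', mul_assoc]
    have h2 := hG w
    rw [blkHom_apply] at h2
    rw [h2, Units.inv_mul_cancel_left]
  obtain ⟨f, hf⟩ := exists_flag_of_conj (χ := (Units.map (algebraMap O R : O →* R)).comp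
      ((cycChar K l O).comp (weilGroup OK K φ s).subtype)) (ρ := ρ) (ρ₀ := ρ₀) e M (fun w => by
    rw [h1]
    refine ⟨(D.isLower_std ρ₀ x w).1, fun i => ?_⟩
    rw [hD.chi_smul]
    exact (D.isLower_std ρ₀ x w).2 i)
  have : HasFiltration ρ m ((Units.map (algebraMap O R : O →* R)).comp
      ((cycChar K l O).comp (weilGroup OK K φ s).subtype)) (weilInertia OK K φ s)
      ((mapGL (algebraMap O R) r).comp (weilGroup OK K φ s).subtype) :=
    f.hasFiltration (Nat.pos_of_ne_zero (NeZero.ne m)) (fun w hw => by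
      rw [hD.rB_eq, hI w ((hD.mem_I w).mpr hw)]) hf
  exact this

theorem isStd_P {T : weilGroup OK K φ s →* Blk m d R} (h : D.IsStd T) {p} (hp : p ∈ D.P)
    (hr : D.r p = 1) : T p = 1 := by
  let := ratAlgebra L R
  obtain ⟨G, ρ₀, x, hI, hG⟩ := h
  have h1 := hG p
  rw [D.std_P hI x hp hr, mul_one] at h1
  exact (Units.mul_left_inj G).mp (by rw [h1, one_mul])

include hD in
-- The filtration condition and standardness agree on each piece of a cover. For the open wild
-- kernel, one open subgroup coming from `r` works on all pieces, hence over `R`.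
theorem IsCompatible.mem_moduliPoints_iff {ρ : weilGroup OK K φ s →* GL (Fin n) R} :
    ρ ∈ moduliPoints OK l φ s m n r R ↔ D.IsLocStd (blkHom e ρ) := by
  constructor
  · rintro ⟨⟨U, hU, hw⟩, S, hS, h⟩
    refine ⟨S, hS, fun f hf => ?_⟩
    rw [← blkHom_away]
    refine hD.isStd e (h f hf) ⟨U, hU, fun g hg hgU => ?_⟩
    change Matrix.GeneralLinearGroup.map _ (ρ g) = 1
    rw [hw g hg hgU, map_one]
  · rintro ⟨S, hS, h⟩
    refine ⟨?_, S, hS, fun f hf => hD.isDiscreteSeries e (by rw [blkHom_away (L := L)]; exact h f hf)⟩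
    obtain ⟨U, hU, hU1⟩ := hD.open_ker
    refine ⟨U, hU, fun g hg hgU => ?_⟩
    have hp := (hD.mem_P g).mpr hg
    have hr := hU1 g hp hgU
    refine Units.ext ((toBlk R e).injective (Matrix.ext fun i j => Matrix.ext fun a b => ?_))
    refine eq_of_awayHom_eq (L := L) hS fun f hf => ?_
    have h1 := isStd_P (h f hf) hp hr
    have h2 := congrFun (congrFun (congrFun (congrFun h1 i) j) a) b
    rw [Units.val_one, map_one]
    refine Eq.trans h2 ?_
    have h3 := map_one (bmap m d (awayHom L f))
    exact (congrFun (congrFun (congrFun (congrFun h3 i) j) a) b).symm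

end Ring

end Compatible


/-! ### Representability and the scheme-theoretic generic fibre -/

section Represent

variable {OK : Type v} [CommRing OK] {K : Type w} [Field K] [Algebra OK K]
  {l : ℕ} [Fact l.Prime] {O : Type u} [CommRing O] [Algebra ℤ_[l] O] {d : ℕ}
  {φ s : Gal(AlgebraicClosure K/K)} {L : Type u} [Field L] [Algebra O L]

theorem IsCompatible.exists_represents [CharZero L] [CompactSpace Gal(AlgebraicClosure K/K)]
    {r : Gal(AlgebraicClosure K/K) →* GL (Fin d) O} {D : TameDatum L (weilGroup OK K φ s) d}
    (hD : IsCompatible l r D) {m n : ℕ} [NeZero m] (e : Fin m × Fin d ≃ Fin n) :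
    ∃ (A : Type u) (_ : CommRing A) (_ : Algebra L A) (_ : Algebra O A)
        (_ : IsScalarTower O L A), Algebra.Smooth L A ∧
        RepresentsGenericFibre OK l φ s m n r L A := by
  -- Only smoothness and the universal property of `univRing` are kept; its construction is
  -- forgotten.
  obtain ⟨A, _, _, T, hsm, hT, hext, hex⟩ : ∃ (A : Type u) (_ : CommRing A) (_ : Algebra L A)
      (T : weilGroup OK K φ s →* Blk m d A), Algebra.Smooth L A ∧ D.IsLocStd T ∧
      (∀ (R : Type u) [CommRing R] [Algebra L R] (f g : A →ₐ[L] R),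
        bmapHom f T = bmapHom g T → f = g) ∧
      ∀ (R : Type u) [CommRing R] [Algebra L R] (T' : weilGroup OK K φ s →* Blk m d R),
        D.IsLocStd T' → ∃ f : A →ₐ[L] R, bmapHom f T = T' :=
    ⟨D.univRing m, _, _, D.univHom m, D.smooth_univRing m, D.isLocStd_univHom m,
      fun R _ _ f g h => D.univHom_hom_ext h, fun R _ _ T' h => D.exists_hom_univRing h⟩
  let : Algebra O A := ((algebraMap L A).comp (algebraMap O L)).toAlgebra
  have : IsScalarTower O L A := IsScalarTower.of_algebraMap_eq fun _ => rfl
  refine ⟨A, inferInstance, inferInstance, inferInstance, inferInstance, hsm, unblkHom e T, ?_,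
    fun R _ _ _ _ => ⟨fun f _ => ?_, fun f _ g _ h => ?_, fun ρ hρ => ?_⟩⟩
  · rw [hD.mem_moduliPoints_iff (L := L) e, blkHom_unblkHom]
    exact hT
  · rw [hD.mem_moduliPoints_iff (L := L) e, blkHom_mapGL, blkHom_unblkHom]
    exact hT.map D f
  · refine hext R f g ?_
    have h1 := congrArg (blkHom e) h
    rwa [blkHom_mapGL, blkHom_mapGL, blkHom_unblkHom] at h1
  · obtain ⟨f, hf⟩ := hex R _ ((hD.mem_moduliPoints_iff (L := L) e).mp hρ)
    refine ⟨f, trivial, blkHom_injective e ?_⟩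
    change blkHom e (mapGL f.toRingHom _) = _
    rw [blkHom_mapGL, blkHom_unblkHom, hf]

end Represent

section Scheme

/-- A morphism of schemes which is bijective on points valued in affine schemes is an
isomorphism. -/
theorem isIso_of_affine_points {X Y : Scheme.{u}} (g : X ⟶ Y)
    (hinj : ∀ (R : CommRingCat.{u}) (a b : Spec R ⟶ X), a ≫ g = b ≫ g → a = b)
    (hsurj : ∀ (R : CommRingCat.{u}) (y : Spec R ⟶ Y), ∃ a : Spec R ⟶ X, a ≫ g = y) :
    IsIso g := by
  have hmono : Mono g := ⟨fun {Z} a b hab => by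
    refine Scheme.Cover.hom_ext Z.affineOpenCover.openCover _ _ fun i => ?_
    refine hinj (Z.affineOpenCover.X i) _ _ ?_
    have h := congrArg (fun t => Z.affineOpenCover.openCover.f i ≫ t) hab
    exact (Category.assoc _ _ _).trans (h.trans (Category.assoc _ _ _).symm)⟩
  have h := IsZariskiLocalAtTarget.of_openCover (P := MorphismProperty.isomorphisms Scheme)
    (f := g) Y.affineOpenCover.openCover fun i => by
      -- Over an affine chart of the target, lifting the chart gives a section of the pulled-back
      -- monomorphism, which is therefore an isomorphism.
      obtain ⟨a, ha⟩ := hsurj _ (Y.affineOpenCover.f i)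
      have hm : Mono (pullback.snd g (Y.affineOpenCover.f i)) := inferInstance
      have hs : IsSplitEpi (pullback.snd g (Y.affineOpenCover.f i)) :=
        ⟨⟨⟨pullback.lift a (𝟙 _) (by rw [ha, Category.id_comp]), pullback.lift_snd _ _ _⟩⟩⟩
      have : IsIso (pullback.snd g (Y.affineOpenCover.f i)) := isIso_of_mono_of_isSplitEpi _
      exact this
  exact h

variable {OK : Type v} [CommRing OK] {K : Type w} [Field K] [Algebra OK K]
  {l : ℕ} [Fact l.Prime] {O : Type u} [CommRing O] [Algebra ℤ_[l] O] {d m n : ℕ}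
  {φ s : Gal(AlgebraicClosure K/K)} {L : Type u} [Field L] [Algebra O L]
  {r : Gal(AlgebraicClosure K/K) →* GL (Fin d) O}
  {A : Type u} [CommRing A] [Algebra L A] [Algebra O A] [IsScalarTower O L A]

/-- The universal representation over `A` is a point of `X`, hence gives a map from the spectrum of
`A` to the fibre product. A point of the fibre product with values in `R` is an `L`-algebra
structure on `R` with an `R`-point of `X`, so this map is bijective on affine points. -/
theorem smooth_genericFibre (hA : Algebra.Smooth L A)
    (h : RepresentsGenericFibre OK l φ s m n r L A)
    {X : Scheme.{u}} (f : X ⟶ Spec (CommRingCat.of O)) (hX : IsModuliSpace OK l φ s m n r f) :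
    Smooth (pullback.snd f (Spec.map (CommRingCat.ofHom (algebraMap O L)))) := by
  obtain ⟨ρ, hρ, hbij⟩ := h
  obtain ⟨e, he⟩ := hX
  set π := Spec.map (CommRingCat.ofHom (algebraMap O L)) with hπ
  let x : PointsOver f A := (e A).symm ⟨ρ, hρ⟩
  have hx : (e A x).1 = ρ := by rw [Equiv.apply_symm_apply]
  have htow : ∀ (R : Type u) [CommRing R] [Algebra O R] [Algebra L R] [IsScalarTower O L R],
      Spec.map (CommRingCat.ofHom (algebraMap L R)) ≫ π =
        Spec.map (CommRingCat.ofHom (algebraMap O R)) := fun R _ _ _ _ => by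
    rw [hπ, ← Spec.map_comp, ← CommRingCat.ofHom_comp, ← IsScalarTower.algebraMap_eq]
  let g : Spec (CommRingCat.of A) ⟶ pullback f π :=
    pullback.lift x.1 (Spec.map (CommRingCat.ofHom (algebraMap L A))) (by rw [x.2, htow])
  have hgf : g ≫ pullback.fst f π = x.1 := pullback.lift_fst _ _ _
  have hgs : g ≫ pullback.snd f π = Spec.map (CommRingCat.ofHom (algebraMap L A)) :=
    pullback.lift_snd _ _ _
  -- the points of the source
  let pt : ∀ (R : Type u) [CommRing R] [Algebra O R] [Algebra L R] [IsScalarTower O L R],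
      (A →ₐ[L] R) → PointsOver f R := fun R _ _ _ _ k =>
    ⟨Spec.map (CommRingCat.ofHom k.toRingHom) ≫ x.1, by
      rw [Category.assoc, x.2, ← Spec.map_comp, ← CommRingCat.ofHom_comp]
      congr 2
      exact (k.restrictScalars O).comp_algebraMap⟩
  have hpt : ∀ (R : Type u) [CommRing R] [Algebra O R] [Algebra L R] [IsScalarTower O L R]
      (k : A →ₐ[L] R), (e R (pt R k)).1 = mapGL k.toRingHom ρ := fun R _ _ _ _ k => by
    rw [he A R (k.restrictScalars O) x (pt R k) rfl, hx]
    rfl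
  have hiso : IsIso g := by
    refine isIso_of_affine_points g (fun R a b hab => ?_) fun R y => ?_
    · obtain ⟨a', rfl⟩ := Spec.map_surjective a
      obtain ⟨b', rfl⟩ := Spec.map_surjective b
      have h1 := congrArg (fun t => t ≫ pullback.snd f π) hab
      have h2 := congrArg (fun t => t ≫ pullback.fst f π) hab
      simp only [Category.assoc, hgs, hgf] at h1 h2
      rw [← Spec.map_comp, ← Spec.map_comp] at h1
      have h1' := congrArg CommRingCat.Hom.hom (Spec.map_injective h1)
      -- The common composite to the spectrum of `L` gives `R` one `L`-algebra structure for which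
      -- both maps are `L`-linear.
      let : Algebra L R := (a'.hom.comp (algebraMap L A)).toAlgebra
      let : Algebra O R := ((algebraMap L R).comp (algebraMap O L)).toAlgebra
      have : IsScalarTower O L R := IsScalarTower.of_algebraMap_eq fun _ => rfl
      let ka : A →ₐ[L] R := { a'.hom with commutes' := fun c => rfl }
      let kb : A →ₐ[L] R := { b'.hom with commutes' := fun c => (RingHom.congr_fun h1' c).symm }
      have h3 : pt R ka = pt R kb := Subtype.ext h2
      have h4 : mapGL ka.toRingHom ρ = mapGL kb.toRingHom ρ := by rw [← hpt, ← hpt, h3]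
      have h5 : ka = kb := (hbij R).injOn trivial trivial h4
      have h6 : a' = b' := CommRingCat.hom_ext (congrArg AlgHom.toRingHom h5)
      rw [h6]
    · obtain ⟨ψ, hψ⟩ := Spec.map_surjective (y ≫ pullback.snd f π)
      let : Algebra L R := ψ.hom.toAlgebra
      let : Algebra O R := ((algebraMap L R).comp (algebraMap O L)).toAlgebra
      have : IsScalarTower O L R := IsScalarTower.of_algebraMap_eq fun _ => rfl
      have hψ' : Spec.map (CommRingCat.ofHom (algebraMap L R)) = y ≫ pullback.snd f π := hψ
      let y' : PointsOver f R := ⟨y ≫ pullback.fst f π, by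
        rw [Category.assoc, pullback.condition, ← Category.assoc, ← hψ']
        exact htow R⟩
      obtain ⟨k, -, hk⟩ := (hbij R).surjOn (e R y').2
      have h1 : pt R k = y' := (e R).injective (Subtype.ext (by rw [hpt]; exact hk))
      refine ⟨Spec.map (CommRingCat.ofHom k.toRingHom), pullback.hom_ext ?_ ?_⟩
      · rw [Category.assoc, hgf]
        exact congrArg Subtype.val h1
      · rw [Category.assoc, hgs, ← hψ', ← Spec.map_comp, ← CommRingCat.ofHom_comp]
        congr 2
        exact k.comp_algebraMap
  have h1 : Smooth (g ≫ pullback.snd f π) := by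
    rw [hgs, HasRingHomProperty.Spec_iff (P := @Smooth)]
    exact RingHom.smooth_algebraMap.mpr hA
  have h2 : pullback.snd f π = inv g ≫ g ≫ pullback.snd f π := (IsIso.inv_hom_id_assoc g _).symm
  rw [h2]
  infer_instance

end Scheme


/-! ### The valuation on the algebraic closure -/

section Valuation

open scoped NNReal

variable (OK : Type v) [CommRing OK] (K : Type w) [Field K] [Algebra OK K]

/-- `v` is the valuation of the algebraic closure of a local field of residue characteristic
`p`. -/
structure IsGaloisValuation (p : ℕ) (v : Valuation (AlgebraicClosure K) ℝ≥0) : Prop where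
  le_one_iff : ∀ x, v x ≤ 1 ↔ IsIntegral OK x
  map_galois : ∀ (σ : Gal(AlgebraicClosure K/K)) (x : AlgebraicClosure K), v (σ x) = v x
  map_prime_lt : v (p : AlgebraicClosure K) < 1

/-- The valuation is the spectral norm over `ℚ_[p]`. It is at most one exactly when the minimal
polynomial has integral coefficients, which is integrality because `ℤ_[p]` is integrally closed. -/
theorem exists_isGaloisValuation (p : ℕ) [Fact p.Prime] [IsDomain OK] [CharZero OK]
    [Algebra ℤ_[p] OK] [Module.Finite ℤ_[p] OK] [IsFractionRing OK K] :
    ∃ v, IsGaloisValuation OK K p v := by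
  let : Algebra ℤ_[p] K := ((algebraMap OK K).comp (algebraMap ℤ_[p] OK)).toAlgebra
  have : IsScalarTower ℤ_[p] OK K := IsScalarTower.of_algebraMap_eq fun _ => rfl
  have : CharZero K := charZero_of_injective_algebraMap (IsFractionRing.injective OK K)
  -- A nonzero kernel would be the maximal ideal and contain `p`, contradicting characteristic zero.
  have hinj : Function.Injective (algebraMap ℤ_[p] K) := by
    rw [RingHom.injective_iff_ker_eq_bot]
    by_contra h
    have hp : (RingHom.ker (algebraMap ℤ_[p] K)).IsPrime := RingHom.ker_isPrime _
    have hmax := hp.isMaximal h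
    have h1 : (p : ℤ_[p]) ∈ RingHom.ker (algebraMap ℤ_[p] K) := by
      rw [IsLocalRing.eq_maximalIdeal hmax, PadicInt.maximalIdeal_eq_span_p]
      exact Ideal.mem_span_singleton_self _
    rw [RingHom.mem_ker, map_natCast] at h1
    exact (Fact.out : p.Prime).ne_zero (Nat.cast_eq_zero.mp h1)
  let : Algebra ℚ_[p] K := (IsFractionRing.lift hinj : ℚ_[p] →+* K).toAlgebra
  have : IsScalarTower ℤ_[p] ℚ_[p] K := IsScalarTower.of_algebraMap_eq fun x =>
    (IsFractionRing.lift_algebraMap hinj x).symm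
  have : Algebra.IsAlgebraic ℤ_[p] OK := inferInstance
  have : Algebra.IsAlgebraic OK K := IsLocalization.isAlgebraic K (nonZeroDivisors OK)
  have : FaithfulSMul ℤ_[p] OK := by
    rw [faithfulSMul_iff_algebraMap_injective]
    exact Function.Injective.of_comp (f := algebraMap OK K) (by
      rw [← RingHom.coe_comp, ← IsScalarTower.algebraMap_eq]; exact hinj)
  have : Algebra.IsAlgebraic ℤ_[p] K := Algebra.IsAlgebraic.trans ℤ_[p] OK K
  have : Algebra.IsAlgebraic ℚ_[p] K :=
    (IsFractionRing.comap_isAlgebraic_iff (A := ℤ_[p]) (K := ℚ_[p]) (C := K)).mp inferInstance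
  have : Algebra.IsAlgebraic ℚ_[p] (AlgebraicClosure K) := Algebra.IsAlgebraic.trans ℚ_[p] K _
  let N : AlgebraicClosure K → ℝ := spectralNorm ℚ_[p] (AlgebraicClosure K)
  have hN0 : ∀ x, 0 ≤ N x := spectralNorm_nonneg
  have hmul : ∀ x y, N (x * y) = N x * N y := spectralAlgNorm_mul
  have hadd : ∀ x y, N (x + y) ≤ max (N x) (N y) := isNonarchimedean_spectralNorm
  let v : Valuation (AlgebraicClosure K) ℝ≥0 :=
    { toFun := fun x => ⟨N x, hN0 x⟩
      map_zero' := NNReal.eq spectralNorm_zero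
      map_one' := NNReal.eq spectralNorm_one
      map_mul' := fun x y => NNReal.eq (hmul x y)
      map_add_le_max' := fun x y => hadd x y }
  refine ⟨v, fun x => ?_, fun σ x => NNReal.eq ?_, ?_⟩
  · have h1 : v x ≤ 1 ↔ ∀ n, ‖(minpoly ℚ_[p] x).coeff n‖ ≤ 1 :=
      spectralValue_le_one_iff (minpoly.monic (Algebra.IsIntegral.isIntegral x))
    have h2 : IsIntegral OK x ↔ IsIntegral ℤ_[p] x :=
      ⟨fun h => isIntegral_trans x h, fun h => h.tower_top⟩
    rw [h1, h2]
    constructor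
    · intro h
      have hl : minpoly ℚ_[p] x ∈ Polynomial.lifts (algebraMap ℤ_[p] ℚ_[p]) := by
        rw [Polynomial.lifts_iff_coeff_lifts]
        exact fun n => ⟨⟨_, h n⟩, rfl⟩
      obtain ⟨f, hf, -, hm⟩ := Polynomial.lifts_and_degree_eq_and_monic hl
        (minpoly.monic (Algebra.IsIntegral.isIntegral x))
      refine ⟨f, hm, ?_⟩
      rw [← Polynomial.aeval_def, ← Polynomial.aeval_map_algebraMap ℚ_[p], hf, minpoly.aeval]
    · intro h n
      rw [minpoly.isIntegrallyClosed_eq_field_fractions' ℚ_[p] h,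
        Polynomial.coeff_map]
      exact ((minpoly ℤ_[p] x).coeff n).2
  · exact (spectralNorm_eq_of_equiv (σ.restrictScalars ℚ_[p]) x).symm
  · have h1 : N (algebraMap ℚ_[p] (AlgebraicClosure K) p) = ‖(p : ℚ_[p])‖ :=
      spectralNorm_extends _
    rw [map_natCast] at h1
    have h2 : N (p : AlgebraicClosure K) < 1 := by rw [h1]; exact Padic.norm_p_lt_one
    exact h2

end Valuation

/-! ### Inertia and wild inertia in terms of the valuation -/

section Properties

open scoped NNReal

variable {OK : Type v} [CommRing OK] {K : Type w} [Field K] [Algebra OK K] {p : ℕ}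
  {v : Valuation (AlgebraicClosure K) ℝ≥0} (hv : IsGaloisValuation OK K p v)
include hv

namespace IsGaloisValuation

theorem isUnit_iff (y : intBar OK K) : IsUnit y ↔ v (y : AlgebraicClosure K) = 1 := by
  have hy := (hv.le_one_iff y).mpr y.2
  constructor
  · rintro ⟨u, rfl⟩
    refine le_antisymm hy ?_
    have h1 := (hv.le_one_iff _).mpr ((u⁻¹ : (intBar OK K)ˣ) : intBar OK K).2
    have h2 := congrArg (fun t : intBar OK K => v (t : AlgebraicClosure K)) u.mul_inv
    simp only [MulMemClass.coe_mul, map_mul, OneMemClass.coe_one, map_one] at h2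
    rw [← h2]
    exact mul_le_of_le_one_right' h1
  · intro h
    have h0 : (y : AlgebraicClosure K) ≠ 0 := fun h0 => by simp [h0] at h
    have h1 : IsIntegral OK (y : AlgebraicClosure K)⁻¹ :=
      (hv.le_one_iff _).mp (by rw [map_inv₀, h, inv_one])
    exact IsUnit.of_mul_eq_one ⟨_, h1⟩ (Subtype.ext (mul_inv_cancel₀ h0))

theorem mem_maxBar (y : intBar OK K) : y ∈ maxBar OK K ↔ v (y : AlgebraicClosure K) < 1 := by
  have hy := (hv.le_one_iff y).mpr y.2
  rw [maxBar, Ideal.mem_jacobson_bot]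
  constructor
  · intro h
    refine lt_of_le_of_ne hy fun h1 => ?_
    obtain ⟨u, rfl⟩ := (hv.isUnit_iff y).mpr h1
    have h2 := h (-((u⁻¹ : (intBar OK K)ˣ) : intBar OK K))
    rw [mul_neg, Units.mul_inv, neg_add_cancel] at h2
    exact not_isUnit_zero h2
  · intro h z
    rw [hv.isUnit_iff]
    have h1 : v (y * z : AlgebraicClosure K) < 1 := by
      rw [map_mul]
      exact mul_lt_one_of_nonneg_of_lt_one_left zero_le h ((hv.le_one_iff z).mpr z.2)
    push_cast
    rw [Valuation.map_add_eq_of_lt_right v (by rwa [map_one]), map_one]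

theorem mem_wildInertia {σ : Gal(AlgebraicClosure K/K)} :
    σ ∈ wildInertia OK K ↔ ∀ x : AlgebraicClosure K, x ≠ 0 → v (σ x - x) < v x := by
  constructor
  · intro h x hx
    obtain ⟨y, hy, hxy⟩ := h x
    rw [hxy, mul_add, mul_one, add_sub_cancel_left, map_mul]
    exact mul_lt_of_lt_one_right (pos_of_ne_zero ((Valuation.ne_zero_iff _).mpr hx))
      ((hv.mem_maxBar y).mp hy)
  · intro h x
    by_cases hx : x = 0
    · exact ⟨0, zero_mem _, by simp [hx]⟩
    have h1 : v ((σ x - x) / x) < 1 := by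
      rw [map_div₀]
      exact (div_lt_one₀ (pos_of_ne_zero ((Valuation.ne_zero_iff _).mpr hx))).mpr (h x hx)
    refine ⟨⟨_, (hv.le_one_iff _).mp h1.le⟩, (hv.mem_maxBar _).mpr h1, ?_⟩
    simp only
    field_simp
    ring

theorem mem_inertiaGroup {σ : Gal(AlgebraicClosure K/K)} :
    σ ∈ inertiaGroup OK K ↔ ∀ x : AlgebraicClosure K, v x ≤ 1 → v (σ x - x) < 1 := by
  constructor
  · intro h x hx
    exact (hv.mem_maxBar _).mp (h ⟨x, (hv.le_one_iff x).mp hx⟩)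
  · intro h x
    exact (hv.mem_maxBar _).mpr (h x ((hv.le_one_iff x).mpr x.2))

theorem wildInertia_le : wildInertia OK K ≤ inertiaGroup OK K := fun σ hσ =>
  hv.mem_inertiaGroup.mpr fun x hx => by
    by_cases h0 : x = 0
    · simp [h0]
    · exact (hv.mem_wildInertia.mp hσ x h0).trans_le hx

theorem normal_wildInertia : (wildInertia OK K).Normal := ⟨fun σ hσ τ => by
  rw [hv.mem_wildInertia] at hσ ⊢
  intro x hx
  have h1 : (τ * σ * τ⁻¹) x - x = τ (σ (τ⁻¹ x) - τ⁻¹ x) := by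
    rw [map_sub]
    congr 1
    exact (τ.apply_symm_apply x).symm
  rw [h1, hv.map_galois, ← hv.map_galois τ⁻¹ x]
  exact hσ _ ((map_ne_zero_iff _ (τ⁻¹).injective).mpr hx)⟩

theorem normal_inertiaGroup : (inertiaGroup OK K).Normal := ⟨fun σ hσ τ => by
  rw [hv.mem_inertiaGroup] at hσ ⊢
  intro x hx
  have h1 : (τ * σ * τ⁻¹) x - x = τ (σ (τ⁻¹ x) - τ⁻¹ x) := by
    rw [map_sub]
    congr 1
    exact (τ.apply_symm_apply x).symm
  rw [h1, hv.map_galois]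
  exact hσ _ (by rwa [hv.map_galois])⟩

theorem map_natCast_le (k : ℕ) : v (k : AlgebraicClosure K) ≤ 1 :=
  (hv.le_one_iff _).mpr (by
    have := isIntegral_algebraMap (R := OK) (A := AlgebraicClosure K) (x := (k : OK))
    rwa [map_natCast] at this)

theorem map_natCast_eq_one {b : ℕ} (hb : b.Coprime p) : v (b : AlgebraicClosure K) = 1 := by
  refine le_antisymm (hv.map_natCast_le b) (not_lt.mp fun h => ?_)
  have h1 := Nat.gcd_eq_gcd_ab b p
  rw [hb] at h1
  have h2 : (1 : AlgebraicClosure K) = b * (b.gcdA p : ℤ) + p * (b.gcdB p : ℤ) := by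
    exact_mod_cast congrArg (Int.cast : ℤ → AlgebraicClosure K) h1
  have hi : ∀ z : ℤ, v (z : AlgebraicClosure K) ≤ 1 := fun z => (hv.le_one_iff _).mpr (by
    have := isIntegral_algebraMap (R := OK) (A := AlgebraicClosure K) (x := (z : OK))
    rwa [map_intCast] at this)
  have h3 : v (1 : AlgebraicClosure K) < 1 := by
    rw [h2]
    refine Valuation.map_add_lt _ ?_ ?_
    · rw [map_mul]
      exact mul_lt_one_of_nonneg_of_lt_one_left zero_le h (hi _)
    · rw [map_mul]
      exact mul_lt_one_of_nonneg_of_lt_one_left zero_le hv.map_prime_lt (hi _)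
  rw [map_one] at h3
  exact lt_irrefl _ h3

/-- An automorphism in the wild inertia which fixes `x` up to a power prime to `p` fixes `x`. -/
theorem apply_eq_of_pow_apply_eq {σ : Gal(AlgebraicClosure K/K)} (hσ : σ ∈ wildInertia OK K)
    {b : ℕ} (hb : b.Coprime p) {x : AlgebraicClosure K} (hx : (σ ^ b) x = x) : σ x = x := by
  have hvb := hv.map_natCast_eq_one hb
  have hb0 : (b : AlgebraicClosure K) ≠ 0 := fun h => by simp [h] at hvb
  have hpow : ∀ (i : ℕ) y, (σ ^ (i + 1)) y = σ ((σ ^ i) y) := fun i y => by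
    rw [pow_succ']; rfl
  set T := ∑ i ∈ Finset.range b, (σ ^ i) x with hT
  have hσT : σ T = T := by
    have h1 := Finset.sum_range_succ' (fun i => (σ ^ i) x) b
    rw [Finset.sum_range_succ, hx] at h1
    rw [hT, map_sum]
    simp only [← hpow]
    exact (add_right_cancel (h1.trans (by simp))).symm
  have hTi : ∀ i : ℕ, (σ ^ i) T = T := fun i => by
    induction i with
    | zero => rfl
    | succ i ih => rw [hpow, ih, hσT]
  -- The orbit sum of `z` is zero. If `z ≠ 0`, then `b * z` is minus a sum of differences `σ ^ i z -
  -- z`, each of valuation below that of `z`, whereas `b` is a unit.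
  set z := b * x - T with hz
  have hsum : ∑ i ∈ Finset.range b, (σ ^ i) z = 0 := by
    simp only [hz, map_sub, map_mul, map_natCast, hTi, Finset.sum_sub_distrib, ← Finset.mul_sum,
      Finset.sum_const, Finset.card_range, nsmul_eq_mul]
    rw [← hT, sub_self]
  have hz0 : z = 0 := by
    by_contra h0
    have h1 : (b : AlgebraicClosure K) * z = -∑ i ∈ Finset.range b, ((σ ^ i) z - z) := by
      rw [Finset.sum_sub_distrib, hsum, Finset.sum_const, Finset.card_range, nsmul_eq_mul]
      ring
    have h2 : v (b * z : AlgebraicClosure K) < v z := by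
      rw [h1, Valuation.map_neg]
      exact Valuation.map_sum_lt _ ((Valuation.ne_zero_iff _).mpr h0) fun i _ =>
        hv.mem_wildInertia.mp (pow_mem hσ i) z h0
    rw [map_mul, hvb, one_mul] at h2
    exact lt_irrefl _ h2
  have hx' : x = T / b := by
    rw [eq_div_iff hb0, mul_comm]
    exact sub_eq_zero.mp hz0
  rw [hx', map_div₀, hσT, map_natCast]

/-- Wild inertia is a pro-`p` group. -/
theorem exists_pow_prime_mem [Fact p.Prime] [IsGalois K (AlgebraicClosure K)]
    {σ : Gal(AlgebraicClosure K/K)} (hσ : σ ∈ wildInertia OK K)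
    {U : Subgroup Gal(AlgebraicClosure K/K)} (hU : IsOpen (U : Set Gal(AlgebraicClosure K/K))) :
    ∃ k : ℕ, σ ^ p ^ k ∈ U := by
  obtain ⟨E, hE, hEU⟩ := (krullTopology_mem_nhds_one_iff K (AlgebraicClosure K) _).mp
    (hU.mem_nhds U.one_mem)
  have hEo : IsOpen (E.fixingSubgroup : Set Gal(AlgebraicClosure K/K)) :=
    E.fixingSubgroup_isOpen
  obtain ⟨M, hM, hMU⟩ := exists_pow_mem_of_isOpen hEo σ
  obtain ⟨k, b, hb, rfl⟩ := Nat.exists_eq_pow_mul_and_not_dvd hM.ne' p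
    (Fact.out : p.Prime).ne_one
  refine ⟨k, hEU ?_⟩
  rw [IntermediateField.mem_fixingSubgroup_iff] at hMU
  rw [SetLike.mem_coe, IntermediateField.mem_fixingSubgroup_iff]
  intro x hx
  refine hv.apply_eq_of_pow_apply_eq (pow_mem hσ _) (b := b) ?_ ?_
  · exact ((Nat.Prime.coprime_iff_not_dvd Fact.out).mpr hb).symm
  · rw [← pow_mul]
    exact hMU x hx

end IsGaloisValuation

end Properties


/-! ### The tame relation and the cyclotomic character -/

section Tame

open scoped NNReal

variable {OK : Type v} [CommRing OK] {K : Type w} [Field K] [Algebra OK K] {p : ℕ}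
  {v : Valuation (AlgebraicClosure K) ℝ≥0} (hv : IsGaloisValuation OK K p v)

variable (OK K) in
/-- The cardinality of the residue field. -/
def residueCard : ℕ := Nat.card (OK ⧸ (maxBar OK K).under OK)

namespace IsGaloisValuation

include hv in
theorem finite_residue {φ : Gal(AlgebraicClosure K/K)} (hφ : IsFrobeniusLift OK K φ) :
    Finite (OK ⧸ (maxBar OK K).under OK) := AlgHom.IsArithFrobAt.finite_quotient hφ

include hv in
theorem maxBar_ne_top : maxBar OK K ≠ ⊤ := fun h => by
  have h1 := (hv.mem_maxBar 1).mp (h ▸ Submodule.mem_top)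
  rw [OneMemClass.coe_one, map_one] at h1
  exact lt_irrefl _ h1

include hv in
theorem two_le_residueCard {φ : Gal(AlgebraicClosure K/K)} (hφ : IsFrobeniusLift OK K φ) :
    2 ≤ residueCard OK K := by
  have := hv.finite_residue hφ
  have : Nontrivial (OK ⧸ (maxBar OK K).under OK) := Ideal.Quotient.nontrivial_iff.mpr
    (Ideal.comap_ne_top _ hv.maxBar_ne_top)
  exact Finite.one_lt_card

include hv in
theorem frobenius_sub_pow_lt {φ : Gal(AlgebraicClosure K/K)} (hφ : IsFrobeniusLift OK K φ)
    {x : AlgebraicClosure K} (hx : v x ≤ 1) : v (φ x - x ^ residueCard OK K) < 1 :=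
  (hv.mem_maxBar _).mp (hφ ⟨x, (hv.le_one_iff x).mp hx⟩)

theorem _root_.Valuation.mul_sub_mul_lt_one {F : Type*} [Field F] (v : Valuation F ℝ≥0)
    {a b a' b' : F} (ha : v a ≤ 1) (hb : v b' ≤ 1) (h : v (a - a') < 1) (h' : v (b - b') < 1) :
    v (a * b - a' * b') < 1 := by
  have h1 : a * b - a' * b' = a * (b - b') + (a - a') * b' := by ring
  rw [h1]
  refine Valuation.map_add_lt _ ?_ ?_
  · rw [map_mul, mul_comm]
    exact mul_lt_one_of_nonneg_of_lt_one_left zero_le h' ha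
  · rw [map_mul]
    exact mul_lt_one_of_nonneg_of_lt_one_left zero_le h hb

theorem _root_.Valuation.pow_sub_pow_lt_one {F : Type*} [Field F] (v : Valuation F ℝ≥0)
    {a b : F} (ha : v a ≤ 1) (hb : v b ≤ 1) (h : v (a - b) < 1) (k : ℕ) :
    v (a ^ k - b ^ k) < 1 := by
  induction k with
  | zero => simp
  | succ k ih =>
    rw [pow_succ, pow_succ]
    exact v.mul_sub_mul_lt_one (by rw [map_pow]; exact pow_le_one₀ zero_le ha) hb ih h

theorem _root_.Valuation.sub_lt_one_trans {F : Type*} [Field F] (v : Valuation F ℝ≥0)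
    {a b c : F} (h : v (a - b) < 1) (h' : v (b - c) < 1) : v (a - c) < 1 := by
  rw [← sub_add_sub_cancel a b c]
  exact Valuation.map_add_lt _ h h'

include hv in
theorem map_ratio (σ : Gal(AlgebraicClosure K/K)) {x : AlgebraicClosure K} (hx : x ≠ 0) :
    v (σ x / x) = 1 := by
  rw [map_div₀, hv.map_galois, div_self ((Valuation.ne_zero_iff _).mpr hx)]

include hv in
/-- The residue class of `σ x / x`, for `σ` in the inertia group, depends only on the valuation
of `x`. -/
theorem ratio_sub_ratio_lt {σ : Gal(AlgebraicClosure K/K)} (hσ : σ ∈ inertiaGroup OK K)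
    {x y : AlgebraicClosure K} (hx : x ≠ 0) (hy : y ≠ 0) (hxy : v x = v y) :
    v (σ x / x - σ y / y) < 1 := by
  have hu : v (x / y) = 1 := by
    rw [map_div₀, hxy, div_self ((Valuation.ne_zero_iff _).mpr hy)]
  have h1 := hv.mem_inertiaGroup.mp hσ (x / y) hu.le
  have hσy : σ y ≠ 0 := (map_ne_zero_iff _ σ.injective).mpr hy
  have h2 : σ x / x - σ y / y = (σ y / y) * ((σ (x / y) - x / y) / (x / y)) := by
    rw [map_div₀]
    field_simp
  rw [h2, map_mul, hv.map_ratio σ hy, one_mul, map_div₀, hu, div_one]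
  exact h1

include hv in
-- Modulo the maximal ideal, `σ x / x` is multiplicative in `σ` on inertia, since it does not change
-- when `x` is replaced by an element of the same valuation.
theorem pow_ratio_sub_lt {σ : Gal(AlgebraicClosure K/K)} (hσ : σ ∈ inertiaGroup OK K)
    {x : AlgebraicClosure K} (hx : x ≠ 0) (k : ℕ) :
    v ((σ ^ k) x / x - (σ x / x) ^ k) < 1 := by
  induction k with
  | zero => simp [div_self hx]
  | succ k ih =>
    have hσx : σ x ≠ 0 := (map_ne_zero_iff _ σ.injective).mpr hx
    have h1 : (σ ^ (k + 1)) x / x = (σ ^ k) (σ x) / σ x * (σ x / x) := by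
      rw [div_mul_div_cancel₀ hσx, pow_succ]
      rfl
    rw [h1, pow_succ]
    refine v.mul_sub_mul_lt_one (hv.map_ratio _ hσx).le (hv.map_ratio _ hx).le ?_ (by simp)
    exact v.sub_lt_one_trans
      (hv.ratio_sub_ratio_lt (pow_mem hσ k) hσx hx (hv.map_galois σ x)) ih

include hv in
/-- A Frobenius lift acts on the tame inertia group by raising to the power `q`. -/
theorem tame_relation {φ s : Gal(AlgebraicClosure K/K)} (hφ : IsFrobeniusLift OK K φ)
    (hs : s ∈ inertiaGroup OK K) :
    (s ^ residueCard OK K)⁻¹ * (φ * s * φ⁻¹) ∈ wildInertia OK K := by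
  set q := residueCard OK K with hq
  rw [hv.mem_wildInertia]
  intro x hx
  set y := φ⁻¹ x with hy
  have hxy : x = φ y := (φ.apply_symm_apply x).symm
  have hy0 : y ≠ 0 := (map_ne_zero_iff _ (φ⁻¹).injective).mpr hx
  have h1 : v (((s ^ q)⁻¹ * (φ * s * φ⁻¹)) x - x) = v ((φ * s * φ⁻¹) x - (s ^ q) x) := by
    rw [← hv.map_galois (s ^ q) (_ - x), map_sub]
    congr 2
    exact (s ^ q).apply_symm_apply _
  have h2 : (φ * s * φ⁻¹) x = φ (s y) := rfl
  have h3 : φ (s y) / x = φ (s y / y) := by rw [map_div₀, ← hxy]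
  -- With `x = φ y`, the residue of `φ (s y / y)` is the `q`-th power of that of `s y / y`, hence of
  -- `s x / x`, and so equals that of `(s ^ q) x / x`.
  have h4 : v (φ (s y) / x - (s ^ q) x / x) < 1 := by
    rw [h3]
    refine v.sub_lt_one_trans (hv.frobenius_sub_pow_lt hφ (hv.map_ratio s hy0).le) ?_
    refine v.sub_lt_one_trans (v.pow_sub_pow_lt_one (hv.map_ratio s hy0).le
      (hv.map_ratio s hx).le (hv.ratio_sub_ratio_lt hs hy0 hx (hv.map_galois _ _)) _) ?_
    rw [← Valuation.map_neg, neg_sub]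
    exact hv.pow_ratio_sub_lt hs hx q
  rw [h1, h2]
  rwa [← sub_div, map_div₀,
    div_lt_one₀ (pos_of_ne_zero ((Valuation.ne_zero_iff _).mpr hx))] at h4

include hv in
theorem mem_inertiaGroup_of_isTameGenerator {s : Gal(AlgebraicClosure K/K)}
    (hs : IsTameGenerator OK K s) : s ∈ inertiaGroup OK K := by
  rw [IsTameGenerator] at hs
  rw [← hs]
  exact Subgroup.le_topologicalClosure _
    (Subgroup.mem_sup_left (Subgroup.subset_closure rfl))

include hv in
/-- Roots of unity of order prime to the residue characteristic which are congruent are equal. -/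
theorem eq_of_pow_eq_one {a b : AlgebraicClosure K} {m : ℕ} (hm : m.Coprime p) (hm0 : m ≠ 0)
    (ha : a ^ m = 1) (hb : b ^ m = 1) (h : v (a - b) < 1) : a = b := by
  have hb0 : b ≠ 0 := fun h0 => by simp [h0, hm0] at hb
  have hvb : v b = 1 := by
    have h1 := congrArg v hb
    rw [map_pow, map_one] at h1
    exact (pow_eq_one_iff_of_nonneg zero_le hm0).mp h1
  set ξ := a / b with hξ
  have h1 : ξ ^ m = 1 := by rw [hξ, div_pow, ha, hb, div_one]
  have h2 : v (ξ - 1) < 1 := by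
    have : ξ - 1 = (a - b) / b := by rw [hξ]; field_simp
    rw [this, map_div₀, hvb, div_one]
    exact h
  have h3 : v ξ = 1 := by
    have h1 := congrArg v h1
    rw [map_pow, map_one] at h1
    exact (pow_eq_one_iff_of_nonneg zero_le hm0).mp h1
  by_contra hab
  have hξ1 : ξ - 1 ≠ 0 := fun h0 => hab (by
    rw [sub_eq_zero, hξ, div_eq_one_iff_eq hb0] at h0
    exact h0)
  -- If `ξ ≠ 1` its geometric sum vanishes; but each term is congruent to `1`, so the integer `m`
  -- would lie in the maximal ideal.
  have h4 : ∑ i ∈ Finset.range m, ξ ^ i = 0 := by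
    have := geom_sum_mul ξ m
    rw [h1, sub_self] at this
    exact (mul_eq_zero.mp this).resolve_right hξ1
  have h5 : (m : AlgebraicClosure K) = -∑ i ∈ Finset.range m, (ξ ^ i - 1 ^ i) := by
    rw [Finset.sum_sub_distrib, h4]
    simp
  have h6 : v (m : AlgebraicClosure K) < 1 := by
    rw [h5, Valuation.map_neg]
    exact Valuation.map_sum_lt _ one_ne_zero fun i _ =>
      v.pow_sub_pow_lt_one h3.le (map_one v).le h2 i
  rw [hv.map_natCast_eq_one hm] at h6
  exact lt_irrefl _ h6

include hv in
/-- An automorphism acting on the residue field as the `k`-th power has cyclotomic character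
`k`. -/
theorem cycChar_eq [CharZero K] {l : ℕ} [Fact l.Prime] [Fact p.Prime] (hpl : p ≠ l)
    {O : Type*} [CommRing O] [Algebra ℤ_[l] O] {σ : Gal(AlgebraicClosure K/K)} {k : ℕ}
    (h : ∀ x : AlgebraicClosure K, v x ≤ 1 → v (σ x - x ^ k) < 1) :
    (cycChar K l O σ : O) = k := by
  have hcop : ∀ n, (l ^ n).Coprime p := fun n =>
    Nat.Coprime.pow_left n ((Nat.coprime_primes Fact.out Fact.out).mpr hpl.symm)
  have hl0 : l ≠ 0 := (Fact.out : l.Prime).ne_zero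
  have hne : ∀ i : ℕ, NeZero ((l ^ i : ℕ) : AlgebraicClosure K) := fun i =>
    ⟨by exact_mod_cast pow_ne_zero i hl0⟩
  have key : ((cyclotomicCharacter (AlgebraicClosure K) l (MulSemiringAction.toRingAut
      Gal(AlgebraicClosure K/K) (AlgebraicClosure K) σ) : ℤ_[l]ˣ) : ℤ_[l]) = k := by
    refine PadicInt.ext_of_toZModPow.mp fun n => ?_
    obtain ⟨ζ, hζ⟩ := HasEnoughRootsOfUnity.exists_primitiveRoot (AlgebraicClosure K) (l ^ n)
    have h1 := cyclotomicCharacter.spec l (MulSemiringAction.toRingAut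
      Gal(AlgebraicClosure K/K) (AlgebraicClosure K) σ) ζ hζ.pow_eq_one
    have hvζ : v ζ ≤ 1 := by
      have h2 := congrArg v hζ.pow_eq_one
      rw [map_pow, map_one] at h2
      exact ((pow_eq_one_iff_of_nonneg zero_le (pow_ne_zero n hl0)).mp h2).le
    -- Both sides are congruent roots of unity of order prime to `p`, so they are equal.
    have h2 : σ ζ = ζ ^ k := by
      refine hv.eq_of_pow_eq_one (hcop n) (pow_ne_zero n hl0) ?_ ?_ (h ζ hvζ)
      · rw [← map_pow, hζ.pow_eq_one, map_one]
      · rw [← pow_mul, mul_comm, pow_mul, hζ.pow_eq_one, one_pow]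
    have h3 : ζ ^ k = _ := h2.symm.trans h1
    rw [map_natCast]
    generalize (PadicInt.toZModPow (p := l) n) _ = c at h3 ⊢
    have hζ0 : ζ ≠ 0 := hζ.ne_zero (pow_ne_zero n hl0)
    have h4 : ζ ^ ((k : ℤ) - (c.val : ℤ)) = 1 := by
      rw [zpow_sub₀ hζ0, zpow_natCast, zpow_natCast, h3, div_self (pow_ne_zero _ hζ0)]
    have h5 : ((k : ℤ) : ZMod (l ^ n)) = ((c.val : ℤ) : ZMod (l ^ n)) := by
      rw [ZMod.intCast_eq_intCast_iff_dvd_sub, ← neg_sub, dvd_neg]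
      exact (hζ.zpow_eq_one_iff_dvd _).mp h4
    rw [Int.cast_natCast, Int.cast_natCast] at h5
    rw [h5, ZMod.natCast_val, ZMod.cast_id', id]
  change algebraMap ℤ_[l] O _ = _
  have h5 := congrArg (algebraMap ℤ_[l] O) key
  rw [map_natCast] at h5
  exact h5

end IsGaloisValuation

end Tame


/-! ### Groups generated by a Frobenius element and a tame generator -/

section TameGroup

variable {Q : Type*} [Group Q] {φ s : Q} {q : ℕ}

theorem pow_mul_zpow_of_conj (h : φ * s * φ⁻¹ = s ^ q) (a : ℕ) (b : ℤ) :
    φ ^ a * s ^ b = s ^ (b * (q : ℤ) ^ a) * φ ^ a := by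
  induction a generalizing b with
  | zero => simp
  | succ a ih =>
    have h1 : φ * s ^ b = s ^ (b * q) * φ := by
      rw [← eq_mul_inv_iff_mul_eq, mul_assoc, mul_comm b, zpow_mul, zpow_natCast, ← h, conj_zpow]
      group
    rw [pow_succ, mul_assoc, h1, ← mul_assoc, ih, mul_assoc, ← pow_succ, mul_assoc b, ← pow_succ']

theorem zpow_mul_inv_pow_of_conj (h : φ * s * φ⁻¹ = s ^ q) (a : ℕ) (b : ℤ) :
    s ^ b * (φ ^ a)⁻¹ = (φ ^ a)⁻¹ * s ^ (b * (q : ℤ) ^ a) := by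
  rw [mul_inv_eq_iff_eq_mul, mul_assoc, ← pow_mul_zpow_of_conj h, inv_mul_cancel_left]

/-- Left multiplication by a generator or its inverse preserves the shape, since positive powers of
Frobenius move past `s` at the cost of powers of `q` in the exponent. -/
theorem exists_normalForm (h : φ * s * φ⁻¹ = s ^ q) {g : Q}
    (hg : g ∈ Subgroup.closure {φ, s}) :
    ∃ (a : ℕ) (b : ℤ) (c : ℕ), g = (φ ^ a)⁻¹ * s ^ b * φ ^ c := by
  have hs : ∀ (e : ℤ) (y : Q), (∃ (a : ℕ) (b : ℤ) (c : ℕ), y = (φ ^ a)⁻¹ * s ^ b * φ ^ c) →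
      ∃ (a : ℕ) (b : ℤ) (c : ℕ), s ^ e * y = (φ ^ a)⁻¹ * s ^ b * φ ^ c := by
    rintro e y ⟨a, b, c, rfl⟩
    refine ⟨a, e * (q : ℤ) ^ a + b, c, ?_⟩
    rw [← mul_assoc, ← mul_assoc, zpow_mul_inv_pow_of_conj h, zpow_add]
    group
  induction hg using Subgroup.closure_induction_left with
  | one => exact ⟨0, 0, 0, by simp⟩
  | mul_left x hx y _ ih =>
    rcases hx with rfl | hx
    · obtain ⟨a, b, c, rfl⟩ := ih
      cases a with
      | zero =>
        refine ⟨0, b * q, c + 1, ?_⟩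
        have h1 := pow_mul_zpow_of_conj h 1 b
        simp only [pow_one] at h1
        rw [pow_zero, inv_one, one_mul, one_mul, ← mul_assoc, h1, mul_assoc, ← pow_succ']
      | succ a =>
        refine ⟨a, b, c, ?_⟩
        rw [pow_succ]
        group
    · rw [Set.mem_singleton_iff.mp hx]
      have := hs 1 y ih
      rwa [zpow_one] at this
  | inv_mul_cancel x hx y _ ih =>
    rcases hx with rfl | hx
    · obtain ⟨a, b, c, rfl⟩ := ih
      refine ⟨a + 1, b, c, ?_⟩
      rw [pow_succ]
      group
    · rw [Set.mem_singleton_iff.mp hx]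
      have := hs (-1) y ih
      rwa [zpow_neg_one] at this

/-- The tame cocycle of a group in normal form. -/
theorem exists_tameCocycle {L : Type*} [Field L] (hq : (q : L) ≠ 0)
    (h : φ * s * φ⁻¹ = s ^ q)
    (form : ∀ g : Q, ∃ (a : ℕ) (b : ℤ) (c : ℕ), g = (φ ^ a)⁻¹ * s ^ b * φ ^ c)
    (v : Q →* Multiplicative ℤ) (hvφ : v φ = Multiplicative.ofAdd 1) (hvs : v s = 1)
    (hs : ∀ j : ℕ, 0 < j → s ^ j ≠ 1) :
    ∃ t : Q → L, (∀ g g', t (g * g') = (q : L) ^ (-(v g').toAdd) * t g + t g') ∧ t φ = 0 ∧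
      t s = 1 := by
  have hv : ∀ (a : ℕ) (b : ℤ) (c : ℕ),
      (v ((φ ^ a)⁻¹ * s ^ b * φ ^ c)).toAdd = (c : ℤ) - a := fun a b c => by
    simp only [map_mul, map_inv, map_pow, map_zpow, hvφ, hvs, toAdd_mul, toAdd_inv, toAdd_pow,
      toAdd_zpow, toAdd_ofAdd, toAdd_one]
    simp only [smul_eq_mul, nsmul_eq_mul, mul_one, mul_zero, add_zero]
    ring
  have hinj : ∀ i j : ℤ, s ^ i = s ^ j → i = j := fun i j hij => by
    have h0 : orderOf s = 0 := by
      rw [orderOf_eq_zero_iff']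
      exact fun n hn => hs n hn
    rw [zpow_eq_zpow_iff_modEq, h0] at hij
    exact Int.modEq_zero_iff.mp (by exact_mod_cast hij)
  -- The normal form is not unique: both Frobenius exponents may be raised by `k` if the exponent of
  -- `s` is multiplied by `q ^ k`.
  have hup : ∀ (a : ℕ) (b : ℤ) (c k : ℕ), (φ ^ a)⁻¹ * s ^ b * φ ^ c =
      (φ ^ (a + k))⁻¹ * s ^ (b * (q : ℤ) ^ k) * φ ^ (c + k) := fun a b c k => by
    have h1 := pow_mul_zpow_of_conj h k b
    have h2 : s ^ (b * (q : ℤ) ^ k) = φ ^ k * s ^ b * (φ ^ k)⁻¹ := by rw [h1, mul_inv_cancel_right]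
    rw [h2, pow_add, pow_add]
    have h3 : φ ^ c * φ ^ k = φ ^ k * φ ^ c := by rw [← pow_add, ← pow_add, add_comm]
    have h4 : φ ^ a * φ ^ k = φ ^ k * φ ^ a := by rw [← pow_add, ← pow_add, add_comm]
    rw [h3, h4]
    group
  -- The valuation fixes `c - a`, so two normal forms can be brought to the same Frobenius
  -- exponents; infinite order of `s` then makes `b / q ^ c` well defined. This ratio is the
  -- cocycle.
  have hwd : ∀ (a : ℕ) (b : ℤ) (c a' : ℕ) (b' : ℤ) (c' : ℕ),
      (φ ^ a)⁻¹ * s ^ b * φ ^ c = (φ ^ a')⁻¹ * s ^ b' * φ ^ c' →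
      (b : L) / (q : L) ^ c = (b' : L) / (q : L) ^ c' := by
    intro a b c a' b' c' heq
    have h1 : (c : ℤ) - a = c' - a' := by rw [← hv a b c, ← hv a' b' c', heq]
    have h2 : c + a' = c' + a := by omega
    rw [hup a b c a', hup a' b' c' a, h2, add_comm a' a] at heq
    have h3 := hinj _ _ (mul_left_cancel (mul_right_cancel heq))
    have h4 : (b : L) * (q : L) ^ a' = b' * (q : L) ^ a := by exact_mod_cast congrArg (Int.cast : ℤ → L) h3
    have h5 : (b : L) / (q : L) ^ c = (b * (q : L) ^ a') / (q : L) ^ (c + a') := by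
      rw [pow_add, mul_div_mul_right _ _ (pow_ne_zero _ hq)]
    rw [h5, h4, h2, pow_add, mul_div_mul_right _ _ (pow_ne_zero _ hq)]
  choose A B C hABC using form
  let t : Q → L := fun g => (B g : L) / (q : L) ^ C g
  have ht : ∀ (a : ℕ) (b : ℤ) (c : ℕ), t ((φ ^ a)⁻¹ * s ^ b * φ ^ c) = (b : L) / (q : L) ^ c :=
    fun a b c => hwd _ _ _ _ _ _ (hABC _).symm
  refine ⟨t, fun g g' => ?_, ?_, ?_⟩
  · obtain ⟨a, b, c, rfl⟩ : ∃ (a : ℕ) (b : ℤ) (c : ℕ), g = (φ ^ a)⁻¹ * s ^ b * φ ^ c :=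
      ⟨_, _, _, hABC g⟩
    obtain ⟨a', b', c', rfl⟩ : ∃ (a : ℕ) (b : ℤ) (c : ℕ), g' = (φ ^ a)⁻¹ * s ^ b * φ ^ c :=
      ⟨_, _, _, hABC g'⟩
    have h1 : (φ ^ a)⁻¹ * s ^ b * φ ^ c * ((φ ^ a')⁻¹ * s ^ b' * φ ^ c') =
        (φ ^ (a' + a))⁻¹ * s ^ (b * (q : ℤ) ^ a' + b' * (q : ℤ) ^ c) * φ ^ (c + c') := by
      have e1 : φ ^ c * (φ ^ a')⁻¹ = (φ ^ a')⁻¹ * φ ^ c := by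
        rw [mul_inv_eq_iff_eq_mul, mul_assoc, ← pow_add, add_comm, pow_add, inv_mul_cancel_left]
      calc _ = (φ ^ a)⁻¹ * s ^ b * (φ ^ c * (φ ^ a')⁻¹) * (s ^ b' * φ ^ c') := by group
        _ = (φ ^ a)⁻¹ * (s ^ b * (φ ^ a')⁻¹) * (φ ^ c * s ^ b') * φ ^ c' := by rw [e1]; group
        _ = _ := by
          rw [zpow_mul_inv_pow_of_conj h, pow_mul_zpow_of_conj h, pow_add, pow_add, zpow_add]
          group
    rw [h1, ht, ht, ht, hv]
    push_cast
    rw [neg_sub, zpow_sub₀ hq, zpow_natCast, zpow_natCast, pow_add]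
    have h2 := pow_ne_zero c hq
    have h3 := pow_ne_zero c' hq
    field_simp
  · have := ht 0 0 1
    simpa using this
  · have := ht 0 1 0
    simpa using this

variable {W : Type*} [Group W] {P : Subgroup W} [P.Normal] {φ s : W}

theorem exists_normalForm_mod (h : (s ^ q)⁻¹ * (φ * s * φ⁻¹) ∈ P) {g : W}
    (hg : g ∈ Subgroup.closure {φ, s} ⊔ P) :
    ∃ (a : ℕ) (b : ℤ) (c : ℕ), ∃ x ∈ P, g = (φ ^ a)⁻¹ * s ^ b * φ ^ c * x := by
  let π := QuotientGroup.mk' P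
  have h1 : π φ * π s * (π φ)⁻¹ = π s ^ q := (QuotientGroup.eq.mpr h).symm
  obtain ⟨y, hy, z, hz, rfl⟩ := Subgroup.mem_sup_of_normal_right.mp hg
  have h2 : π y ∈ Subgroup.closure {π φ, π s} := by
    have := Subgroup.mem_map_of_mem π hy
    rwa [MonoidHom.map_closure, Set.image_pair] at this
  obtain ⟨a, b, c, hb⟩ := exists_normalForm h1 h2
  have h3 : π ((φ ^ a)⁻¹ * s ^ b * φ ^ c) = π y := by simp only [map_mul, map_inv, map_pow, map_zpow, hb]
  exact ⟨a, b, c, _, P.mul_mem (QuotientGroup.eq.mp h3) hz, by group⟩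

theorem exists_tameCocycle_mod {L : Type*} [Field L] (hq : (q : L) ≠ 0)
    (h : (s ^ q)⁻¹ * (φ * s * φ⁻¹) ∈ P)
    (form : ∀ g : W, ∃ (a : ℕ) (b : ℤ) (c : ℕ), ∃ x ∈ P, g = (φ ^ a)⁻¹ * s ^ b * φ ^ c * x)
    (v : W →* Multiplicative ℤ) (hvφ : v φ = Multiplicative.ofAdd 1) (hvs : v s = 1)
    (hvP : ∀ x ∈ P, v x = 1) :
    ∃ t : W → L, (∀ g g', t (g * g') = (q : L) ^ (-(v g').toAdd) * t g + t g') ∧ t φ = 0 ∧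
      (∀ x ∈ P, t x = 0) ∧ (t s = 1 ∨ (∀ g, t g = 0) ∧ ∃ j > 0, s ^ j ∈ P) := by
  by_cases hs : ∃ j > 0, s ^ j ∈ P
  · exact ⟨fun _ => 0, fun _ _ => by simp, rfl, fun _ _ => rfl, Or.inr ⟨fun _ => rfl, hs⟩⟩
  push Not at hs
  let π := QuotientGroup.mk' P
  have h1 : π φ * π s * (π φ)⁻¹ = π s ^ q := (QuotientGroup.eq.mpr h).symm
  obtain ⟨t, ht, htφ, hts⟩ := exists_tameCocycle (φ := π φ) (s := π s) (L := L) hq h1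
    (fun g => by
      obtain ⟨g, rfl⟩ := QuotientGroup.mk'_surjective P g
      obtain ⟨a, b, c, x, hx, rfl⟩ := form g
      refine ⟨a, b, c, ?_⟩
      have hx1 : π x = 1 := (QuotientGroup.eq_one_iff x).mpr hx
      change π _ = _
      rw [map_mul, hx1, mul_one]
      simp only [map_mul, map_inv, map_pow, map_zpow])
    (QuotientGroup.lift P v hvP) hvφ hvs fun j hj h0 =>
      hs j hj ((QuotientGroup.eq_one_iff _).mp (by rw [← h0]; rfl))
  have ht1 : t 1 = 0 := by
    have := ht 1 1
    simpa using this
  refine ⟨fun g => t (π g), fun g g' => (congrArg t (map_mul π g g')).trans (ht _ _), htφ, fun x hx => ?_, Or.inl hts⟩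
  have h2 : π x = 1 := (QuotientGroup.eq_one_iff x).mpr hx
  simp only [h2, ht1]

/-- A character which is trivial on `P` and `s` and maps `φ` to `q ≥ 2` is a power of `q`. -/
theorem exists_valuation_of_character {L : Type*} [Field L] [CharZero L] (hq : 2 ≤ q)
    (form : ∀ g : W, ∃ (a : ℕ) (b : ℤ) (c : ℕ), ∃ x ∈ P, g = (φ ^ a)⁻¹ * s ^ b * φ ^ c * x)
    (χ : W →* Lˣ) (hχφ : (χ φ : L) = q) (hχs : χ s = 1) (hχP : ∀ x ∈ P, χ x = 1) :
    ∃ v : W →* Multiplicative ℤ, v φ = Multiplicative.ofAdd 1 ∧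
      (∀ g, v g = 1 ↔ χ g = 1) ∧ ∀ g, (χ g : L) = (q : L) ^ (v g).toAdd := by
  have hinj : Function.Injective (zpowersHom Lˣ (χ φ)) := by
    rw [injective_iff_map_eq_one]
    intro k hk
    rw [zpowersHom_apply] at hk
    have h1 := congrArg (Units.val) hk
    rw [Units.val_zpow_eq_zpow_val, hχφ, Units.val_one] at h1
    have h2 : ((q : ℚ) ^ k.toAdd) = 1 := by
      have : (((q : ℚ) ^ k.toAdd : ℚ) : L) = ((1 : ℚ) : L) := by push_cast; exact h1
      exact_mod_cast this
    have h3 : (1 : ℚ) < q := by exact_mod_cast hq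
    exact Multiplicative.toAdd.injective ((zpow_eq_one_iff_right₀ (by positivity) h3.ne').mp h2)
  have hmem : ∀ g, χ g ∈ (zpowersHom Lˣ (χ φ)).range := fun g => by
    obtain ⟨a, b, c, x, hx, rfl⟩ := form g
    refine ⟨Multiplicative.ofAdd ((c : ℤ) - a), ?_⟩
    rw [zpowersHom_apply, toAdd_ofAdd]
    simp only [map_mul, map_inv, map_pow, map_zpow, hχs, hχP x hx, one_zpow, mul_one]
    rw [zpow_sub, zpow_natCast, zpow_natCast, mul_comm]
  let v : W →* Multiplicative ℤ :=
    ((MonoidHom.ofInjective hinj).symm : _ →* Multiplicative ℤ).comp (χ.codRestrict _ hmem)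
  have hv : ∀ g, zpowersHom Lˣ (χ φ) (v g) = χ g := fun g =>
    congrArg Subtype.val ((MonoidHom.ofInjective hinj).apply_symm_apply ⟨χ g, hmem g⟩)
  refine ⟨v, hinj ?_, fun g => ?_, fun g => ?_⟩
  · rw [hv, zpowersHom_apply, toAdd_ofAdd, zpow_one]
  · rw [← hv g, ← map_one (zpowersHom Lˣ (χ φ)), hinj.eq_iff]
  · rw [← hv g, zpowersHom_apply, Units.val_zpow_eq_zpow_val, hχφ]

end TameGroup


/-! ### The image of wild inertia is finite -/

section Adic

variable {O : Type u} [CommRing O] {d : ℕ}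

theorem matrix_mul_mem_pow {I : Ideal O} {a b : ℕ} {X Y : Matrix (Fin d) (Fin d) O}
    (hX : ∀ i j, X i j ∈ I ^ a) (hY : ∀ i j, Y i j ∈ I ^ b) (i j : Fin d) :
    (X * Y) i j ∈ I ^ (a + b) := by
  rw [Matrix.mul_apply, pow_add]
  exact sum_mem fun k _ => Ideal.mul_mem_mul (hX i k) (hY k j)

/-- If a power of `1 + X` with exponent a unit is trivial modulo `I ^ N`, and `X` is trivial modulo
`I`, then `X` is trivial modulo `I ^ N`. -/
theorem mem_pow_of_one_add_pow {I : Ideal O} {X : Matrix (Fin d) (Fin d) O} {M : ℕ}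
    (hM : IsUnit (M : O)) (hX : ∀ i j, X i j ∈ I) {N : ℕ}
    (h : ∀ i j, ((1 + X) ^ M - 1) i j ∈ I ^ N) (i j : Fin d) : X i j ∈ I ^ N := by
  -- Expanding, `M * X` is `(1 + X) ^ M - 1` minus a multiple of `X * X`. As `M` is a unit, each
  -- pass improves the congruence by at least one power of `I`, up to `I ^ N`.
  have key : ∀ k : ℕ, ∀ i j, X i j ∈ I ^ min N (k + 1) := by
    intro k
    induction k with
    | zero => exact fun i j => Ideal.pow_le_pow_right (min_le_right _ _) (by simpa using hX i j)
    | succ k ih =>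
      intro i j
      obtain ⟨Z, hZ⟩ : ∃ Z : Matrix (Fin d) (Fin d) O,
          (1 + X) ^ M = 1 + (M : O) • X + X * X * Z := by
        clear ih h hM
        induction M with
        | zero => exact ⟨0, by simp⟩
        | succ M ih =>
          obtain ⟨Z, hZ⟩ := ih
          refine ⟨(M : O) • 1 + Z * (1 + X), ?_⟩
          rw [pow_succ, hZ]
          push_cast
          simp only [add_smul, mul_add, add_mul, one_smul, mul_one, one_mul, mul_assoc, smul_mul_assoc,
            mul_smul_comm]
          abel
      have h1 : (M : O) * X i j = ((1 + X) ^ M - 1) i j - (X * X * Z) i j := by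
        rw [hZ]
        simp only [Matrix.sub_apply, Matrix.add_apply, Matrix.smul_apply, smul_eq_mul]
        ring
      have h2 : (X * X * Z) i j ∈ I ^ (min N (k + 1) + min N (k + 1) + 0) :=
        matrix_mul_mem_pow (matrix_mul_mem_pow ih ih) (fun _ _ => by simp) i j
      rw [← Ideal.unit_mul_mem_iff_mem _ hM, h1]
      exact sub_mem (Ideal.pow_le_pow_right (min_le_left _ _) (h i j))
        (Ideal.pow_le_pow_right (by omega) h2)
  exact Ideal.pow_le_pow_right (by omega) (key N i j)

theorem isUnit_natCast_of_coprime [IsLocalRing O] {l : ℕ} [Fact l.Prime] [Algebra ℤ_[l] O]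
    {M : ℕ} (hM : M.Coprime l) : IsUnit (M : O) := by
  have h1 : IsUnit (M : ℤ_[l]) := by
    rw [PadicInt.isUnit_iff]
    have := (PadicInt.norm_natCast_eq_one_iff (p := l) (n := M)).mpr hM.symm
    exact this
  have h2 := h1.map (algebraMap ℤ_[l] O)
  rwa [map_natCast] at h2

end Adic

section WildImage

open scoped NNReal

variable {OK : Type v} [CommRing OK] {K : Type w} [Field K] [Algebra OK K] {p : ℕ} [Fact p.Prime]
  {v : Valuation (AlgebraicClosure K) ℝ≥0} (hv : IsGaloisValuation OK K p v)
  {l : ℕ} [Fact l.Prime] {O : Type u} [CommRing O] [Algebra ℤ_[l] O] {d : ℕ}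
  [IsDomain O] [IsLocalRing O] [IsNoetherianRing O] [IsGalois K (AlgebraicClosure K)]
  {r : Gal(AlgebraicClosure K/K) →* GL (Fin d) O}

include hv in
-- A wild element congruent to `1` has `p`-power powers arbitrarily close to `1`, and `p` is a unit
-- in `O`; so it is congruent to `1` modulo every power of the maximal ideal, and Krull's
-- intersection theorem finishes.
theorem IsGaloisValuation.exists_open_eq_one (hpl : p ≠ l) (hr : IsAdicContinuous K r) :
    ∃ U : Subgroup Gal(AlgebraicClosure K/K), IsOpen (U : Set Gal(AlgebraicClosure K/K)) ∧
      ∀ g ∈ wildInertia OK K, g ∈ U → r g = 1 := by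
  obtain ⟨U, hU, hU1⟩ := hr 1
  refine ⟨U, hU, fun g hg hgU => ?_⟩
  set X : Matrix (Fin d) (Fin d) O := (r g).1 - 1 with hX
  have hXm : ∀ N i j, X i j ∈ IsLocalRing.maximalIdeal O ^ N := fun N => by
    obtain ⟨V, hV, hVN⟩ := hr N
    obtain ⟨k, hk⟩ := hv.exists_pow_prime_mem hg hV
    refine mem_pow_of_one_add_pow (M := p ^ k) (isUnit_natCast_of_coprime (l := l)
      (Nat.Coprime.pow_left k ((Nat.coprime_primes Fact.out Fact.out).mpr hpl)))
      (fun i j => pow_one (IsLocalRing.maximalIdeal O) ▸ hU1 g hgU i j) fun i j => ?_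
    have h1 := hVN _ hk i j
    rw [hX, add_sub_cancel]
    rwa [map_pow, Units.val_pow_eq_pow_val] at h1
  have hX0 : X = 0 := Matrix.ext fun i j => by
    have h1 : X i j ∈ ⨅ N : ℕ, IsLocalRing.maximalIdeal O ^ N :=
      (Submodule.mem_iInf _).mpr fun N => hXm N i j
    rwa [Ideal.iInf_pow_eq_bot_of_isDomain _ (Ideal.IsPrime.ne_top inferInstance)] at h1
  exact Units.ext (sub_eq_zero.mp hX0)

/-- If a homomorphism kills the intersection of a subgroup with an open subgroup, then the subgroup
has finite image. -/
theorem finite_image_of_open_ker {G H : Type*} [Group G] [TopologicalSpace G]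
    [IsTopologicalGroup G] [CompactSpace G] [Group H] (f : G →* H) {P U : Subgroup G}
    (hU : IsOpen (U : Set G)) (h : ∀ g ∈ P, g ∈ U → f g = 1) : (f '' P).Finite := by
  have : Finite (G ⧸ U) := U.quotient_finite_of_isOpen hU
  classical
  have h1 : (f '' P) ⊆ Set.range fun x : G ⧸ U =>
      if hx : ∃ g ∈ P, (g : G ⧸ U) = x then f hx.choose else 1 := by
    rintro _ ⟨g, hg, rfl⟩
    have hx : ∃ g' ∈ P, (g' : G ⧸ U) = (g : G ⧸ U) := ⟨g, hg, rfl⟩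
    refine ⟨(g : G ⧸ U), ?_⟩
    simp only [dif_pos hx]
    have h2 := h _ (P.mul_mem (P.inv_mem hx.choose_spec.1) hg)
      (QuotientGroup.eq.mp hx.choose_spec.2)
    rw [map_mul, map_inv, inv_mul_eq_one] at h2
    exact h2
  exact (Set.finite_range _).subset h1

end WildImage


/-! ### Density of the Weil group -/

section ProfiniteAction

open scoped Pointwise

/-- An element of a profinite group acting trivially on the residue classes of the invariants of a
closed subgroup acts on the residue ring in the same way as some element of the subgroup. -/
theorem exists_mem_smul_sub_mem {B G : Type*} [CommRing B] [Group G] [MulSemiringAction G B]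
    [TopologicalSpace G] [CompactSpace G] [TotallyDisconnectedSpace G] [IsTopologicalGroup G]
    [TopologicalSpace B] [DiscreteTopology B] [ContinuousSMul G B] (Q : Ideal B) [Q.IsPrime]
    (hQ : ∀ g : G, g • Q = Q) {U : Subgroup G} (hU : IsClosed (U : Set G)) {g : G}
    (hg : ∀ b : B, (∀ u ∈ U, u • b = b) → g • b - b ∈ Q) :
    ∃ ρ ∈ U, ∀ b : B, ρ • b - g • b ∈ Q := by
  have : CompactSpace U := isCompact_iff_compactSpace.mp hU.isCompact
  let A := FixedPoints.subring B U
  have : Algebra.IsInvariant A B U := ⟨fun b hb => ⟨⟨b, hb⟩, rfl⟩⟩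
  let e : B ⧸ Q ≃+* B ⧸ Q := Ideal.quotientEquiv Q Q (MulSemiringAction.toRingEquiv G B g)
    (hQ g).symm
  have he : ∀ b : B, e (Ideal.Quotient.mk Q b) = Ideal.Quotient.mk Q (g • b) := fun b => rfl
  let τ : (B ⧸ Q) ≃ₐ[A ⧸ Q.under A] (B ⧸ Q) := AlgEquiv.ofRingEquiv (f := e) fun a => by
    obtain ⟨a, rfl⟩ := Ideal.Quotient.mk_surjective a
    change e (Ideal.Quotient.mk Q a.1) = Ideal.Quotient.mk Q a.1
    rw [he, Ideal.Quotient.eq]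
    exact hg a.1 fun u hu => a.2 ⟨u, hu⟩
  -- By assumption `g` induces an automorphism of the residue ring over that of the `U`-invariants.
  -- A profinite decomposition group surjects onto such automorphisms.
  obtain ⟨ρ, hρ⟩ := Ideal.Quotient.stabilizerHom_surjective_of_profinite (G := U)
    (Q.under A) Q τ
  refine ⟨ρ.1.1, ρ.1.2, fun b => ?_⟩
  rw [← Ideal.Quotient.eq]
  exact DFunLike.congr_fun hρ (Ideal.Quotient.mk Q b)

end ProfiniteAction

section FiniteField

/-- An automorphism of an extension of a finite field is a power of the Frobenius on every finite
subextension. -/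
theorem exists_forall_eq_pow_card {k F : Type*} [Field k] [Finite k] [Field F] [Algebra k F]
    (τ : F ≃ₐ[k] F) (S : IntermediateField k F) [FiniteDimensional k S] :
    ∃ n : ℕ, ∀ x ∈ S, τ x = x ^ Nat.card k ^ n := by
  let := Fintype.ofFinite k
  have : Finite S := Module.finite_of_finite k
  obtain ⟨n, hn⟩ := (FiniteField.bijective_frobeniusAlgEquivOfAlgebraic_pow k S).2
    (τ.restrictNormal S)
  refine ⟨n, fun x hx => ?_⟩
  have h1 := τ.restrictNormal_commutes S ⟨x, hx⟩
  rw [← hn, AlgEquiv.coe_pow, FiniteField.coe_frobeniusAlgEquivOfAlgebraic_iterate,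
    ← Nat.card_eq_fintype_card] at h1
  exact h1.symm

end FiniteField

section Density

open scoped NNReal Pointwise

variable {OK : Type v} [CommRing OK] {K : Type w} [Field K] [Algebra OK K] {p : ℕ}
  {v : Valuation (AlgebraicClosure K) ℝ≥0} (hv : IsGaloisValuation OK K p v)

include hv in
theorem IsGaloisValuation.isMaximal_maxBar : (maxBar OK K).IsMaximal := by
  rw [Ideal.isMaximal_iff]
  refine ⟨fun h => hv.maxBar_ne_top ((Ideal.eq_top_iff_one _).mpr h), fun J x _ hx hxJ => ?_⟩
  rw [hv.mem_maxBar, not_lt] at hx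
  exact (Ideal.eq_top_iff_one J).mp (Ideal.eq_top_of_isUnit_mem J hxJ
    ((hv.isUnit_iff x).mpr (le_antisymm ((hv.le_one_iff x).mpr x.2) hx)))

theorem smul_maxBar (σ : Gal(AlgebraicClosure K/K)) : σ • maxBar OK K = maxBar OK K := by
  ext x
  rw [Ideal.mem_pointwise_smul_iff_inv_smul_mem]
  refine ⟨fun h => ?_, smul_mem_maxBar OK K σ⁻¹⟩
  have := smul_mem_maxBar OK K σ h
  rwa [smul_inv_smul] at this

/-- Modulo the inertia of the residue field, every automorphism agrees with a power of a Frobenius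
lift on the integers of a finite extension. -/
theorem IsGaloisValuation.exists_pow_frobenius [IsDomain OK] [IsDiscreteValuationRing OK]
    [IsFractionRing OK K] [CharZero K] (hv : IsGaloisValuation OK K p v)
    {φ : Gal(AlgebraicClosure K/K)} (hφ : IsFrobeniusLift OK K φ)
    (σ : Gal(AlgebraicClosure K/K)) (E : IntermediateField K (AlgebraicClosure K))
    [FiniteDimensional K E] :
    ∃ n : ℕ, ∀ b : intBar OK K, (b : AlgebraicClosure K) ∈ E →
      σ • b - φ ^ n • b ∈ maxBar OK K := by
  set Q := maxBar OK K with hQ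
  have hQm : Q.IsMaximal := hv.isMaximal_maxBar
  let 𝔭 : Ideal OK := Q.under OK
  have h𝔭 : 𝔭.IsMaximal := Ideal.isMaximal_comap_of_isIntegral_of_isMaximal Q
  let : Field (OK ⧸ 𝔭) := Ideal.Quotient.field 𝔭
  let : Field (intBar OK K ⧸ Q) := Ideal.Quotient.field Q
  have : Finite (OK ⧸ 𝔭) := hv.finite_residue hφ
  let τ : (intBar OK K ⧸ Q) ≃ₐ[OK ⧸ 𝔭] (intBar OK K ⧸ Q) :=
    Ideal.Quotient.stabilizerHom Q 𝔭 Gal(AlgebraicClosure K/K) ⟨σ, smul_maxBar σ⟩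
  have hτ : ∀ b : intBar OK K, τ (Ideal.Quotient.mk Q b) = Ideal.Quotient.mk Q (σ • b) :=
    fun b => rfl
  let C := integralClosure OK E
  have : Module.Finite OK C := IsIntegralClosure.finite OK K E C
  let ι : C →ₐ[OK] intBar OK K :=
    ((E.val.restrictScalars OK).comp C.val).codRestrict _ fun c =>
      c.2.map (E.val.restrictScalars OK)
  have hι : ∀ c, (ι c : AlgebraicClosure K) = ((c : E) : AlgebraicClosure K) := fun c => rfl
  let f : C →ₐ[OK] (intBar OK K ⧸ Q) := (Ideal.Quotient.mkₐ OK Q).comp ι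
  obtain ⟨T, hT⟩ := (Module.Finite.fg_top : (⊤ : Submodule OK C).FG)
  -- The integers of `E` are a finite module over `OK`, so their residues lie in a finite extension
  -- of the residue field, where every automorphism is a power of Frobenius.
  let S : IntermediateField (OK ⧸ 𝔭) (intBar OK K ⧸ Q) :=
    IntermediateField.adjoin _ (f '' T)
  have : Finite (f '' (T : Set C)) := (T.finite_toSet.image f).to_subtype
  have : FiniteDimensional (OK ⧸ 𝔭) S := IntermediateField.finiteDimensional_adjoin
    fun x _ => Algebra.IsIntegral.isIntegral x
  have hS : ∀ c : C, f c ∈ S := fun c => by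
    have hc : c ∈ Submodule.span OK (T : Set C) := hT ▸ Submodule.mem_top
    induction hc using Submodule.span_induction with
    | mem x hx => exact IntermediateField.subset_adjoin _ _ ⟨x, hx, rfl⟩
    | zero => rw [map_zero]; exact zero_mem _
    | add x y _ _ hx hy => rw [map_add]; exact add_mem hx hy
    | smul a x _ hx =>
      rw [map_smul]
      exact S.smul_mem (x := Ideal.Quotient.mk 𝔭 a) hx
  obtain ⟨n, hn⟩ := exists_forall_eq_pow_card τ S
  refine ⟨n, fun b hb => ?_⟩
  have hfrob : ∀ (m : ℕ) (b : intBar OK K),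
      Ideal.Quotient.mk Q (φ ^ m • b) = Ideal.Quotient.mk Q b ^ residueCard OK K ^ m := by
    intro m b
    induction m with
    | zero => simp
    | succ m ih =>
      rw [pow_succ', mul_smul, pow_succ, pow_mul, ← ih, ← map_pow, Ideal.Quotient.eq]
      exact hφ _
  have hbC : IsIntegral OK (⟨b, hb⟩ : E) :=
    (isIntegral_algHom_iff (E.val.restrictScalars OK) Subtype.val_injective).mp b.2
  have h1 := hn _ (hS ⟨_, hbC⟩)
  have h2 : f ⟨_, hbC⟩ = Ideal.Quotient.mk Q b := rfl
  rw [h2, hτ] at h1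
  rw [← Ideal.Quotient.eq, hfrob, h1]
  rfl

/-- Density of `W`. On the integers of a finite extension `E`, `σ` agrees modulo the maximal ideal
with a power of Frobenius. The discrepancy is therefore an inertia element times one fixing `E`, and
inertia is approximated by `s` and wild inertia. -/
theorem IsGaloisValuation.exists_weilGroup_inv_mul_mem [IsDomain OK] [IsDiscreteValuationRing OK]
    [IsFractionRing OK K] [CharZero K] (hv : IsGaloisValuation OK K p v)
    {φ s : Gal(AlgebraicClosure K/K)} (hφ : IsFrobeniusLift OK K φ)
    (hs : IsTameGenerator OK K s) {U : Subgroup Gal(AlgebraicClosure K/K)}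
    (hU : IsOpen (U : Set Gal(AlgebraicClosure K/K))) (σ : Gal(AlgebraicClosure K/K)) :
    ∃ w ∈ weilGroup OK K φ s, w⁻¹ * σ ∈ U := by
  obtain ⟨E, hE, hEU⟩ := (krullTopology_mem_nhds_one_iff K (AlgebraicClosure K) _).mp
    (hU.mem_nhds U.one_mem)
  set Q := maxBar OK K with hQ
  have hQm : Q.IsMaximal := hv.isMaximal_maxBar
  have hQi : ∀ (g : Gal(AlgebraicClosure K/K)) {b : intBar OK K}, g • b ∈ Q → b ∈ Q :=
    fun g b h => by
      have := smul_mem_maxBar OK K g⁻¹ h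
      rwa [inv_smul_smul] at this
  obtain ⟨n, hn⟩ := hv.exists_pow_frobenius hφ σ E
  let : TopologicalSpace (intBar OK K) := ⊥
  have : DiscreteTopology (intBar OK K) := ⟨rfl⟩
  have : ContinuousSMul Gal(AlgebraicClosure K/K) (intBar OK K) := by
    rw [continuousSMul_iff_stabilizer_isOpen]
    intro b
    have h1 := stabilizer_isOpen_of_isIntegral (K := K) (b : AlgebraicClosure K)
    convert h1 using 1
    ext g
    simp only [SetLike.mem_coe, MulAction.mem_stabilizer_iff]
    exact Subtype.ext_iff
  obtain ⟨ρ, hρ, hρb⟩ := exists_mem_smul_sub_mem Q smul_maxBar E.fixingSubgroup_isClosed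
    (g := (φ ^ n)⁻¹ * σ) fun b hb => by
      have hbE : (b : AlgebraicClosure K) ∈ E := by
        rw [← InfiniteGalois.fixedField_fixingSubgroup E, IntermediateField.mem_fixedField_iff]
        exact fun u hu => congrArg Subtype.val (hb u hu)
      refine hQi (φ ^ n) ?_
      rw [smul_sub, mul_smul, smul_inv_smul]
      exact hn b hbE
  have hI : (φ ^ n)⁻¹ * σ * ρ⁻¹ ∈ inertiaGroup OK K := fun b => by
    have h1 := neg_mem (hρb (ρ⁻¹ • b))
    rw [neg_sub, smul_inv_smul, smul_smul] at h1
    exact h1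
  rw [← hs] at hI
  have hI' : (φ ^ n)⁻¹ * σ * ρ⁻¹ ∈
      closure ((Subgroup.closure {s} ⊔ wildInertia OK K : Subgroup _) : Set _) := hI
  obtain ⟨y, hy1, hy2⟩ := mem_closure_iff.mp hI' _
    (hU.leftCoset ((φ ^ n)⁻¹ * σ * ρ⁻¹)) ⟨1, U.one_mem, by simp⟩
  obtain ⟨u, hu, rfl⟩ := hy1
  refine ⟨φ ^ n * ((φ ^ n)⁻¹ * σ * ρ⁻¹ * u), mul_mem (pow_mem ?_ n) ?_, ?_⟩
  · exact Subgroup.mem_sup_left (Subgroup.subset_closure (Or.inl rfl))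
  · refine (sup_le_sup_right (Subgroup.closure_mono ?_) _) hy2
    exact Set.singleton_subset_iff.mpr (Or.inr rfl)
  · have h1 : (φ ^ n * ((φ ^ n)⁻¹ * σ * ρ⁻¹ * u))⁻¹ * σ = u⁻¹ * ρ := by group
    rw [h1]
    exact mul_mem (inv_mem hu) (hEU hρ)

end Density


/-! ### Absolute irreducibility and the span of the image -/

section Span

theorem pos_of_isAbsolutelyIrreducible {F G : Type*} [Field F] [Group G] {d : ℕ}
    {ρ : G →* GL (Fin d) F} (h : IsAbsolutelyIrreducible (toRep ρ)) : 0 < d := by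
  by_contra hd
  obtain rfl : d = 0 := by omega
  have h1 := (Representation.irreducible_iff_isSimpleModule_asModule _).mp h
  have h2 := h1.nontrivial
  have h3 : Subsingleton (TensorProduct F (AlgebraicClosure F) (Fin 0 → F)) :=
    (TensorProduct.congr (LinearEquiv.refl F _)
      (LinearEquiv.refl F (Fin 0 → F))).toEquiv.subsingleton_congr.mpr
      ⟨fun x y => by
        have : ∀ z : TensorProduct F (AlgebraicClosure F) (Fin 0 → F), z = 0 := fun z => by
          induction z using TensorProduct.induction_on with
          | zero => rfl
          | tmul a b => rw [Subsingleton.elim b 0, TensorProduct.tmul_zero]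
          | add x y hx hy => rw [hx, hy, add_zero]
        rw [this x, this y]⟩
  exact not_subsingleton_iff_nontrivial.mpr h2 h3

/-- A linear form vanishing on the image of an absolutely irreducible representation is zero. -/
theorem eq_zero_of_isAbsolutelyIrreducible {F G : Type*} [Field F] [Group G] {d : ℕ}
    {ρ : G →* GL (Fin d) F} (h : IsAbsolutelyIrreducible (toRep ρ)) {c : Fin d → Fin d → F}
    (hc : ∀ g, ∑ i, ∑ j, (ρ g).1 i j * c i j = 0) (i j : Fin d) : c i j = 0 := by
  let B := Algebra.TensorProduct.basis (AlgebraicClosure F) (Pi.basisFun F (Fin d))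
  -- The linear form with coefficients `c`, extended to the algebraic closure. It vanishes on the
  -- image of the group, which spans by Burnside's theorem.
  let Λ : Module.End (AlgebraicClosure F) (TensorProduct F (AlgebraicClosure F) (Fin d → F)) →ₗ[(AlgebraicClosure F)] (AlgebraicClosure F) :=
    { toFun := fun T => ∑ i, ∑ j, LinearMap.toMatrix B B T i j * algebraMap F (AlgebraicClosure F) (c i j)
      map_add' := fun S T => by
        simp only [map_add, Matrix.add_apply, add_mul, Finset.sum_add_distrib]
      map_smul' := fun a T => by
        simp only [map_smul, Matrix.smul_apply, smul_eq_mul, mul_assoc, Finset.mul_sum,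
          RingHom.id_apply] }
  have hspan := span_range_eq_top_of_isIrreducible _ h
  have hΛ : Λ = 0 := by
    rw [← LinearMap.ker_eq_top, ← top_le_iff, ← hspan, Submodule.span_le]
    rintro _ ⟨g, rfl⟩
    have h1 : ∀ i j, LinearMap.toMatrix B B ((toRep ρ g).baseChange (AlgebraicClosure F)) i j =
        algebraMap F (AlgebraicClosure F) ((ρ g).1 i j) := fun i j => by
      rw [LinearMap.toMatrix_baseChange, Matrix.map_apply]
      congr 1
      rw [← LinearMap.toMatrix'_toLin' (ρ g).1]
      rfl
    change ∑ i, ∑ j, LinearMap.toMatrix B B ((toRep ρ g).baseChange (AlgebraicClosure F)) i j *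
      algebraMap F (AlgebraicClosure F) (c i j) = 0
    simp only [h1, ← map_mul, ← map_sum, hc, map_zero]
  have h2 := LinearMap.congr_fun hΛ (Matrix.toLin B B (Matrix.single i j 1))
  change ∑ i', ∑ j', LinearMap.toMatrix B B (Matrix.toLin B B (Matrix.single i j 1)) i' j' *
      algebraMap F (AlgebraicClosure F) (c i' j') = 0 at h2
  rw [LinearMap.toMatrix_toLin, Finset.sum_eq_single i, Finset.sum_eq_single j,
    Matrix.single_apply_same, one_mul] at h2
  · exact (map_eq_zero_iff _ (algebraMap F (AlgebraicClosure F)).injective).mp h2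
  · intro j' _ hj
    rw [Matrix.single_apply, if_neg fun h => hj h.2.symm, zero_mul]
  · simp
  · intro i' _ hi
    exact Finset.sum_eq_zero fun j' _ => by
      rw [Matrix.single_apply, if_neg fun h => hi h.1.symm, zero_mul]
  · simp

/-- A set of integral matrices whose reductions are annihilated by no nonzero linear form spans the
matrix algebra over the fraction field. -/
theorem span_eq_top_of_reduction {O L ι : Type*} [CommRing O] [IsDomain O]
    [IsDiscreteValuationRing O] [Field L] [Algebra O L] [IsFractionRing O L] {d : ℕ}
    (A : ι → Matrix (Fin d) (Fin d) O)
    (h : ∀ c : Fin d → Fin d → IsLocalRing.ResidueField O,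
      (∀ x, ∑ i, ∑ j, IsLocalRing.residue O (A x i j) * c i j = 0) → ∀ i j, c i j = 0) :
    Submodule.span L (Set.range fun x => (A x).map (algebraMap O L)) = ⊤ := by
  by_contra hne
  obtain ⟨f, hf0, hf⟩ := Submodule.exists_le_ker_of_lt_top _ (lt_top_iff_ne_top.mpr hne)
  have hfM : ∀ M : Matrix (Fin d) (Fin d) L, f M = ∑ i, ∑ j, M i j * f (Matrix.single i j 1) :=
    fun M => by
      conv_lhs => rw [Matrix.matrix_eq_sum_single M]
      simp only [map_sum]
      refine Finset.sum_congr rfl fun i _ => Finset.sum_congr rfl fun j _ => ?_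
      have : Matrix.single i j (M i j) = M i j • Matrix.single i j (1 : L) := by
        rw [Matrix.smul_single, smul_eq_mul, mul_one]
      rw [this, map_smul, smul_eq_mul]
  obtain ⟨b, hb⟩ := IsLocalization.exist_integer_multiples_of_finite (nonZeroDivisors O)
    fun ij : Fin d × Fin d => f (Matrix.single ij.1 ij.2 1)
  choose c hc using hb
  have hb0 : algebraMap O L b ≠ 0 :=
    IsFractionRing.to_map_ne_zero_of_mem_nonZeroDivisors b.2
  have hcx : ∀ x, ∑ i, ∑ j, A x i j * c (i, j) = 0 := fun x => by
    refine IsFractionRing.injective O L ?_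
    have h1 : f ((A x).map (algebraMap O L)) = 0 := hf (Submodule.subset_span ⟨x, rfl⟩)
    rw [hfM] at h1
    have h2 := congrArg (fun y => algebraMap O L b * y) h1
    simp only [mul_zero, Finset.mul_sum] at h2
    rw [map_zero, map_sum, ← h2]
    refine Finset.sum_congr rfl fun i _ => ?_
    rw [map_sum]
    refine Finset.sum_congr rfl fun j _ => ?_
    rw [map_mul, hc, Matrix.map_apply, Algebra.smul_def]
    ring
  have hc0 : ∃ ij, c ij ≠ 0 := by
    by_contra h0
    push Not at h0
    refine hf0 (LinearMap.ext fun M => ?_)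
    rw [hfM]
    refine Finset.sum_eq_zero fun i _ => Finset.sum_eq_zero fun j _ => ?_
    have h1 := hc (i, j)
    rw [h0, map_zero, Algebra.smul_def] at h1
    rw [(mul_eq_zero.mp h1.symm).resolve_left hb0, mul_zero]
  -- After clearing denominators, divide the linear form by a generator of its content ideal. Some
  -- coefficient of the quotient is a unit, yet the reduction of the quotient annihilates the
  -- reduced matrices.
  let J := Ideal.span (Set.range c)
  obtain ⟨g, hg⟩ : ∃ g, J = Ideal.span {g} := (IsPrincipalIdealRing.principal J).principal
  have hg0 : g ≠ 0 := fun h0 => by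
    obtain ⟨ij, hij⟩ := hc0
    have h1 : c ij ∈ J := Ideal.subset_span ⟨ij, rfl⟩
    rw [hg, h0, Ideal.mem_span_singleton, zero_dvd_iff] at h1
    exact hij h1
  have hdvd : ∀ ij, ∃ a, c ij = g * a := fun ij => by
    have h1 : c ij ∈ J := Ideal.subset_span ⟨ij, rfl⟩
    rwa [hg, Ideal.mem_span_singleton] at h1
  choose a ha using hdvd
  have ha0 := h (fun i j => IsLocalRing.residue O (a (i, j))) fun x => by
    have h1 : ∑ i, ∑ j, A x i j * a (i, j) = 0 := by
      refine mul_left_cancel₀ hg0 ?_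
      rw [mul_zero, ← hcx x, Finset.mul_sum]
      refine Finset.sum_congr rfl fun i _ => ?_
      rw [Finset.mul_sum]
      refine Finset.sum_congr rfl fun j _ => ?_
      rw [ha]
      ring
    rw [← map_zero (IsLocalRing.residue O), ← h1]
    simp only [map_sum, map_mul]
  have hle : J ≤ Ideal.span {g} * IsLocalRing.maximalIdeal O := by
    refine Ideal.span_le.mpr ?_
    rintro _ ⟨ij, rfl⟩
    rw [ha]
    exact Ideal.mul_mem_mul (Ideal.mem_span_singleton_self g)
      ((IsLocalRing.residue_eq_zero_iff _).mp (ha0 ij.1 ij.2))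
  have hgm : g ∈ Ideal.span {g} * IsLocalRing.maximalIdeal O :=
    hle (hg ▸ Ideal.mem_span_singleton_self g)
  obtain ⟨z, hz, hgz⟩ := Ideal.mem_span_singleton_mul.mp hgm
  have hz1 : z = 1 := mul_left_cancel₀ hg0 (by rw [hgz, mul_one])
  rw [hz1] at hz
  exact (Ideal.ne_top_iff_one _).mp (Ideal.IsPrime.ne_top inferInstance) hz

end Span


/-! ### The tame datum of a representation of the Galois group -/

section GaloisDatum

open scoped NNReal

variable {p l : ℕ} [Fact p.Prime] [Fact l.Prime] {OK : Type v} [CommRing OK] [IsDomain OK]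
  [IsDiscreteValuationRing OK] {K : Type w} [Field K] [CharZero K] [Algebra OK K]
  [IsFractionRing OK K]
  {O : Type u} [CommRing O] [IsDomain O] [IsDiscreteValuationRing O] [Algebra ℤ_[l] O]
  {L : Type u} [Field L] [CharZero L] [Algebra O L] [IsFractionRing O L]
  {v : Valuation (AlgebraicClosure K) ℝ≥0}
  {φ s : Gal(AlgebraicClosure K/K)} {d m : ℕ} {r : Gal(AlgebraicClosure K/K) →* GL (Fin d) O}

/-- By density `W` has the same image as the full Galois group modulo the maximal ideal. Burnside's
theorem for the reduction then lifts to the fraction field. -/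
theorem IsGaloisValuation.span_weilGroup_eq_top (hv : IsGaloisValuation OK K p v)
    (hφ : IsFrobeniusLift OK K φ) (hs : IsTameGenerator OK K s) (hr : IsAdicContinuous K r)
    (hirr : IsAbsolutelyIrreducible (reduction K r)) :
    Submodule.span L (Set.range fun w : weilGroup OK K φ s =>
      (r w.1).1.map (algebraMap O L)) = ⊤ := by
  refine span_eq_top_of_reduction (fun w : weilGroup OK K φ s => (r w.1).1) fun c hc => ?_
  refine eq_zero_of_isAbsolutelyIrreducible hirr fun σ => ?_
  obtain ⟨U, hU, hU1⟩ := hr 1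
  obtain ⟨w, hw, hwσ⟩ := hv.exists_weilGroup_inv_mul_mem hφ hs hU σ
  have h1 : ∀ i j, IsLocalRing.residue O ((r σ).1 i j) = IsLocalRing.residue O ((r w).1 i j) := by
    intro i j
    have h2 : (r σ).1 = (r w).1 * ((r (w⁻¹ * σ)).1 - 1) + (r w).1 := by
      rw [mul_sub, mul_one, sub_add_cancel, ← Units.val_mul, ← map_mul, mul_inv_cancel_left]
    rw [h2, Matrix.add_apply, map_add, Matrix.mul_apply, map_sum]
    have h3 : ∀ x, IsLocalRing.residue O ((r w).1 i x * ((r (w⁻¹ * σ)).1 - 1) x j) = 0 := fun x => by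
      have h4 := hU1 _ hwσ x j
      rw [pow_one] at h4
      rw [IsLocalRing.residue_eq_zero_iff]
      exact Ideal.mul_mem_left _ _ h4
    rw [Finset.sum_eq_zero fun x _ => h3 x, zero_add]
  have h5 := hc ⟨w, hw⟩
  simp only [← h1] at h5
  exact h5

variable (L) in
theorem IsGaloisValuation.exists_tameDatum (hv : IsGaloisValuation OK K p v) (hpl : p ≠ l)
    (hφ : IsFrobeniusLift OK K φ) (hs : IsTameGenerator OK K s)
    (hr : IsAdicContinuous K r) (hirr : IsAbsolutelyIrreducible (reduction K r)) :
    ∃ D : TameDatum L (weilGroup OK K φ s) d, IsCompatible l r D := by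
  set W := weilGroup OK K φ s with hW
  have hPn := hv.normal_wildInertia
  have hsI := hv.mem_inertiaGroup_of_isTameGenerator hs
  have htame := hv.tame_relation hφ hsI
  set q := residueCard OK K with hq
  have hq2 : 2 ≤ q := hv.two_le_residueCard hφ
  have hφW : φ ∈ W := Subgroup.mem_sup_left (Subgroup.subset_closure (Or.inl rfl))
  have hsW : s ∈ W := Subgroup.mem_sup_left (Subgroup.subset_closure (Or.inr rfl))
  let φ' : W := ⟨φ, hφW⟩
  let s' : W := ⟨s, hsW⟩
  let P : Subgroup W := (wildInertia OK K).subgroupOf W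
  have hP : P.Normal := inferInstance
  have form : ∀ g : W, ∃ (a : ℕ) (b : ℤ) (c : ℕ), ∃ x ∈ P,
      g = (φ' ^ a)⁻¹ * s' ^ b * φ' ^ c * x := fun g => by
    obtain ⟨a, b, c, x, hx, hg⟩ := exists_normalForm_mod htame g.2
    exact ⟨a, b, c, ⟨x, Subgroup.mem_sup_right hx⟩, hx, Subtype.ext hg⟩
  -- The valuation on `W` is extracted from the cyclotomic character: it is trivial on inertia and
  -- equals `q` at Frobenius, so all its values are powers of `q`.
  let χ : W →* Lˣ := (Units.map (algebraMap O L : O →* L)).comp ((cycChar K l O).comp W.subtype)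
  have hχ : ∀ w : W, (χ w : L) = algebraMap O L (cycChar K l O w.1 : O) := fun w => rfl
  have hχφ : (χ φ' : L) = q := by
    rw [hχ, hv.cycChar_eq hpl fun x hx => hv.frobenius_sub_pow_lt hφ hx, map_natCast]
  have hχI : ∀ w : W, w.1 ∈ inertiaGroup OK K → χ w = 1 := fun w hw => by
    refine Units.ext ?_
    rw [hχ, hv.cycChar_eq (k := 1) hpl fun x hx => by
      rw [pow_one]; exact hv.mem_inertiaGroup.mp hw x hx]
    simp
  have hχP : ∀ x ∈ P, χ x = 1 := fun x hx => hχI x (hv.wildInertia_le hx)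
  obtain ⟨ν, hνφ, hν1, hνq⟩ := exists_valuation_of_character hq2 form χ hχφ (hχI s' hsI) hχP
  have hνs : ν s' = 1 := (hν1 _).mpr (hχI s' hsI)
  have hνP : ∀ x ∈ P, ν x = 1 := fun x hx => (hν1 x).mpr (hχP x hx)
  have hq0 : (q : L) ≠ 0 := by exact_mod_cast (by omega : q ≠ 0)
  have htame' : (s' ^ q)⁻¹ * (φ' * s' * φ'⁻¹) ∈ P := htame
  obtain ⟨t, ht, htφ, htP, hts⟩ := exists_tameCocycle_mod hq0 htame' form ν hνφ hνs hνP
  obtain ⟨U, hU, hUr⟩ := hv.exists_open_eq_one hpl hr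
  let rL : W →* GL (Fin d) L :=
    ((Matrix.GeneralLinearGroup.map (algebraMap O L)).comp r).comp W.subtype
  let D : TameDatum L W d :=
    { φ := φ', s := s', P := P, v := ν, q := q, t := t, r := rL
      normal := hP
      two_le := hq2
      v_φ := hνφ
      v_s := hνs
      v_P := hνP
      tame := htame'
      form := form
      t_mul := ht
      t_φ := htφ
      t_P := htP
      t_s := hts
      finite_P := by
        refine ((finite_image_of_open_ker r hU hUr).image
          (Matrix.GeneralLinearGroup.map (algebraMap O L))).subset ?_
        rintro _ ⟨w, hw, rfl⟩
        exact ⟨_, ⟨w.1, hw, rfl⟩, rfl⟩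
      span := hv.span_weilGroup_eq_top hφ hs hr hirr
      pos := pos_of_isAbsolutelyIrreducible hirr }
  refine ⟨D, fun w => rfl, fun w => Iff.rfl, fun w => ?_, hνq, U, hU, fun w hw hwU => ?_⟩
  · have hIn := hv.normal_inertiaGroup
    have h1 : w ∈ D.I ↔ ν w = 1 := MonoidHom.mem_ker
    refine ⟨fun hw => ?_, fun hw => h1.mpr ((hν1 w).mpr (hχI w hw))⟩
    obtain ⟨a, b, c, x, hx, rfl⟩ := form w
    rw [h1] at hw
    simp only [map_mul, map_inv, map_pow, map_zpow, hνφ, hνs, hνP x hx, one_zpow, mul_one] at hw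
    rw [inv_mul_eq_one] at hw
    have hac : a = c := by
      have := congrArg Multiplicative.toAdd hw
      simpa using this
    rw [hac]
    refine mul_mem ?_ (hv.wildInertia_le hx)
    have h2 := hIn.conj_mem _ (zpow_mem hsI b) (φ ^ c)⁻¹
    rwa [inv_inv] at h2
  · change Matrix.GeneralLinearGroup.map (algebraMap O L) (r w.1) = 1
    rw [hUr w.1 hw hwU, map_one]

end GaloisDatum

end DiscreteSeries

end

theorem mainTheorem5
    (p l : ℕ) [Fact p.Prime] [Fact l.Prime] (hpl : p ≠ l)
    -- `OK` is the ring of integers of the finite extension `K` of `ℚ_p`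
    (OK : Type v) [CommRing OK] [IsDomain OK] [IsDiscreteValuationRing OK] [CharZero OK]
    [Algebra ℤ_[p] OK] [Module.Finite ℤ_[p] OK]
    (K : Type w) [Field K] [Algebra OK K] [IsFractionRing OK K]
    -- `O` is the ring of integers of the finite extension `L` of `ℚ_l`
    (O : Type u) [CommRing O] [IsDomain O] [IsDiscreteValuationRing O] [CharZero O]
    [Algebra ℤ_[l] O] [Module.Finite ℤ_[l] O]
    (L : Type u) [Field L] [Algebra O L] [IsFractionRing O L]
    (φ s : Gal(AlgebraicClosure K/K))
    (hφ : DiscreteSeries.IsFrobeniusLift OK K φ) (hs : DiscreteSeries.IsTameGenerator OK K s)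
    (d n : ℕ) (hn : 0 < n) (hdn : d ∣ n) (hl : n < l)
    (r : Gal(AlgebraicClosure K/K) →* GL (Fin d) O)
    (hr : DiscreteSeries.IsDiscreteSeriesType OK K l (n / d) r) :
    (∃ (A : Type u) (_ : CommRing A) (_ : Algebra L A) (_ : Algebra O A)
        (_ : IsScalarTower O L A), Algebra.Smooth L A ∧
        DiscreteSeries.RepresentsGenericFibre OK l φ s (n / d) n r L A) ∧
      ∀ (X : Scheme.{u}) (f : X ⟶ Spec (CommRingCat.of O)),
        DiscreteSeries.IsModuliSpace OK l φ s (n / d) n r f →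
        Smooth (pullback.snd f (Spec.map (CommRingCat.ofHom (algebraMap O L)))) := by
  have : CharZero K := charZero_of_injective_algebraMap (IsFractionRing.injective OK K)
  have : CharZero L := charZero_of_injective_algebraMap (IsFractionRing.injective O L)
  obtain ⟨v, hv⟩ := DiscreteSeries.exists_isGaloisValuation OK K p
  obtain ⟨D, hD⟩ := hv.exists_tameDatum L hpl hφ hs hr.continuous hr.absolutelyIrreducible
  have : NeZero (n / d) := ⟨(Nat.div_pos (Nat.le_of_dvd hn hdn) D.pos).ne'⟩
  have e : Fin (n / d) × Fin d ≃ Fin n :=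
    finProdFinEquiv.trans (finCongr (Nat.div_mul_cancel hdn))
  obtain ⟨A, i₁, i₂, i₃, i₄, hA, hrep⟩ := hD.exists_represents e
  exact ⟨⟨A, i₁, i₂, i₃, i₄, hA, hrep⟩, fun X f hX =>
    DiscreteSeries.smooth_genericFibre hA hrep f hX⟩
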